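/- Let $p>1$ be real. There is a constant $C=C(p)$, depending only on $p$, such that the following holds for all $0\le s\le 1$, $N>0$, $T>0$. Let $m:\mathbb R\to[0,1]$ be smooth and even with $m(\xi)=1$ for $|\xi|\le N$ and $m(\xi)=(N/|\xi|)^{1-s}$ for $|\xi|\ge 2N$, and let $I$ be the Fourier multiplier $\widehat{If}(\xi)=m(\xi)\widehat f(\xi)$, where $\widehat f(\xi)=\int_{\mathbb R} e^{-ix\xi}f(x)\,dx$, extended to tempered distributions. Let $u\in C([0,T];H^s(\mathbb R))\cap L^{p+1}_{t,x}([0,T]\times\mathbb R)$ be a solution, in the sense of distributions, of the one-dimensional defocusing $p$-NLS $$i\partial_t u+\partial_x^2 u=|u|^{p-1}u,\qquad u(0)=u_0 .$$ Put $$E(v)=\tfrac12\int_{\mathbb R}|\partial_x v|^2\,dx+\tfrac1{p+1}\int_{\mathbb R}|v|^{p+1}\,dx,\qquad F(u)=Iu\,|Iu|^{p-1}-I(u|u|^{p-1}).$$ Then $$\|Iu\|_{L^{p+3}_{t,x}([0,T]\times\mathbb R)}^{p+3}\le C\Big(\|u_0\|_{L^2}^3\,\sup_{t\in[0,T]}E(Iu(t))^{1/2}+\|u_0\|_{L^2}^2\,\sup_{t\in[0,T]}E(Iu(t))^{1/2}\,\|F(u)\|_{L^1_tL^2_x([0,T]\times\mathbb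 R)}\Big),$$ where $\|F(u)\|_{L^1_tL^2_x([0,T]\times\mathbb R)}\in[0,\infty]$. -/

import Mathlib

open MeasureTheory Filter Topology
open scoped SchwartzMap ENNReal NNReal ContDiff LineDeriv

namespace AlmostMorawetz

noncomputable section

/-- The function `f` on the line represents the tempered distribution `S`: for every Schwartz
function `φ`, the product `φ f` is integrable and `⟨S, φ⟩ = ∫ φ f`. -/
def Represents (f : ℝ → ℂ) (S : 𝓢'(ℝ, ℂ)) : Prop :=
  ∀ φ : 𝓢(ℝ, ℂ), Integrable (fun x : ℝ => φ x * f x) ∧ S φ = ∫ x : ℝ, φ x * f x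

open Classical in
/-- The tempered distribution given by the function `f`, for example by any `f` in some `L^q`,
`1 ≤ q ≤ ∞` (and `0` when `f` does not define a tempered distribution). -/
def ofFun (f : ℝ → ℂ) : 𝓢'(ℝ, ℂ) :=
  if h : ∃ S : 𝓢'(ℝ, ℂ), Represents f S then h.choose else 0

open Classical in
/-- A function (unique up to null sets) representing the tempered distribution `S`
(and `0` when there is none). -/
def toFun (S : 𝓢'(ℝ, ℂ)) : ℝ → ℂ :=
  if h : ∃ f : ℝ → ℂ, Represents f S then h.choose else 0

/-- The `L^q(ℝ)` norm of a tempered distribution, in `[0, ∞]`: the `L^q` norm of the function that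
represents it (unique up to null sets), and `∞` if it is not a function. -/
def normL (q : ℝ≥0∞) (S : 𝓢'(ℝ, ℂ)) : ℝ≥0∞ :=
  ⨅ (f : ℝ → ℂ) (_ : Represents f S), eLpNorm f q volume

/-- The inhomogeneous Sobolev norm `‖⟨∇⟩^s S‖_{L²}`, in `[0, ∞]`, with `⟨·⟩` evaluated at the
frequency `ξ` rather than at `2πξ`, which gives an equivalent norm. -/
def normH (s : ℝ) (S : 𝓢'(ℝ, ℂ)) : ℝ≥0∞ :=
  normL 2 (TemperedDistribution.besselPotential ℝ ℂ s S)

/-- The nonlinearity `|f|^{p-1} f`. -/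
def nonlin (p : ℝ) (f : ℝ → ℂ) : ℝ → ℂ :=
  fun x => ((‖f x‖ ^ (p - 1) : ℝ) : ℂ) * f x

/-- `u` solves `i ∂ₜu + ∂ₓ²u = |u|^{p-1} u` on `[0,T] × ℝ` with `u(0) = u₀`, as an `H^s` solution.
The bound in `L^{p+1}_{t,x}`, part of every local theory in `H^s`, makes the nonlinearity a
distribution. -/
structure IsSolution (p s T : ℝ) (u₀ : ℝ → ℂ) (u : ℝ → ℝ → ℂ) : Prop where
  /-- `u(t) ∈ H^s(ℝ)` for every `t ∈ [0,T]` -/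
  memLp : ∀ t ∈ Set.Icc 0 T, MemLp (u t) 2 volume
  memSobolev : ∀ t ∈ Set.Icc 0 T, TemperedDistribution.MemSobolev s 2 (ofFun (u t))
  /-- `t ↦ u(t)` is continuous from `[0,T]` to `H^s(ℝ)` -/
  continuous : ∀ t₀ ∈ Set.Icc 0 T,
    Tendsto (fun t => normH s (ofFun (u t) - ofFun (u t₀))) (𝓝[Set.Icc 0 T] t₀) (𝓝 0)
  /-- `u ∈ L^{p+1}_{t,x}([0,T] × ℝ)` -/
  memLp_spacetime : MemLp (Function.uncurry u) (ENNReal.ofReal (p + 1))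
    ((volume.restrict (Set.Icc 0 T)).prod volume)
  /-- the initial condition -/
  initial : u 0 =ᵐ[volume] u₀
  /-- the equation, tested against Schwartz functions and integrated in time:
  `i⟨u(t),φ⟩ - i⟨u₀,φ⟩ + ∫₀ᵗ ⟨u(τ),φ''⟩ dτ = ∫₀ᵗ ⟨|u|^{p-1}u(τ),φ⟩ dτ` -/
  equation : ∀ φ : 𝓢(ℝ, ℂ), ∀ t ∈ Set.Icc 0 T,
    Complex.I * (∫ x : ℝ, u t x * φ x) - Complex.I * (∫ x : ℝ, u₀ x * φ x)
      + ∫ τ in (0 : ℝ)..t, ∫ x : ℝ, u τ x * iteratedDeriv 2 φ x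
      = ∫ τ in (0 : ℝ)..t, ∫ x : ℝ, nonlin p (u τ) x * φ x

/-- `m` is the symbol of an `I`-operator with parameters `s` and `N`: smooth and radial, with values
in `[0,1]`, equal to `1` for `|ξ| ≤ N` and to `(N/|ξ|)^{1-s}` for `|ξ| ≥ 2N`. -/
structure IsIMultiplier (s N : ℝ) (m : ℝ → ℝ) : Prop where
  smooth : ContDiff ℝ ∞ m
  even : ∀ ξ, m (-ξ) = m ξ
  nonneg : ∀ ξ, 0 ≤ m ξ
  le_one : ∀ ξ, m ξ ≤ 1
  low : ∀ ξ, |ξ| ≤ N → m ξ = 1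
  high : ∀ ξ, 2 * N ≤ |ξ| → m ξ = (N / |ξ|) ^ (1 - s)

/-- The operator `I` with symbol `m`, on tempered distributions. Mathlib's Fourier variable `ξ` is
the frequency, so the symbol is evaluated at the angular frequency `2πξ`. -/
def opI (m : ℝ → ℝ) (S : 𝓢'(ℝ, ℂ)) : 𝓢'(ℝ, ℂ) :=
  TemperedDistribution.fourierMultiplierCLM ℂ (fun ξ : ℝ => ((m (2 * Real.pi * ξ) : ℝ) : ℂ)) S

/-- The energy `E(S) = ½ ‖∂ₓS‖²_{L²} + (1/(p+1)) ‖S‖^{p+1}_{L^{p+1}}`, in `[0, ∞]`. -/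
def energy (p : ℝ) (S : 𝓢'(ℝ, ℂ)) : ℝ≥0∞ :=
  2⁻¹ * normL 2 (TemperedDistribution.derivCLM ℂ S) ^ 2
    + ENNReal.ofReal (1 / (p + 1)) * normL (ENNReal.ofReal (p + 1)) S ^ (p + 1)

/-- The error `F(f) = If |If|^{p-1} - I(f |f|^{p-1})`. -/
def errorF (p : ℝ) (m : ℝ → ℝ) (f : ℝ → ℂ) : 𝓢'(ℝ, ℂ) :=
  ofFun (nonlin p (toFun (opI m (ofFun f)))) - opI m (ofFun (nonlin p f))

/-- The mixed norm `‖S‖_{L^a_t L^b_x([0,T] × ℝ)}`, for finite `a > 0`. -/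
def normMixed (a b T : ℝ) (S : ℝ → 𝓢'(ℝ, ℂ)) : ℝ≥0∞ :=
  (∫⁻ t in Set.Icc 0 T, normL (ENNReal.ofReal b) (S t) ^ a) ^ (1 / a)

end

end AlmostMorawetz

/-! Write `a = Iu` and consider the interaction Morawetz functional `∫ Im(ā a')(x) R(x) dx`, where
`R(x) = ∫_{y ≤ x} |a(y)|² dy`. It is at most `‖a‖₂³ ‖a'‖₂` in absolute value. Suppose `a` solves the
equation up to an error, `i ∂ₜa + a'' = |a|^{p-1} a - E`. The local laws of momentum and mass
express its time derivative, up to the integral of an exact `x`-derivative, as `4 ∫ (Re ā a')² +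
(p-1)/(p+1) ∫ |a|^{p+3}` plus terms linear in `E`. The first term is nonnegative, the second is the
desired norm, and the terms in `E` are at most `6 ‖a‖₂² ‖a'‖₂ ‖E‖₂`, by `R ≤ ‖a‖₂²` and `|a|² ≤ 2
‖a‖₂ ‖a'‖₂`. Integration in time gives the theorem, because `‖a'‖₂` is controlled by the square root
of the energy and `‖a(t)‖₂ ≤ ‖u(t)‖₂ ≤ ‖u₀‖₂`. The pointwise identity is `flux_identity`, and the
inequality at a fixed time for smooth functions is `morawetz_inequality_schwartz`.

The rest of the work is regularity. Since `m(ξ)⟨ξ⟩^{1-s}` is bounded, `Iu` is a continuous curve in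
`H¹`, written `Jg` with `J = ⟨∇⟩⁻¹` and `g` continuous into `L²`; then `Dg` is its derivative. All
terms of the inequality become continuous functions on `L²`. But `∂ₜIu` is not in `H¹`, so the
functional cannot be differentiated along `g`. Averaging in time over `[t, t+h]` repairs this: the
average is differentiable in `L²`, and it solves the equation with an additional commutator error
between averaging and the nonlinearity. The equation itself then puts the second derivative of the
average in `L²`, and `morawetz_inequality` applies by density of Schwartz functions in `H²`. As `h →
0` the commutator error vanishes (`AlmostSolves.integral_le`).

The bound on the mass is a separate argument (`eLpNorm_two_le_of_equation`). The equation is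
mollified in `x`; the Laplacian does not contribute to the change of mass, and the nonlinear
contribution tends to zero, because `u ∈ L^{p+1}` and `|u|^{p-1}u ∈ L^{(p+1)/p}` have dual exponents
and `Im(ū |u|^{p-1}u) = 0`. -/

namespace AlmostMorawetz

/-! ### Functions representing tempered distributions -/

/-- The Hilbert space of complex square-integrable functions on the line. -/
abbrev L2 : Type := Lp ℂ 2 (volume : Measure ℝ)

theorem integrable_schwartz_mul {q : ℝ≥0∞} (hq : 1 ≤ q) {f : ℝ → ℂ} (hf : MemLp f q volume)
    (φ : 𝓢(ℝ, ℂ)) : Integrable (fun x => φ x * f x) := by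
  have := ENNReal.HolderConjugate.inv_one_sub_inv' hq
  have : ENNReal.HolderConjugate (1 - q⁻¹)⁻¹ q := this.symm
  exact (φ.memLp (1 - q⁻¹)⁻¹).integrable_mul hf

theorem Represents.unique {f : ℝ → ℂ} {S S' : 𝓢'(ℝ, ℂ)} (h : Represents f S)
    (h' : Represents f S') : S = S' := by
  ext φ
  rw [(h φ).2, (h' φ).2]

theorem Represents.congr_ae {f g : ℝ → ℂ} {S : 𝓢'(ℝ, ℂ)} (h : Represents f S)
    (hfg : f =ᵐ[volume] g) : Represents g S := by
  intro φ
  have : (fun x => φ x * f x) =ᵐ[volume] fun x => φ x * g x := by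
    filter_upwards [hfg] with x hx using by rw [hx]
  exact ⟨(h φ).1.congr this, (h φ).2.trans (integral_congr_ae this)⟩

theorem Represents.locallyIntegrable {f : ℝ → ℂ} {S : 𝓢'(ℝ, ℂ)} (h : Represents f S) :
    LocallyIntegrable f volume := by
  rw [locallyIntegrable_iff]
  intro K hK
  obtain ⟨R, hR⟩ := hK.isBounded.subset_closedBall (0 : ℝ)
  let χ : ContDiffBump (0 : ℝ) := ⟨max R 1, max R 1 + 1, by positivity, by linarith⟩
  have hg₁ : HasCompactSupport (Complex.ofRealCLM ∘ χ) := χ.hasCompactSupport.comp_left rfl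
  have hg₂ : ContDiff ℝ ∞ (Complex.ofRealCLM ∘ χ) := Complex.ofRealCLM.contDiff.comp χ.contDiff
  refine ((h (hg₁.toSchwartzMap hg₂)).1.integrableOn (s := K)).congr_fun (fun x hx => ?_)
    hK.measurableSet
  have : χ x = 1 := χ.one_of_mem_closedBall
    (Metric.closedBall_subset_closedBall (le_max_left R 1) (hR hx))
  simp [this]

theorem Represents.ae_eq {f g : ℝ → ℂ} {S : 𝓢'(ℝ, ℂ)} (h : Represents f S)
    (h' : Represents g S) : f =ᵐ[volume] g := by
  refine ae_eq_of_integral_contDiff_smul_eq h.locallyIntegrable h'.locallyIntegrable ?_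
  intro χ hχ hc
  have hg₁ : HasCompactSupport (Complex.ofRealCLM ∘ χ) := hc.comp_left rfl
  have hg₂ : ContDiff ℝ ∞ (Complex.ofRealCLM ∘ χ) := by fun_prop
  have := (h (hg₁.toSchwartzMap hg₂)).2.symm.trans (h' (hg₁.toSchwartzMap hg₂)).2
  simpa using this

theorem represents_Lp {q : ℝ≥0∞} [hq : Fact (1 ≤ q)] (f : Lp ℂ q (volume : Measure ℝ)) :
    Represents f (Lp.toTemperedDistribution f) := fun φ =>
  ⟨integrable_schwartz_mul hq.out (Lp.memLp f) φ, by simp⟩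

theorem represents_toLp {q : ℝ≥0∞} [hq : Fact (1 ≤ q)] {f : ℝ → ℂ} (hf : MemLp f q volume) :
    Represents f (Lp.toTemperedDistribution (hf.toLp f)) :=
  (represents_Lp _).congr_ae hf.coeFn_toLp

theorem Represents.ofFun_eq {f : ℝ → ℂ} {S : 𝓢'(ℝ, ℂ)} (h : Represents f S) : ofFun f = S := by
  have hex : ∃ S : 𝓢'(ℝ, ℂ), Represents f S := ⟨S, h⟩
  rw [ofFun, dif_pos hex]
  exact hex.choose_spec.unique h

theorem Represents.toFun_ae_eq {f : ℝ → ℂ} {S : 𝓢'(ℝ, ℂ)} (h : Represents f S) :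
    toFun S =ᵐ[volume] f := by
  have hex : ∃ f : ℝ → ℂ, Represents f S := ⟨f, h⟩
  rw [toFun, dif_pos hex]
  exact hex.choose_spec.ae_eq h

/-- The representing function is unique almost everywhere, so the infimum in `normL` runs over a
single class. -/
theorem Represents.normL_eq {f : ℝ → ℂ} {S : 𝓢'(ℝ, ℂ)} (h : Represents f S) (q : ℝ≥0∞) :
    normL q S = eLpNorm f q volume :=
  le_antisymm (iInf₂_le f h)
    (le_iInf₂ fun _ hg => (eLpNorm_congr_ae (h.ae_eq hg)).le)

theorem ofFun_toLp {q : ℝ≥0∞} [Fact (1 ≤ q)] {f : ℝ → ℂ} (hf : MemLp f q volume) :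
    ofFun f = Lp.toTemperedDistribution (hf.toLp f) :=
  (represents_toLp hf).ofFun_eq

theorem normL_two_toTemperedDistribution (f : L2) :
    normL 2 (Lp.toTemperedDistribution f) = ‖f‖ₑ := by
  rw [(represents_Lp f).normL_eq, Lp.enorm_def]

theorem enorm_schwartz_toLp (φ : 𝓢(ℝ, ℂ)) :
    ‖φ.toLp 2 (volume : Measure ℝ)‖ₑ = eLpNorm φ 2 volume := by
  rw [← ofReal_norm, SchwartzMap.norm_toLp, ENNReal.ofReal_toReal (φ.eLpNorm_lt_top 2 volume).ne]

theorem enorm_apply_le_normL (S : 𝓢'(ℝ, ℂ)) (φ : 𝓢(ℝ, ℂ)) :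
    ‖S φ‖ₑ ≤ normL 2 S * ‖φ.toLp 2 volume‖ₑ := by
  by_cases h : ∃ f, Represents f S
  · obtain ⟨f, hf⟩ := h
    have hφ := enorm_schwartz_toLp φ
    have hφm : AEStronglyMeasurable (φ : ℝ → ℂ) volume := φ.continuous.aestronglyMeasurable
    have hfm : AEStronglyMeasurable f volume := hf.locallyIntegrable.aestronglyMeasurable
    have hint := eLpNorm_smul_le_mul_eLpNorm (p := 2) (q := 2) (r := 1) hfm hφm
    calc ‖S φ‖ₑ = ‖∫ x, φ x * f x‖ₑ := by rw [(hf φ).2]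
      _ ≤ ∫⁻ x, ‖φ x • f x‖ₑ := enorm_integral_le_lintegral_enorm _
      _ = eLpNorm (fun x => φ x • f x) 1 volume := eLpNorm_one_eq_lintegral_enorm.symm
      _ ≤ eLpNorm f 2 volume * eLpNorm φ 2 volume := hint.trans (mul_comm _ _).le
      _ = _ := by rw [hf.normL_eq, hφ]
  -- If no function represents `S`, the norm is infinite and the right side is `⊤`, except in the
  -- case `0 * ⊤ = 0`; then `φ` vanishes in `L²`, hence as a Schwartz function, and the left side is
  -- zero too.
  · have hS : normL 2 S = ⊤ := by
      simp only [normL, iInf_eq_top]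
      exact fun f hf => absurd ⟨f, hf⟩ h
    by_cases hφ : φ.toLp 2 (volume : Measure ℝ) = 0
    · have : φ = 0 := by
        apply SchwartzMap.injective_toLp 2 volume
        exact hφ.trans (map_zero (SchwartzMap.toLpCLM ℂ ℂ 2 (volume : Measure ℝ))).symm
      simp [this]
    · rw [hS, ENNReal.top_mul (enorm_ne_zero.mpr hφ)]
      exact le_top

/-- A functional on Schwartz functions that is bounded in `L²` is given by a function in `L²`. -/
theorem exists_L2_of_bound (l : 𝓢(ℝ, ℂ) →ₗ[ℂ] ℂ) {A : ℝ} (hA : 0 ≤ A)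
    (h : ∀ φ : 𝓢(ℝ, ℂ), ‖l φ‖ ≤ A * ‖φ.toLp 2 volume‖) :
    ∃ E : L2, ‖E‖ ≤ A ∧ ∀ φ : 𝓢(ℝ, ℂ), l φ = Lp.toTemperedDistribution E φ := by
  let e : 𝓢(ℝ, ℂ) →ₗ[ℂ] L2 := (SchwartzMap.toLpCLM ℂ ℂ 2 (volume : Measure ℝ)).toLinearMap
  have hd : DenseRange e := SchwartzMap.denseRange_toLpCLM ENNReal.ofNat_ne_top
  let L : L2 →L[ℂ] ℂ := l.extendOfNorm e
  have hL : ‖L‖ ≤ A := l.opNorm_extendOfNorm_le hd hA h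
  let G : L2 := (InnerProductSpace.toDual ℂ L2).symm L
  -- The Riesz representative is conjugated because the pairing of a distribution with a test
  -- function is bilinear, whereas the inner product is conjugate-linear in its first argument.
  refine ⟨star G, ?_, ?_⟩
  · have : ‖star G‖ = ‖G‖ := by
      rw [Lp.norm_def, Lp.norm_def, eLpNorm_congr_ae (Lp.coeFn_star G), eLpNorm_star]
    rw [this]
    simpa [G] using hL
  · intro φ
    have h1 : L (e φ) = l φ := LinearMap.extendOfNorm_eq hd ⟨A, h⟩ φ
    have h2 : inner ℂ G (e φ) = L (e φ) := InnerProductSpace.toDual_symm_apply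
    rw [← h1, ← h2, L2.inner_def, Lp.toTemperedDistribution_apply]
    refine integral_congr_ae ?_
    filter_upwards [φ.coeFn_toLp 2 volume, Lp.coeFn_star G] with x hx hx'
    rw [hx']
    change inner ℂ (G x) (φ.toLp 2 volume x) = _
    rw [hx]
    simp

/-! ### Fourier multipliers on `L²` -/

theorem toTemperedDistribution_injective :
    Function.Injective (fun f : L2 => (Lp.toTemperedDistribution f : 𝓢'(ℝ, ℂ))) :=
  LinearMap.ker_eq_bot.mp
    (Lp.ker_toTemperedDistributionCLM_eq_bot (F := ℂ) (μ := (volume : Measure ℝ)) (p := 2))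

/-- The symbol `σ` is smooth, of temperate growth, and bounded by `C`. -/
structure IsBddSymbol (σ : ℝ → ℂ) (C : ℝ) : Prop where
  temperate : σ.HasTemperateGrowth
  bound : ∀ ξ, ‖σ ξ‖ ≤ C

theorem IsBddSymbol.nonneg {σ : ℝ → ℂ} {C : ℝ} (h : IsBddSymbol σ C) : 0 ≤ C :=
  (norm_nonneg _).trans (h.bound 0)

-- By Plancherel, the Fourier transform conjugates the multiplier to multiplication by an `L^∞`
-- function, which is bounded on `L²`.
open FourierTransform in
theorem IsBddSymbol.exists_clm {σ : ℝ → ℂ} {C : ℝ} (h : IsBddSymbol σ C) :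
    ∃ A : L2 →L[ℂ] L2, (∀ f, ‖A f‖ ≤ C * ‖f‖) ∧ ∀ f : L2, Lp.toTemperedDistribution (A f) =
      TemperedDistribution.fourierMultiplierCLM ℂ σ (Lp.toTemperedDistribution f) := by
  have hm : MemLp σ ⊤ (volume : Measure ℝ) :=
    memLp_top_of_bound h.temperate.1.continuous.aestronglyMeasurable C
      (Eventually.of_forall h.bound)
  have hn : ‖hm.toLp σ‖ ≤ C := by
    rw [Lp.norm_toLp]
    exact ENNReal.toReal_le_of_le_ofReal h.nonneg
      (eLpNormEssSup_le_of_ae_bound (Eventually.of_forall h.bound))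
  let B : L2 →L[ℂ] L2 := LinearMap.mkContinuous
    { toFun := fun f : L2 => (hm.toLp σ • f : L2)
      map_add' := fun f g => Lp.add_smul _ _ _
      map_smul' := fun c f => (Lp.smul_comm c (hm.toLp σ) f).symm } C (fun f => by
        refine (Lp.norm_smul_le (r := 2) (hm.toLp σ) f).trans ?_
        gcongr)
  have hB : ∀ f, ‖B f‖ ≤ C * ‖f‖ := fun f =>
    (B.le_opNorm f).trans (by
      gcongr
      exact LinearMap.mkContinuous_norm_le _ h.nonneg _)
  let e := Lp.fourierTransformₗᵢ ℝ ℂ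
  refine ⟨e.symm.toContinuousLinearEquiv.toContinuousLinearMap ∘L B ∘L
    e.toContinuousLinearEquiv.toContinuousLinearMap, fun f => ?_, fun f => ?_⟩
  · change ‖e.symm (B (e f))‖ ≤ _
    rw [e.symm.norm_map]
    exact (hB _).trans (by rw [e.norm_map])
  · change Lp.toTemperedDistribution (𝓕⁻ (hm.toLp σ • (𝓕 f : L2) : L2)) = _
    rw [← Lp.fourierInv_toTemperedDistribution_eq,
      Lp.toTemperedDistribution_smul_eq h.temperate hm, ← Lp.fourier_toTemperedDistribution_eq]
    rfl

open Classical in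
/-- The Fourier multiplier on `L²` with a bounded symbol. -/
noncomputable def mult (σ : ℝ → ℂ) : L2 →L[ℂ] L2 :=
  if h : ∃ A : L2 →L[ℂ] L2, ∀ f : L2, Lp.toTemperedDistribution (A f) =
      TemperedDistribution.fourierMultiplierCLM ℂ σ (Lp.toTemperedDistribution f)
  then h.choose else 0

theorem IsBddSymbol.toTemperedDistribution_mult {σ : ℝ → ℂ} {C : ℝ} (h : IsBddSymbol σ C)
    (f : L2) : Lp.toTemperedDistribution (mult σ f) =
      TemperedDistribution.fourierMultiplierCLM ℂ σ (Lp.toTemperedDistribution f) := by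
  have hex : ∃ A : L2 →L[ℂ] L2, ∀ f : L2, Lp.toTemperedDistribution (A f) =
      TemperedDistribution.fourierMultiplierCLM ℂ σ (Lp.toTemperedDistribution f) :=
    let ⟨A, _, hA⟩ := h.exists_clm
    ⟨A, hA⟩
  rw [mult, dif_pos hex]
  exact hex.choose_spec f

theorem IsBddSymbol.norm_mult_le {σ : ℝ → ℂ} {C : ℝ} (h : IsBddSymbol σ C) (f : L2) :
    ‖mult σ f‖ ≤ C * ‖f‖ := by
  obtain ⟨A, hA, hA'⟩ := h.exists_clm
  have : mult σ f = A f := toTemperedDistribution_injective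
    ((h.toTemperedDistribution_mult f).trans (hA' f).symm)
  rw [this]
  exact hA f

theorem toTemperedDistribution_schwartz (φ : 𝓢(ℝ, ℂ)) :
    Lp.toTemperedDistribution (φ.toLp 2 (volume : Measure ℝ)) =
      φ.toTemperedDistributionCLM ℝ ℂ volume :=
  Lp.toTemperedDistribution_toLp_eq φ

theorem IsBddSymbol.mult_schwartz {σ : ℝ → ℂ} {C : ℝ} (h : IsBddSymbol σ C) (φ : 𝓢(ℝ, ℂ)) :
    mult σ (φ.toLp 2 volume) = (SchwartzMap.fourierMultiplierCLM ℂ σ φ).toLp 2 volume := by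
  apply toTemperedDistribution_injective
  change Lp.toTemperedDistribution _ = Lp.toTemperedDistribution _
  rw [h.toTemperedDistribution_mult, toTemperedDistribution_schwartz,
    toTemperedDistribution_schwartz,
    TemperedDistribution.fourierMultiplierCLM_toTemperedDistributionCLM_eq h.temperate]

theorem IsBddSymbol.mult_comm {σ τ : ℝ → ℂ} {C C' : ℝ} (h : IsBddSymbol σ C)
    (h' : IsBddSymbol τ C') (f : L2) : mult σ (mult τ f) = mult τ (mult σ f) := by
  apply toTemperedDistribution_injective
  change Lp.toTemperedDistribution _ = Lp.toTemperedDistribution _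
  rw [h.toTemperedDistribution_mult, h'.toTemperedDistribution_mult,
    h'.toTemperedDistribution_mult, h.toTemperedDistribution_mult,
    TemperedDistribution.fourierMultiplierCLM_fourierMultiplierCLM_apply h.temperate h'.temperate,
    TemperedDistribution.fourierMultiplierCLM_fourierMultiplierCLM_apply h'.temperate h.temperate,
    mul_comm]

/-! ### The inverse Bessel potential and its derivative -/

/-- The symbol `(1 + ξ²)^{a/2}` of the Bessel potential of order `a`. -/
noncomputable def besselSymbol (a : ℝ) (ξ : ℝ) : ℂ := ((1 + ‖ξ‖ ^ 2) ^ (a / 2) : ℝ)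

theorem besselSymbol_temperate (a : ℝ) : (besselSymbol a).HasTemperateGrowth := by
  unfold besselSymbol
  fun_prop

theorem besselPotential_eq (a : ℝ) : TemperedDistribution.besselPotential ℝ ℂ a =
    TemperedDistribution.fourierMultiplierCLM ℂ (besselSymbol a) := rfl

theorem norm_besselSymbol (a ξ : ℝ) : ‖besselSymbol a ξ‖ = (1 + ‖ξ‖ ^ 2) ^ (a / 2) := by
  rw [besselSymbol, Complex.norm_real, Real.norm_of_nonneg (by positivity)]

theorem isBddSymbol_besselSymbol {a : ℝ} (ha : a ≤ 0) : IsBddSymbol (besselSymbol a) 1 := by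
  refine ⟨besselSymbol_temperate a, fun ξ => ?_⟩
  rw [norm_besselSymbol]
  exact Real.rpow_le_one_of_one_le_of_nonpos (by simp [sq_nonneg]) (by linarith)

theorem besselSymbol_mul (a b : ℝ) : besselSymbol a * besselSymbol b = besselSymbol (a + b) := by
  ext ξ
  simp only [besselSymbol, Pi.mul_apply, ← Complex.ofReal_mul]
  rw [← Real.rpow_add (by positivity), add_div]

/-- The symbol `2πiξ` of the derivative. -/
noncomputable def derivSymbol (ξ : ℝ) : ℂ := 2 * Real.pi * Complex.I * (ξ : ℂ)

theorem derivSymbol_temperate : derivSymbol.HasTemperateGrowth := by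
  unfold derivSymbol
  fun_prop

theorem derivSymbol_eq : derivSymbol =
    (2 * Real.pi * Complex.I) • fun ξ : ℝ => ((inner ℝ ξ (1 : ℝ) : ℝ) : ℂ) := by
  ext ξ
  simp [derivSymbol]

theorem schwartz_derivCLM_eq_lineDeriv (φ : 𝓢(ℝ, ℂ)) :
    SchwartzMap.derivCLM ℂ ℂ φ = ∂_{(1 : ℝ)} φ := by
  ext x
  rw [SchwartzMap.derivCLM_apply, SchwartzMap.lineDerivOp_apply_eq_fderiv]
  simp

theorem schwartz_derivCLM_eq (φ : 𝓢(ℝ, ℂ)) : SchwartzMap.derivCLM ℂ ℂ φ =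
    SchwartzMap.fourierMultiplierCLM ℂ derivSymbol φ := by
  have h : (fun ξ : ℝ => inner ℝ ξ (1 : ℝ)).HasTemperateGrowth := by fun_prop
  rw [schwartz_derivCLM_eq_lineDeriv, SchwartzMap.lineDeriv_eq_fourierMultiplierCLM,
    derivSymbol_eq, SchwartzMap.fourierMultiplierCLM_smul (by fun_prop),
    ← SchwartzMap.fourierMultiplierCLM_ofReal ℂ h]
  rfl

theorem distribution_derivCLM_eq (S : 𝓢'(ℝ, ℂ)) : TemperedDistribution.derivCLM ℂ S =
    TemperedDistribution.fourierMultiplierCLM ℂ derivSymbol S := by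
  have h1 : TemperedDistribution.derivCLM ℂ S = ∂_{(1 : ℝ)} S := by
    ext φ
    rw [TemperedDistribution.derivCLM_apply_apply, TemperedDistribution.lineDerivOp_apply_apply,
      schwartz_derivCLM_eq_lineDeriv]
  rw [h1, TemperedDistribution.lineDeriv_eq_fourierMultiplierCLM, derivSymbol_eq,
    TemperedDistribution.fourierMultiplierCLM_smul (by fun_prop)]
  rfl

theorem isBddSymbol_derivBessel : IsBddSymbol (derivSymbol * besselSymbol (-1)) (2 * Real.pi) := by
  refine ⟨derivSymbol_temperate.mul (besselSymbol_temperate _), fun ξ => ?_⟩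
  rw [Pi.mul_apply, norm_mul, norm_besselSymbol, derivSymbol]
  have h : ‖(ξ : ℂ)‖ ≤ (1 + ‖ξ‖ ^ 2) ^ (1 / 2 : ℝ) := by
    rw [Complex.norm_real, ← Real.sqrt_eq_rpow]
    exact Real.le_sqrt_of_sq_le (by linarith)
  have h2 : (1 + ‖ξ‖ ^ 2) ^ (1 / 2 : ℝ) * (1 + ‖ξ‖ ^ 2) ^ (-1 / 2 : ℝ) = 1 := by
    rw [← Real.rpow_add (by positivity)]
    norm_num
  calc _ = 2 * Real.pi * (‖(ξ : ℂ)‖ * (1 + ‖ξ‖ ^ 2) ^ (-1 / 2 : ℝ)) := by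
        simp [abs_of_pos Real.pi_pos, mul_assoc]
    _ ≤ 2 * Real.pi * ((1 + ‖ξ‖ ^ 2) ^ (1 / 2 : ℝ) * (1 + ‖ξ‖ ^ 2) ^ (-1 / 2 : ℝ)) := by gcongr
    _ = _ := by rw [h2, mul_one]

/-- The isomorphism `⟨∇⟩⁻¹` from `L²` onto `H¹`. -/
noncomputable def J : L2 →L[ℂ] L2 := mult (besselSymbol (-1))

/-- The operator `∂ₓ⟨∇⟩⁻¹` on `L²`. -/
noncomputable def D : L2 →L[ℂ] L2 := mult (derivSymbol * besselSymbol (-1))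

theorem toTemperedDistribution_J (f : L2) : Lp.toTemperedDistribution (J f) =
    TemperedDistribution.fourierMultiplierCLM ℂ (besselSymbol (-1))
      (Lp.toTemperedDistribution f) :=
  (isBddSymbol_besselSymbol (by norm_num)).toTemperedDistribution_mult f

theorem toTemperedDistribution_D (f : L2) : Lp.toTemperedDistribution (D f) =
    TemperedDistribution.derivCLM ℂ (Lp.toTemperedDistribution (J f)) := by
  rw [D, isBddSymbol_derivBessel.toTemperedDistribution_mult, distribution_derivCLM_eq,
    toTemperedDistribution_J, TemperedDistribution.fourierMultiplierCLM_fourierMultiplierCLM_apply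
      (besselSymbol_temperate _) derivSymbol_temperate, mul_comm]

theorem norm_J_le (f : L2) : ‖J f‖ ≤ ‖f‖ :=
  (isBddSymbol_besselSymbol (by norm_num)).norm_mult_le f |>.trans_eq (one_mul _)

theorem D_J_comm (f : L2) : D (J f) = J (D f) :=
  isBddSymbol_derivBessel.mult_comm (isBddSymbol_besselSymbol (by norm_num)) f

/-- `⟨∇⟩⁻¹` on Schwartz functions. -/
noncomputable def JS (φ : 𝓢(ℝ, ℂ)) : 𝓢(ℝ, ℂ) :=
  SchwartzMap.fourierMultiplierCLM ℂ (besselSymbol (-1)) φ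

theorem J_toLp (φ : 𝓢(ℝ, ℂ)) : J (φ.toLp 2 volume) = (JS φ).toLp 2 volume :=
  (isBddSymbol_besselSymbol (by norm_num)).mult_schwartz φ

theorem D_toLp (φ : 𝓢(ℝ, ℂ)) :
    D (φ.toLp 2 volume) = (SchwartzMap.derivCLM ℂ ℂ (JS φ)).toLp 2 volume := by
  rw [D, isBddSymbol_derivBessel.mult_schwartz, schwartz_derivCLM_eq, JS,
    SchwartzMap.fourierMultiplierCLM_fourierMultiplierCLM_apply derivSymbol_temperate
      (besselSymbol_temperate _)]

theorem besselSymbol_two_eq :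
    besselSymbol 2 = (fun _ => 1) + (-(1 / (4 * Real.pi ^ 2) : ℂ)) • (derivSymbol * derivSymbol) := by
  ext ξ
  have h : (Real.pi : ℂ) ≠ 0 := by exact_mod_cast Real.pi_ne_zero
  have hI : (Complex.I : ℂ) ^ 2 = -1 := Complex.I_sq
  simp only [besselSymbol, derivSymbol, Pi.add_apply, Pi.smul_apply, Pi.mul_apply, smul_eq_mul]
  norm_num
  field_simp
  rw [hI]
  ring

theorem fourierMultiplierCLM_add {σ τ : ℝ → ℂ} (hσ : σ.HasTemperateGrowth)
    (hτ : τ.HasTemperateGrowth) (S : 𝓢'(ℝ, ℂ)) :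
    TemperedDistribution.fourierMultiplierCLM ℂ (σ + τ) S =
      TemperedDistribution.fourierMultiplierCLM ℂ σ S +
        TemperedDistribution.fourierMultiplierCLM ℂ τ S := by
  simp [TemperedDistribution.fourierMultiplierCLM_apply,
    TemperedDistribution.smulLeftCLM_add hσ hτ, FourierTransform.fourierInv_add]

/-- A function in `L²` whose second distributional derivative is in `L²` is in `H²`. -/
theorem exists_eq_J_J {a a₂ : L2} (h : Lp.toTemperedDistribution a₂ =
    TemperedDistribution.derivCLM ℂ
      (TemperedDistribution.derivCLM ℂ (Lp.toTemperedDistribution a))) :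
    ∃ q : L2, a = J (J q) ∧ a₂ = D (D q) := by
  let T := Lp.toTemperedDistributionCLM ℂ (volume : Measure ℝ) 2
  -- In the frequency variable `∂ₓ²` has symbol `-4π²ξ²`, so `1 + c ∂ₓ²` has symbol `1 + ξ²`, the
  -- inverse of that of `J ∘ J`. The witness is therefore `q = a + c a₂`.
  let c : ℂ := -(1 / (4 * Real.pi ^ 2) : ℂ)
  have hq : T (a + c • a₂) =
      TemperedDistribution.fourierMultiplierCLM ℂ (besselSymbol 2) (T a) := by
    have h2 : T a₂ = TemperedDistribution.fourierMultiplierCLM ℂ (derivSymbol * derivSymbol)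
        (T a) := by
      refine h.trans ?_
      rw [distribution_derivCLM_eq, distribution_derivCLM_eq,
        TemperedDistribution.fourierMultiplierCLM_fourierMultiplierCLM_apply
          derivSymbol_temperate derivSymbol_temperate]
      rfl
    have hd : (derivSymbol * derivSymbol).HasTemperateGrowth :=
      derivSymbol_temperate.mul derivSymbol_temperate
    rw [map_add, map_smul, h2, besselSymbol_two_eq, fourierMultiplierCLM_add (by fun_prop) (by
      have := (Function.HasTemperateGrowth.const c).mul hd
      exact this), TemperedDistribution.fourierMultiplierCLM_smul hd]
    simp [c]
  have ha : a = J (J (a + c • a₂)) := by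
    apply toTemperedDistribution_injective
    change T a = Lp.toTemperedDistribution _
    rw [toTemperedDistribution_J, toTemperedDistribution_J]
    change _ = TemperedDistribution.fourierMultiplierCLM ℂ _
      (TemperedDistribution.fourierMultiplierCLM ℂ _ (T (a + c • a₂)))
    rw [hq]
    simp only [← besselPotential_eq, TemperedDistribution.besselPotential_besselPotential_apply]
    norm_num
  refine ⟨_, ha, ?_⟩
  apply toTemperedDistribution_injective
  change Lp.toTemperedDistribution _ = Lp.toTemperedDistribution _
  rw [toTemperedDistribution_D, ← D_J_comm, toTemperedDistribution_D, ← ha, h]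

/-! ### The symbol of the `I`-operator -/

/-- Every derivative is in fact bounded: by compactness for `|ξ| ≤ 2N`, and beyond by
differentiating the explicit power, whose exponent `-(1-s)-n` is not positive. Evenness transfers
the bound to negative `ξ`. -/
theorem IsIMultiplier.hasTemperateGrowth {s N : ℝ} {m : ℝ → ℝ} (hm : IsIMultiplier s N m)
    (hN : 0 < N) (hs : s ≤ 1) : m.HasTemperateGrowth := by
  refine ⟨hm.smooth, fun n => ?_⟩
  have hcont : Continuous (iteratedDeriv n m) :=
    hm.smooth.continuous_iteratedDeriv n (by exact_mod_cast le_top)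
  obtain ⟨C₁, hC₁⟩ := (isCompact_Icc (a := -(2 * N)) (b := 2 * N)).exists_bound_of_continuousOn
    hcont.continuousOn
  have hpos : ∀ ξ, 2 * N < ξ → iteratedDeriv n m ξ =
      N ^ (1 - s) * ((descPochhammer ℝ n).eval (-(1 - s)) * ξ ^ (-(1 - s) - n)) := by
    intro ξ hξ
    have heq : m =ᶠ[𝓝 ξ] fun x => N ^ (1 - s) * x ^ (-(1 - s)) := by
      filter_upwards [lt_mem_nhds hξ] with x hx
      have hx0 : 0 < x := by linarith
      rw [hm.high x (hx.le.trans (le_abs_self x)), abs_of_pos hx0, Real.div_rpow hN.le hx0.le,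
        Real.rpow_neg hx0.le, div_eq_mul_inv]
    rw [heq.iteratedDeriv_eq, iteratedDeriv_const_mul_field, iteratedDeriv_eq_iterate,
      Real.iter_deriv_rpow_const]
  have hfar : ∀ ξ, 2 * N < ξ → ‖iteratedDeriv n m ξ‖ ≤
      N ^ (1 - s) * (|(descPochhammer ℝ n).eval (-(1 - s))| * (2 * N) ^ (-(1 - s) - n)) := by
    intro ξ hξ
    have hx0 : 0 < ξ := by linarith
    rw [hpos ξ hξ, norm_mul, norm_mul, Real.norm_of_nonneg (by positivity : 0 ≤ N ^ (1 - s)),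
      Real.norm_of_nonneg (by positivity : 0 ≤ ξ ^ (-(1 - s) - n)), Real.norm_eq_abs]
    gcongr N ^ (1 - s) * (_ * ?_)
    exact Real.rpow_le_rpow_of_nonpos (by positivity) hξ.le (by
      have : (0 : ℝ) ≤ n := n.cast_nonneg
      linarith)
  have heven : ∀ ξ, ‖iteratedDeriv n m (-ξ)‖ = ‖iteratedDeriv n m ξ‖ := by
    intro ξ
    have h1 := iteratedDeriv_comp_neg n m ξ
    simp only [hm.even] at h1
    rw [show (fun x => m x) = m from rfl] at h1
    rw [h1, norm_smul]
    simp
  refine ⟨0, C₁ + N ^ (1 - s) *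
    (|(descPochhammer ℝ n).eval (-(1 - s))| * (2 * N) ^ (-(1 - s) - n)), fun ξ => ?_⟩
  rw [norm_iteratedFDeriv_eq_norm_iteratedDeriv, pow_zero, mul_one]
  have hC₁0 : 0 ≤ C₁ := (norm_nonneg _).trans (hC₁ 0 (by constructor <;> linarith))
  have hC₂0 : 0 ≤ N ^ (1 - s) *
    (|(descPochhammer ℝ n).eval (-(1 - s))| * (2 * N) ^ (-(1 - s) - n)) := by positivity
  rcases lt_or_ge (2 * N) ξ with h | h
  · exact (hfar ξ h).trans (by linarith)
  rcases lt_or_ge ξ (-(2 * N)) with h' | h'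
  · have := hfar (-ξ) (by linarith)
    rw [heven] at this
    linarith
  · exact (hC₁ ξ ⟨h', h⟩).trans (by linarith)

/-- The symbol of the `I`-operator as a function of the frequency. -/
noncomputable def iSymbol (m : ℝ → ℝ) (ξ : ℝ) : ℂ := ((m (2 * Real.pi * ξ) : ℝ) : ℂ)

theorem IsIMultiplier.iSymbol_temperate {s N : ℝ} {m : ℝ → ℝ} (hm : IsIMultiplier s N m)
    (hN : 0 < N) (hs : s ≤ 1) : (iSymbol m).HasTemperateGrowth := by
  have h := hm.hasTemperateGrowth hN hs
  have h2 : (fun ξ : ℝ => 2 * Real.pi * ξ).HasTemperateGrowth := by fun_prop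
  have h3 : (fun ξ => m (2 * Real.pi * ξ)).HasTemperateGrowth := h.comp h2
  unfold iSymbol
  fun_prop

theorem IsIMultiplier.norm_iSymbol_le {s N : ℝ} {m : ℝ → ℝ} (hm : IsIMultiplier s N m) (ξ : ℝ) :
    ‖iSymbol m ξ‖ ≤ 1 := by
  rw [iSymbol, Complex.norm_real, Real.norm_of_nonneg (hm.nonneg _)]
  exact hm.le_one _

theorem IsIMultiplier.isBddSymbol {s N : ℝ} {m : ℝ → ℝ} (hm : IsIMultiplier s N m)
    (hN : 0 < N) (hs : s ≤ 1) : IsBddSymbol (iSymbol m) 1 :=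
  ⟨hm.iSymbol_temperate hN hs, hm.norm_iSymbol_le⟩

/-- The decay `|ξ|^{-(1-s)}` of the symbol exactly compensates the growth of `⟨ξ⟩^{1-s}`; this is
why `I` maps `H^s` into `H¹`. The power law for `m(2πξ)` starts at `|ξ| = N/π`; below it compactness
suffices. The bound may depend on `N` and `s`, since it is used only for continuity in time. -/
theorem IsIMultiplier.isBddSymbol_mul_bessel {s N : ℝ} {m : ℝ → ℝ} (hm : IsIMultiplier s N m)
    (hN : 0 < N) (hs : s ≤ 1) : ∃ C, IsBddSymbol (iSymbol m * besselSymbol (1 - s)) C := by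
  have ht := (hm.iSymbol_temperate hN hs).mul (besselSymbol_temperate (1 - s))
  have hπ := Real.pi_pos
  obtain ⟨C, hC⟩ := (isCompact_Icc (a := -(N / Real.pi)) (b := N / Real.pi)).exists_bound_of_continuousOn
    ht.1.continuous.continuousOn
  have hC0 : 0 ≤ C := (norm_nonneg _).trans (hC 0 (by constructor <;> [simp; skip] <;> positivity))
  refine ⟨C + (N + 1) ^ (1 - s), ht, fun ξ => ?_⟩
  rcases le_or_gt |ξ| (N / Real.pi) with h | h
  · exact (hC ξ (abs_le.mp h)).trans (by linarith [show 0 ≤ (N + 1) ^ (1 - s) by positivity])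
  refine le_trans ?_ (le_add_of_nonneg_left hC0)
  have hξ : 0 < |ξ| := lt_trans (by positivity) h
  have hN' : N < |ξ| * Real.pi := (div_lt_iff₀ hπ).mp h
  have habs : |2 * Real.pi * ξ| = 2 * Real.pi * |ξ| := by
    rw [abs_mul, abs_of_pos (by positivity)]
  have hhigh := hm.high (2 * Real.pi * ξ) (by rw [habs]; linarith)
  have hsq : (1 + ‖ξ‖ ^ 2) ^ ((1 - s) / 2) ≤ (1 + |ξ|) ^ (1 - s) := by
    calc (1 + ‖ξ‖ ^ 2) ^ ((1 - s) / 2) ≤ ((1 + |ξ|) ^ 2) ^ ((1 - s) / 2) := by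
          apply Real.rpow_le_rpow (by positivity) _ (by linarith)
          rw [Real.norm_eq_abs]
          nlinarith
      _ = _ := by
        rw [← Real.rpow_natCast, ← Real.rpow_mul (by positivity)]
        congr 1
        push_cast
        ring
  rw [Pi.mul_apply, norm_mul, norm_besselSymbol, iSymbol, Complex.norm_real,
    Real.norm_of_nonneg (hm.nonneg _), hhigh, habs]
  calc (N / (2 * Real.pi * |ξ|)) ^ (1 - s) * (1 + ‖ξ‖ ^ 2) ^ ((1 - s) / 2)
      ≤ (N / (2 * Real.pi * |ξ|)) ^ (1 - s) * (1 + |ξ|) ^ (1 - s) := by gcongr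
    _ = (N / (2 * Real.pi * |ξ|) * (1 + |ξ|)) ^ (1 - s) := by
        rw [Real.mul_rpow (by positivity) (by positivity)]
    _ ≤ (N + 1) ^ (1 - s) := by
        apply Real.rpow_le_rpow (by positivity) _ (by linarith)
        rw [div_mul_eq_mul_div, div_le_iff₀ (by positivity)]
        nlinarith [Real.pi_gt_three, mul_pos hN hξ, mul_pos hπ hξ]

theorem opI_eq (m : ℝ → ℝ) (S : 𝓢'(ℝ, ℂ)) :
    opI m S = TemperedDistribution.fourierMultiplierCLM ℂ (iSymbol m) S := rfl

/-! ### The Sobolev embedding of `H¹` into `L^∞` -/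

theorem exists_schwartz_seq (g : L2) :
    ∃ φ : ℕ → 𝓢(ℝ, ℂ), Tendsto (fun n => (φ n).toLp 2 volume) atTop (𝓝 g) := by
  have h : g ∈ closure (Set.range (SchwartzMap.toLpCLM ℂ ℂ 2 (volume : Measure ℝ))) :=
    SchwartzMap.denseRange_toLpCLM ENNReal.ofNat_ne_top g
  obtain ⟨x, hx, hlim⟩ := mem_closure_iff_seq_limit.mp h
  choose φ hφ using hx
  refine ⟨φ, ?_⟩
  convert hlim using 2 with n
  exact hφ n

theorem norm_schwartz_toLp_sq (φ : 𝓢(ℝ, ℂ)) :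
    ‖φ.toLp 2 (volume : Measure ℝ)‖ ^ 2 = ∫ x, ‖φ x‖ ^ 2 := by
  have := L2.inner_def (𝕜 := ℂ) (φ.toLp 2 (volume : Measure ℝ)) (φ.toLp 2 (volume : Measure ℝ))
  rw [inner_self_eq_norm_sq_to_K] at this
  have h2 : ∫ x, inner ℂ (φ.toLp 2 (volume : Measure ℝ) x) (φ.toLp 2 (volume : Measure ℝ) x) =
      ((∫ x, ‖φ x‖ ^ 2 : ℝ) : ℂ) := by
    rw [← integral_complex_ofReal]
    refine integral_congr_ae ?_
    filter_upwards [φ.coeFn_toLp 2 volume] with x hx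
    rw [hx, inner_self_eq_norm_sq_to_K]
    simp
  rw [h2] at this
  exact Complex.ofReal_injective (by simpa using this)

theorem integrable_schwartz_mul_norm (φ ψ : 𝓢(ℝ, ℂ)) :
    Integrable (fun x => ‖φ x‖ * ‖ψ x‖) := by
  have := (integrable_schwartz_mul (q := 2) (by norm_num) (φ.memLp 2 volume) ψ).norm
  simpa [mul_comm] using this

theorem integral_norm_mul_norm_le (φ ψ : 𝓢(ℝ, ℂ)) :
    ∫ x, ‖φ x‖ * ‖ψ x‖ ≤ ‖φ.toLp 2 (volume : Measure ℝ)‖ * ‖ψ.toLp 2 (volume : Measure ℝ)‖ := by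
  have h := integral_mul_norm_le_Lp_mul_Lq (μ := (volume : Measure ℝ)) (f := φ) (g := ψ)
    (p := 2) (q := 2) Real.HolderConjugate.two_two (by simpa using φ.memLp 2 volume)
    (by simpa using ψ.memLp 2 volume)
  have hr : ∀ χ : 𝓢(ℝ, ℂ), (∫ x, ‖χ x‖ ^ (2 : ℝ)) ^ (1 / 2 : ℝ) =
      ‖χ.toLp 2 (volume : Measure ℝ)‖ := by
    intro χ
    rw [← Real.sqrt_eq_rpow]
    simp only [Real.rpow_two]
    rw [← norm_schwartz_toLp_sq, Real.sqrt_sq (norm_nonneg _)]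
  rwa [hr, hr] at h

theorem schwartz_tendsto_atBot (φ : 𝓢(ℝ, ℂ)) : Tendsto φ atBot (𝓝 0) :=
  φ.tendsto_cocompact.mono_left atBot_le_cocompact

theorem schwartz_tendsto_atTop (φ : 𝓢(ℝ, ℂ)) : Tendsto φ atTop (𝓝 0) :=
  φ.tendsto_cocompact.mono_left atTop_le_cocompact

theorem hasDerivAt_schwartz (φ : 𝓢(ℝ, ℂ)) (x : ℝ) :
    HasDerivAt φ (SchwartzMap.derivCLM ℂ ℂ φ x) x := φ.hasDerivAt x

/-- Integrate `(|φ|²)' = 2 Re(φ̄ φ')` from `-∞` to `x` and apply Cauchy–Schwarz. -/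
theorem norm_sq_schwartz_le (φ : 𝓢(ℝ, ℂ)) (x : ℝ) :
    ‖φ x‖ ^ 2 ≤ 2 * ‖φ.toLp 2 (volume : Measure ℝ)‖ *
      ‖(SchwartzMap.derivCLM ℂ ℂ φ).toLp 2 (volume : Measure ℝ)‖ := by
  set ψ := SchwartzMap.derivCLM ℂ ℂ φ
  have hd : ∀ y, HasDerivAt (fun y => ‖φ y‖ ^ 2) (2 * inner ℝ (φ y) (ψ y)) y := fun y =>
    (hasDerivAt_schwartz φ y).norm_sq
  have hb : ∀ y, ‖2 * inner ℝ (φ y) (ψ y)‖ ≤ 2 * (‖φ y‖ * ‖ψ y‖) := fun y => by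
    rw [norm_mul, Real.norm_two]
    gcongr
    exact norm_inner_le_norm _ _
  have hc : Continuous fun y => 2 * inner ℝ (φ y) (ψ y) :=
    continuous_const.mul (φ.continuous.inner ψ.continuous)
  have hI := (integrable_schwartz_mul_norm φ ψ).const_mul 2
  have hi : Integrable (fun y => 2 * inner ℝ (φ y) (ψ y)) :=
    hI.mono' hc.aestronglyMeasurable (Eventually.of_forall hb)
  have h := integral_Iic_of_hasDerivAt_of_tendsto' (a := x) (fun y _ => hd y) hi.integrableOn
    (m := 0) (by simpa using ((schwartz_tendsto_atBot φ).norm.pow 2))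
  rw [sub_zero] at h
  rw [← h]
  calc ∫ y in Set.Iic x, 2 * inner ℝ (φ y) (ψ y)
      ≤ ∫ y in Set.Iic x, 2 * (‖φ y‖ * ‖ψ y‖) :=
        integral_mono hi.integrableOn hI.integrableOn fun y => (le_abs_self _).trans (hb y)
    _ ≤ ∫ y, 2 * (‖φ y‖ * ‖ψ y‖) :=
        setIntegral_le_integral hI (Eventually.of_forall fun y => by positivity)
    _ = 2 * ∫ y, ‖φ y‖ * ‖ψ y‖ := integral_const_mul _ _
    _ ≤ _ := by
        rw [mul_assoc]
        gcongr
        exact integral_norm_mul_norm_le φ ψ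

theorem exists_subseq_ae_tendsto {f : ℕ → L2} {g : L2} (h : Tendsto f atTop (𝓝 g)) :
    ∃ ns : ℕ → ℕ, StrictMono ns ∧ ∀ᵐ x, Tendsto (fun n => f (ns n) x) atTop (𝓝 (g x)) :=
  (tendstoInMeasure_of_tendsto_Lp h).exists_seq_tendsto_ae

/-- The bound passes from Schwartz functions by density, along a subsequence converging almost
everywhere. The product form is needed later: it shows that `Jg` vanishes as soon as `‖Jg‖ ‖Dg‖`
does. -/
theorem ae_norm_sq_J_le (g : L2) : ∀ᵐ x, ‖J g x‖ ^ 2 ≤ 2 * ‖J g‖ * ‖D g‖ := by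
  obtain ⟨φ, hφ⟩ := exists_schwartz_seq g
  obtain ⟨ns, hns, hlim⟩ := exists_subseq_ae_tendsto ((J.continuous.tendsto g).comp hφ)
  have hn : Tendsto (fun n => 2 * ‖J ((φ (ns n)).toLp 2 volume)‖ * ‖D ((φ (ns n)).toLp 2 volume)‖)
      atTop (𝓝 (2 * ‖J g‖ * ‖D g‖)) :=
    ((((J.continuous.tendsto g).comp hφ).norm.const_mul 2).mul
      ((D.continuous.tendsto g).comp hφ).norm).comp hns.tendsto_atTop
  have hae : ∀ᵐ x, ∀ n, J ((φ n).toLp 2 volume) x = JS (φ n) x := by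
    rw [ae_all_iff]
    intro n
    rw [J_toLp]
    exact (JS (φ n)).coeFn_toLp 2 volume
  filter_upwards [hlim, hae] with x hx hx'
  refine le_of_tendsto_of_tendsto' (hx.norm.pow 2) hn fun n => ?_
  simp only [Function.comp_apply]
  rw [hx', J_toLp, D_toLp]
  exact norm_sq_schwartz_le _ x

theorem norm_D_le (g : L2) : ‖D g‖ ≤ 2 * Real.pi * ‖g‖ := isBddSymbol_derivBessel.norm_mult_le g

/-- The constant comes from `2 · 2π ≤ 4²`. -/
theorem ae_norm_J_le (g : L2) : ∀ᵐ x, ‖J g x‖ ≤ 4 * ‖g‖ := by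
  filter_upwards [ae_norm_sq_J_le g] with x hx
  refine le_of_sq_le_sq ?_ (by positivity)
  refine hx.trans ?_
  calc 2 * ‖J g‖ * ‖D g‖ ≤ 2 * ‖g‖ * (2 * Real.pi * ‖g‖) := by
        gcongr
        exacts [norm_J_le g, norm_D_le g]
    _ ≤ _ := by nlinarith [Real.pi_lt_four, sq_nonneg ‖g‖]

/-! ### The nonlinearity on `H¹` -/

/-- The function `z ↦ |z|^{p-1} z`. -/
noncomputable def pw (p : ℝ) (z : ℂ) : ℂ := ((‖z‖ ^ (p - 1) : ℝ) : ℂ) * z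

theorem nonlin_apply (p : ℝ) (f : ℝ → ℂ) (x : ℝ) : nonlin p f x = pw p (f x) := rfl

theorem continuous_pw {p : ℝ} (hp : 1 < p) : Continuous (pw p) := by
  unfold pw
  have : Continuous fun z : ℂ => ‖z‖ ^ (p - 1) :=
    continuous_norm.rpow_const fun _ => Or.inr (by linarith)
  fun_prop

theorem norm_pw {p : ℝ} (hp : 1 < p) (z : ℂ) : ‖pw p z‖ = ‖z‖ ^ p := by
  rw [pw, norm_mul, Complex.norm_real, Real.norm_of_nonneg (by positivity)]
  rcases eq_or_ne z 0 with rfl | hz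
  · simp [Real.zero_rpow (by linarith : p ≠ 0)]
  · rw [← Real.rpow_add_one (norm_ne_zero_iff.mpr hz), sub_add_cancel]

/-- Split off `|z|^{p-1}(z - w)`, which accounts for one unit of the constant `p`. Bernoulli's
inequality bounds the remainder by `p - 1` units. -/
theorem norm_pw_sub_le_of_le {p : ℝ} (hp : 1 < p) {z w : ℂ} (h : ‖w‖ ≤ ‖z‖) :
    ‖pw p z - pw p w‖ ≤ p * ‖z‖ ^ (p - 1) * ‖z - w‖ := by
  rcases (norm_nonneg z).eq_or_lt with hz | hz
  · have hz' : z = 0 := norm_eq_zero.mp hz.symm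
    have hw : w = 0 := by
      rw [← norm_eq_zero]
      exact le_antisymm (h.trans hz.symm.le) (norm_nonneg _)
    simp [hz', hw]
  have hle : ‖w‖ ^ (p - 1) ≤ ‖z‖ ^ (p - 1) := by
    gcongr
  have hsplit : pw p z - pw p w = ((‖z‖ ^ (p - 1) : ℝ) : ℂ) * (z - w) +
      ((‖z‖ ^ (p - 1) - ‖w‖ ^ (p - 1) : ℝ) : ℂ) * w := by
    simp only [pw]
    push_cast
    ring
  have hdiff : (‖z‖ ^ (p - 1) - ‖w‖ ^ (p - 1)) * ‖w‖ ≤ (p - 1) * ‖z‖ ^ (p - 1) * ‖z - w‖ := by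
    -- Bernoulli at `1 + s = |w|/|z|` is the tangent-line bound `|w|^p ≥ |z|^p + p |z|^{p-1}(|w| -
    -- |z|)`.
    have hb := one_add_mul_self_le_rpow_one_add (s := ‖w‖ / ‖z‖ - 1) (p := p)
      (by linarith [div_nonneg (norm_nonneg w) hz.le]) hp.le
    rw [add_sub_cancel, Real.div_rpow (norm_nonneg _) hz.le, le_div_iff₀ (by positivity)] at hb
    have h1 : ‖z‖ ^ p = ‖z‖ ^ (p - 1) * ‖z‖ := by
      rw [← Real.rpow_add_one hz.ne', sub_add_cancel]
    have h2 : ‖w‖ ^ p = ‖w‖ ^ (p - 1) * ‖w‖ := by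
      rcases (norm_nonneg w).eq_or_lt with hw | hw
      · rw [← hw, mul_zero, Real.zero_rpow (by linarith)]
      · rw [← Real.rpow_add_one hw.ne', sub_add_cancel]
    have h3 : (1 + p * (‖w‖ / ‖z‖ - 1)) * (‖z‖ ^ (p - 1) * ‖z‖) =
        ‖z‖ ^ (p - 1) * (‖z‖ + p * (‖w‖ - ‖z‖)) := by
      field_simp
    rw [h1, h2, h3] at hb
    have h4 : (p - 1) * ‖z‖ ^ (p - 1) * (‖z‖ - ‖w‖) ≤ (p - 1) * ‖z‖ ^ (p - 1) * ‖z - w‖ := by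
      have : 0 ≤ p - 1 := by linarith
      gcongr
      exact norm_sub_norm_le z w
    nlinarith
  rw [hsplit]
  refine (norm_add_le _ _).trans ?_
  rw [norm_mul, norm_mul, Complex.norm_real, Complex.norm_real,
    Real.norm_of_nonneg (by positivity), Real.norm_of_nonneg (sub_nonneg.mpr hle)]
  linarith

theorem norm_pw_sub_le {p : ℝ} (hp : 1 < p) {z w : ℂ} {R : ℝ} (hz : ‖z‖ ≤ R) (hw : ‖w‖ ≤ R) :
    ‖pw p z - pw p w‖ ≤ p * R ^ (p - 1) * ‖z - w‖ := by
  have hp0 : 0 ≤ p - 1 := by linarith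
  rcases le_total ‖w‖ ‖z‖ with h | h
  · refine (norm_pw_sub_le_of_le hp h).trans ?_
    gcongr
  · rw [norm_sub_rev, norm_sub_rev z w]
    refine (norm_pw_sub_le_of_le hp h).trans ?_
    gcongr

theorem pw_zero (p : ℝ) : pw p 0 = 0 := by simp [pw]

theorem memLp_nonlin_J {p : ℝ} (hp : 1 < p) (g : L2) : MemLp (nonlin p (J g)) 2 volume := by
  refine (Lp.memLp (J g)).of_le_mul (c := p * (4 * ‖g‖) ^ (p - 1))
    ((continuous_pw hp).comp_aestronglyMeasurable (Lp.aestronglyMeasurable _)) ?_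
  filter_upwards [ae_norm_J_le g] with x hx
  have := norm_pw_sub_le hp hx (w := 0) (by simp)
  simpa [pw_zero, nonlin_apply] using this

/-- The nonlinearity `g ↦ |Jg|^{p-1} Jg`, as a map on `L²`. -/
noncomputable def NJ {p : ℝ} (hp : 1 < p) (g : L2) : L2 := (memLp_nonlin_J hp g).toLp _

theorem NJ_ae {p : ℝ} (hp : 1 < p) (g : L2) : NJ hp g =ᵐ[volume] fun x => pw p (J g x) :=
  (memLp_nonlin_J hp g).coeFn_toLp

/-- On a ball of `L²` the functions `Jg` are uniformly bounded by the embedding of `H¹` into `L^∞`,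
so the pointwise Lipschitz bound integrates to one in `L²`. -/
theorem norm_NJ_sub_le {p : ℝ} (hp : 1 < p) {g h : L2} {R : ℝ} (hg : ‖g‖ ≤ R) (hh : ‖h‖ ≤ R) :
    ‖NJ hp g - NJ hp h‖ ≤ p * (4 * R) ^ (p - 1) * ‖g - h‖ := by
  have hR : 0 ≤ R := (norm_nonneg _).trans hg
  refine (Lp.norm_le_mul_norm_of_ae_le_mul (c := p * (4 * R) ^ (p - 1)) (g := J (g - h))
    ?_).trans ?_
  · rw [map_sub]
    filter_upwards [NJ_ae hp g, NJ_ae hp h, ae_norm_J_le g, ae_norm_J_le h,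
      Lp.coeFn_sub (NJ hp g) (NJ hp h), Lp.coeFn_sub (J g) (J h)] with x h1 h2 h3 h4 h5 h6
    rw [h5, h6, Pi.sub_apply, Pi.sub_apply, h1, h2]
    exact norm_pw_sub_le hp (h3.trans (by linarith)) (h4.trans (by linarith))
  · gcongr
    exact norm_J_le _

theorem continuous_NJ {p : ℝ} (hp : 1 < p) : Continuous (NJ hp) := by
  rw [continuous_iff_continuousAt]
  intro g
  rw [ContinuousAt, tendsto_iff_norm_sub_tendsto_zero]
  have h0 : Tendsto (fun h : L2 => p * (4 * (‖g‖ + 1)) ^ (p - 1) * ‖h - g‖) (𝓝 g) (𝓝 0) := by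
    have := (tendsto_norm_sub_self g).const_mul (p * (4 * (‖g‖ + 1)) ^ (p - 1))
    simpa using this
  refine squeeze_zero' (Eventually.of_forall fun _ => norm_nonneg _) ?_ h0
  filter_upwards [Metric.ball_mem_nhds g one_pos] with h hh
  rw [mem_ball_iff_norm] at hh
  refine norm_NJ_sub_le hp ?_ (by linarith)
  have := norm_sub_norm_le h g
  linarith

/-- The functional `‖Jg‖_{L^{p+3}}^{p+3}`. -/
noncomputable def PhiJ {p : ℝ} (hp : 1 < p) (g : L2) : ℝ :=
  (inner ℂ (J g) (NJ (by linarith : 1 < p + 2) g)).re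

/-- Writing the `(p+3)`-rd power as the pairing of `Jg` with `|Jg|^{p+1} Jg` reduces continuity to
that of `NJ` with exponent `p + 2`. -/
theorem continuous_PhiJ {p : ℝ} (hp : 1 < p) : Continuous (PhiJ hp) :=
  Complex.continuous_re.comp (J.continuous.inner (continuous_NJ _))

theorem re_inner_pw {p : ℝ} (hp : 1 < p) (z : ℂ) :
    (inner ℂ z (pw (p + 2) z) : ℂ) = ((‖z‖ ^ (p + 3) : ℝ) : ℂ) := by
  have h : ‖z‖ ^ (p + 3) = ‖z‖ ^ (p + 2 - 1) * ‖z‖ ^ 2 := by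
    rcases eq_or_ne z 0 with rfl | hz
    · simp [Real.zero_rpow (by linarith : p + 3 ≠ 0)]
    · rw [← Real.rpow_natCast, ← Real.rpow_add (norm_pos_iff.mpr hz)]
      congr 1
      push_cast
      ring
  rw [h, pw, ← smul_eq_mul, inner_smul_right, inner_self_eq_norm_sq_to_K]
  simp

theorem PhiJ_eq {p : ℝ} (hp : 1 < p) (g : L2) :
    Integrable (fun x => ‖J g x‖ ^ (p + 3)) ∧ PhiJ hp g = ∫ x, ‖J g x‖ ^ (p + 3) := by
  have hp2 : 1 < p + 2 := by linarith
  have hi := L2.integrable_inner (𝕜 := ℂ) (J g) (NJ hp2 g)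
  have hae : (fun x => inner ℂ (J g x) (NJ hp2 g x)) =ᵐ[volume]
      fun x => ((‖J g x‖ ^ (p + 3) : ℝ) : ℂ) := by
    filter_upwards [NJ_ae hp2 g] with x hx
    rw [hx, re_inner_pw hp]
  refine ⟨(hi.congr hae).re, ?_⟩
  rw [PhiJ, L2.inner_def, integral_congr_ae hae, integral_complex_ofReal, Complex.ofReal_re]

theorem eLpNorm_J_rpow {p : ℝ} (hp : 1 < p) (g : L2) :
    eLpNorm (J g) (ENNReal.ofReal (p + 3)) volume ^ (p + 3) = ENNReal.ofReal (PhiJ hp g) := by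
  have h0 : 0 < p + 3 := by linarith
  obtain ⟨hi, he⟩ := PhiJ_eq hp g
  rw [eLpNorm_eq_lintegral_rpow_enorm_toReal (by simpa using h0) ENNReal.ofReal_ne_top,
    ENNReal.toReal_ofReal h0.le, ← ENNReal.rpow_mul, one_div, inv_mul_cancel₀ h0.ne',
    ENNReal.rpow_one, he, ofReal_integral_eq_lintegral_ofReal hi
      (Eventually.of_forall fun x => by positivity)]
  refine lintegral_congr fun x => ?_
  rw [← ENNReal.ofReal_rpow_of_nonneg (norm_nonneg _) h0.le, ofReal_norm]

/-! ### The interaction Morawetz functional -/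

theorem continuous_integral_Iic {G : ℝ → ℝ} (hG : Integrable G) :
    Continuous fun x => ∫ y in Set.Iic x, G y := by
  have h : (fun x => ∫ y in Set.Iic x, G y) =
      fun x => (∫ y in Set.Iic 0, G y) + ∫ y in (0 : ℝ)..x, G y := by
    ext x
    rw [← intervalIntegral.integral_Iic_sub_Iic hG.integrableOn hG.integrableOn]
    ring
  rw [h]
  exact continuous_const.add
    (intervalIntegral.continuous_primitive (fun _ _ => hG.intervalIntegrable) 0)

theorem abs_integral_Iic_le {G : ℝ → ℝ} (hG : Integrable G) (x : ℝ) :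
    |∫ y in Set.Iic x, G y| ≤ ∫ y, |G y| :=
  (norm_integral_le_integral_norm _).trans
    (setIntegral_le_integral hG.norm (Eventually.of_forall fun _ => norm_nonneg _))

theorem integrable_mul_integral_Iic {F G : ℝ → ℝ} (hF : Integrable F) (hG : Integrable G) :
    Integrable fun x => F x * ∫ y in Set.Iic x, G y :=
  hF.mul_bdd (c := ∫ y, |G y|) (continuous_integral_Iic hG).aestronglyMeasurable
    (Eventually.of_forall fun x => abs_integral_Iic_le hG x)

theorem abs_tail_le (F G : Lp ℝ 1 (volume : Measure ℝ)) :
    ‖∫ x, F x * ∫ y in Set.Iic x, G y‖ ≤ ‖F‖ * ‖G‖ := by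
  have hF := L1.integrable_coeFn F
  have hG := L1.integrable_coeFn G
  rw [L1.norm_eq_integral_norm F, L1.norm_eq_integral_norm G, ← integral_mul_const]
  refine norm_integral_le_of_norm_le (hF.norm.mul_const _) (Eventually.of_forall fun x => ?_)
  rw [norm_mul]
  gcongr
  exact abs_integral_Iic_le hG x

/-- The form `∫ F(x) (∫_{y ≤ x} G(y) dy) dx` on `L¹`. -/
noncomputable def tailForm :
    Lp ℝ 1 (volume : Measure ℝ) →L[ℝ] Lp ℝ 1 (volume : Measure ℝ) →L[ℝ] ℝ :=
  LinearMap.mkContinuous₂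
    (LinearMap.mk₂ ℝ (fun F G => ∫ x, F x * ∫ y in Set.Iic x, G y)
      (fun F F' G => by
        have hG := L1.integrable_coeFn G
        rw [← integral_add (integrable_mul_integral_Iic (L1.integrable_coeFn F) hG)
          (integrable_mul_integral_Iic (L1.integrable_coeFn F') hG)]
        refine integral_congr_ae ?_
        filter_upwards [Lp.coeFn_add F F'] with x hx
        rw [hx, Pi.add_apply, add_mul])
      (fun c F G => by
        rw [smul_eq_mul, ← integral_const_mul]
        refine integral_congr_ae ?_
        filter_upwards [Lp.coeFn_smul c F] with x hx
        rw [hx, Pi.smul_apply, smul_eq_mul, mul_assoc])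
      (fun F G G' => by
        have hF := L1.integrable_coeFn F
        have hG := L1.integrable_coeFn G
        have hG' := L1.integrable_coeFn G'
        rw [← integral_add (integrable_mul_integral_Iic hF hG)
          (integrable_mul_integral_Iic hF hG')]
        congr 1 with x
        rw [← mul_add, ← integral_add hG.integrableOn hG'.integrableOn]
        congr 1
        exact integral_congr_ae (ae_restrict_of_ae (Lp.coeFn_add G G')))
      (fun c F G => by
        rw [smul_eq_mul, ← integral_const_mul]
        congr 1 with x
        have h : ∫ y in Set.Iic x, (c • G : Lp ℝ 1 (volume : Measure ℝ)) y =
            c * ∫ y in Set.Iic x, G y := by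
          rw [← integral_const_mul]
          exact integral_congr_ae (ae_restrict_of_ae (Lp.coeFn_smul c G))
        rw [h, mul_left_comm])) 1
    (fun F G => by
      rw [one_mul]
      exact abs_tail_le F G)

theorem tailForm_apply (F G : Lp ℝ 1 (volume : Measure ℝ)) :
    tailForm F G = ∫ x, F x * ∫ y in Set.Iic x, G y := rfl

theorem norm_tailForm_le (F G : Lp ℝ 1 (volume : Measure ℝ)) : ‖tailForm F G‖ ≤ ‖F‖ * ‖G‖ :=
  abs_tail_le F G

/-- The density `Re (f̄ g)`. -/
noncomputable def reForm : L2 →L[ℝ] L2 →L[ℝ] Lp ℝ 1 (volume : Measure ℝ) :=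
  (innerSL ℝ : ℂ →L[ℝ] ℂ →L[ℝ] ℝ).holderL volume 2 2 1

/-- The density `Im (f̄ g)`. -/
noncomputable def imForm : L2 →L[ℝ] L2 →L[ℝ] Lp ℝ 1 (volume : Measure ℝ) :=
  ((innerSL ℝ : ℂ →L[ℝ] ℂ →L[ℝ] ℝ) ∘L (ContinuousLinearMap.mul ℝ ℂ Complex.I)).holderL volume 2 2 1

theorem reForm_ae (f g : L2) : reForm f g =ᵐ[volume] fun x => inner ℝ (f x) (g x) :=
  (innerSL ℝ : ℂ →L[ℝ] ℂ →L[ℝ] ℝ).coeFn_holder f g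

theorem imForm_ae (f g : L2) :
    imForm f g =ᵐ[volume] fun x => inner ℝ (Complex.I * f x) (g x) :=
  ((innerSL ℝ : ℂ →L[ℝ] ℂ →L[ℝ] ℝ) ∘L (ContinuousLinearMap.mul ℝ ℂ Complex.I)).coeFn_holder f g

theorem norm_reForm_le (f g : L2) : ‖reForm f g‖ ≤ ‖f‖ * ‖g‖ := by
  refine ((innerSL ℝ : ℂ →L[ℝ] ℂ →L[ℝ] ℝ).norm_holder_apply_apply_le (r := 1) f g).trans ?_
  have h : ‖(innerSL ℝ : ℂ →L[ℝ] ℂ →L[ℝ] ℝ)‖ ≤ 1 := norm_innerSL_le ℝ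
  nlinarith [mul_nonneg (norm_nonneg f) (norm_nonneg g)]

theorem norm_imForm_le (f g : L2) : ‖imForm f g‖ ≤ ‖f‖ * ‖g‖ := by
  let B : ℂ →L[ℝ] ℂ →L[ℝ] ℝ := (innerSL ℝ) ∘L (ContinuousLinearMap.mul ℝ ℂ Complex.I)
  refine (B.norm_holder_apply_apply_le (r := 1) f g).trans ?_
  have h : ‖B‖ ≤ 1 := by
    refine B.opNorm_le_bound zero_le_one fun z => ?_
    change ‖innerSL ℝ (Complex.I * z)‖ ≤ _
    simp
  nlinarith [mul_nonneg (norm_nonneg f) (norm_nonneg g)]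

/-- The quadrilinear form `∫ Im (f̄₁ f₂)(x) (∫_{y ≤ x} Re (f̄₃ f₄)(y) dy) dx`. -/
noncomputable def lam (f₁ f₂ f₃ f₄ : L2) : ℝ := tailForm (imForm f₁ f₂) (reForm f₃ f₄)

theorem abs_lam_le (f₁ f₂ f₃ f₄ : L2) : |lam f₁ f₂ f₃ f₄| ≤ ‖f₁‖ * ‖f₂‖ * (‖f₃‖ * ‖f₄‖) :=
  (norm_tailForm_le _ _).trans
    (mul_le_mul (norm_imForm_le _ _) (norm_reForm_le _ _) (norm_nonneg _) (by positivity))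

theorem continuous_lam : Continuous fun f : L2 × L2 × L2 × L2 => lam f.1 f.2.1 f.2.2.1 f.2.2.2 := by
  unfold lam
  fun_prop

/-- The interaction Morawetz functional of `Jg`. -/
noncomputable def morawetz (g : L2) : ℝ := lam (J g) (D g) (J g) (J g)

/-- The derivative of `morawetz` at `g` in the direction `k`. -/
noncomputable def dmorawetz (g k : L2) : ℝ :=
  lam (J k) (D g) (J g) (J g) + lam (J g) (D k) (J g) (J g)
    + (lam (J g) (D g) (J k) (J g) + lam (J g) (D g) (J g) (J k))

theorem continuous_dmorawetz : Continuous fun x : L2 × L2 => dmorawetz x.1 x.2 := by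
  unfold dmorawetz
  have := J.continuous
  have := D.continuous
  refine ((continuous_lam.comp (f := fun x : L2 × L2 => (J x.2, D x.1, J x.1, J x.1)) ?_).add
    (continuous_lam.comp (f := fun x : L2 × L2 => (J x.1, D x.2, J x.1, J x.1)) ?_)).add
    ((continuous_lam.comp (f := fun x : L2 × L2 => (J x.1, D x.1, J x.2, J x.1)) ?_).add
    (continuous_lam.comp (f := fun x : L2 × L2 => (J x.1, D x.1, J x.1, J x.2)) ?_)) <;> fun_prop

/-- The functional is built from bounded real bilinear maps, so this is the Leibniz rule. Going
through `g` rather than `Jg` makes a derivative in `L²` of `g` sufficient. -/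
theorem hasDerivAt_morawetz {γ : ℝ → L2} {k : L2} {t : ℝ} (h : HasDerivAt γ k t) :
    HasDerivAt (fun t => morawetz (γ t)) (dmorawetz (γ t) k) t := by
  have hJ : HasDerivAt (fun t => J (γ t)) (J k) t :=
    (J.restrictScalars ℝ).hasFDerivAt.comp_hasDerivAt t h
  have hD : HasDerivAt (fun t => D (γ t)) (D k) t :=
    (D.restrictScalars ℝ).hasFDerivAt.comp_hasDerivAt t h
  have h1 := imForm.hasDerivAt_of_bilinear (fun _ => hJ) (fun _ => hD)
  have h2 := reForm.hasDerivAt_of_bilinear (fun _ => hJ) (fun _ => hJ)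
  have h3 := tailForm.hasDerivAt_of_bilinear (fun _ => h1) (fun _ => h2)
  refine h3.congr_deriv ?_
  simp only [dmorawetz, lam, map_add, add_apply]
  ring

theorem lam_toLp (φ₁ φ₂ φ₃ φ₄ : 𝓢(ℝ, ℂ)) :
    lam (φ₁.toLp 2 volume) (φ₂.toLp 2 volume) (φ₃.toLp 2 volume) (φ₄.toLp 2 volume) =
      ∫ x, inner ℝ (Complex.I * φ₁ x) (φ₂ x) * ∫ y in Set.Iic x, inner ℝ (φ₃ y) (φ₄ y) := by
  rw [lam, tailForm_apply]
  have h : reForm (φ₃.toLp 2 volume) (φ₄.toLp 2 volume) =ᵐ[volume]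
      fun x => inner ℝ (φ₃ x) (φ₄ x) := by
    filter_upwards [reForm_ae (φ₃.toLp 2 volume) (φ₄.toLp 2 volume), φ₃.coeFn_toLp 2 volume,
      φ₄.coeFn_toLp 2 volume] with x h1 h2 h3
    rw [h1, h2, h3]
  refine integral_congr_ae ?_
  filter_upwards [imForm_ae (φ₁.toLp 2 volume) (φ₂.toLp 2 volume), φ₁.coeFn_toLp 2 volume,
      φ₂.coeFn_toLp 2 volume] with x h1 h2 h3
  rw [h1, h2, h3]
  congr 1
  exact integral_congr_ae (ae_restrict_of_ae h)

/-! ### The interaction Morawetz inequality at a fixed time, for Schwartz functions -/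

theorem L2_integral_norm_mul_norm_le (f g : L2) :
    Integrable (fun x => ‖f x‖ * ‖g x‖) ∧ ∫ x, ‖f x‖ * ‖g x‖ ≤ ‖f‖ * ‖g‖ := by
  let B := ContinuousLinearMap.mul ℂ ℂ
  let F : Lp ℂ 1 (volume : Measure ℝ) := B.holder 1 f g
  have hF : (fun x => ‖F x‖) =ᵐ[volume] fun x => ‖f x‖ * ‖g x‖ := by
    filter_upwards [B.coeFn_holder (r := 1) f g] with x hx
    simp only [F]
    rw [hx, ContinuousLinearMap.mul_apply', norm_mul]
  refine ⟨(L1.integrable_coeFn F).norm.congr hF, ?_⟩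
  rw [← integral_congr_ae hF, ← L1.norm_eq_integral_norm]
  refine (B.norm_holder_apply_apply_le f g).trans ?_
  have : ‖B‖ ≤ 1 := ContinuousLinearMap.opNorm_mul_le ℂ ℂ
  nlinarith [mul_nonneg (norm_nonneg f) (norm_nonneg g)]

theorem hasDerivAt_integral_Iic {G : ℝ → ℝ} (hG : Integrable G) (hc : Continuous G) (x : ℝ) :
    HasDerivAt (fun x => ∫ y in Set.Iic x, G y) (G x) x := by
  have h : (fun x => ∫ y in Set.Iic x, G y) =
      fun x => (∫ y in Set.Iic 0, G y) + ∫ y in (0 : ℝ)..x, G y := by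
    ext x
    rw [← intervalIntegral.integral_Iic_sub_Iic hG.integrableOn hG.integrableOn]
    ring
  rw [h]
  exact (intervalIntegral.integral_hasDerivAt_right hG.intervalIntegrable
    (hc.stronglyMeasurableAtFilter _ _) hc.continuousAt).const_add _

theorem schwartz_bounded (φ : 𝓢(ℝ, ℂ)) : ∃ C, 0 ≤ C ∧ ∀ x, ‖φ x‖ ≤ C :=
  ⟨SchwartzMap.seminorm ℝ 0 0 φ, apply_nonneg _ _, φ.norm_le_seminorm ℝ⟩

/-- The density `Re (z̄ w)`. -/
noncomputable abbrev reI (z w : ℂ) : ℝ := inner ℝ z w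

/-- The density `Im (z̄ w)`. -/
noncomputable abbrev imI (z w : ℂ) : ℝ := inner ℝ (Complex.I * z) w

theorem abs_reI_le (z w : ℂ) : |reI z w| ≤ ‖z‖ * ‖w‖ := abs_real_inner_le_norm z w

theorem abs_imI_le (z w : ℂ) : |imI z w| ≤ ‖z‖ * ‖w‖ := by
  simpa using abs_real_inner_le_norm (Complex.I * z) w

/-- This pointwise identity is the core of the Morawetz estimate. The group in the first parentheses
on the right is an exact derivative when `R' = |a|²`. The momentum law contributes `2|a'|²|a|²`, and
the mass law contributes `-2 (Im ā a')²`; since `|a|²|a'|² = (Re ā a')² + (Im ā a')²`, only `2 (Re ā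
a')²` survives. Another `2 (Re ā a')²` comes from `½ (∂ₓ|a|²)²`, after moving a derivative in the
dispersive part of the momentum flux. Here `n` stands for `|a|^{p-1}` and `e` for the mass created
by the error to the left of `x`. -/
theorem flux_identity (a a' a'' b b' E : ℂ) (n R e : ℝ) {p : ℝ} (hp : p + 1 ≠ 0)
    (hE : E = (n : ℂ) * a - a'' - Complex.I * b) :
    (imI b a' + imI a b') * R + imI a a' * (-2 * imI a a' - 2 * e) =
      ((imI a b' + imI a' b) * R + imI a b * reI a a
        - ((reI a' a'' + reI a'' a') * R + reI a' a' * reI a a)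
        + 2 / (p + 1) * ((p + 1) * n * reI a a' * R + n * reI a a * reI a a)
        - ((reI a a'' + reI a' a') * reI a a + reI a a' * (reI a a' + reI a' a)))
      + 4 * (reI a a' * reI a a') + (p - 1) / (p + 1) * (n * reI a a * reI a a)
      + (-2 * (reI E a' * R) - reI a E * reI a a - 2 * (imI a a' * e)) := by
  subst hE
  simp only [imI, reI, Complex.inner, Complex.mul_re, Complex.mul_im, Complex.conj_re,
    Complex.conj_im, Complex.I_re, Complex.I_im, Complex.sub_re, Complex.sub_im,
    Complex.ofReal_re, Complex.ofReal_im, map_mul, Complex.conj_I, Complex.neg_re, Complex.neg_im]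
  field_simp
  ring

theorem continuous_reI {f g : ℝ → ℂ} (hf : Continuous f) (hg : Continuous g) :
    Continuous fun x => reI (f x) (g x) := hf.inner hg

theorem continuous_imI {f g : ℝ → ℂ} (hf : Continuous f) (hg : Continuous g) :
    Continuous fun x => imI (f x) (g x) := (continuous_const.mul hf).inner hg

theorem integrable_reI {f g : ℝ → ℂ} (hf : Continuous f) (hg : Continuous g)
    (h : Integrable fun x => ‖f x‖ * ‖g x‖) : Integrable fun x => reI (f x) (g x) :=
  h.mono' (continuous_reI hf hg).aestronglyMeasurable
    (Eventually.of_forall fun _ => abs_reI_le _ _)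

theorem integrable_imI {f g : ℝ → ℂ} (hf : Continuous f) (hg : Continuous g)
    (h : Integrable fun x => ‖f x‖ * ‖g x‖) : Integrable fun x => imI (f x) (g x) :=
  h.mono' (continuous_imI hf hg).aestronglyMeasurable
    (Eventually.of_forall fun _ => abs_imI_le _ _)

theorem integrable_schwartz_reI (φ ψ : 𝓢(ℝ, ℂ)) : Integrable fun x => reI (φ x) (ψ x) :=
  integrable_reI φ.continuous ψ.continuous (integrable_schwartz_mul_norm φ ψ)

theorem integrable_schwartz_imI (φ ψ : 𝓢(ℝ, ℂ)) : Integrable fun x => imI (φ x) (ψ x) :=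
  integrable_imI φ.continuous ψ.continuous (integrable_schwartz_mul_norm φ ψ)

theorem hasDerivAt_reI {f g : ℝ → ℂ} {f' g' : ℂ} {x : ℝ} (hf : HasDerivAt f f' x)
    (hg : HasDerivAt g g' x) :
    HasDerivAt (fun x => reI (f x) (g x)) (reI (f x) g' + reI f' (g x)) x := hf.inner ℝ hg

theorem hasDerivAt_imI {f g : ℝ → ℂ} {f' g' : ℂ} {x : ℝ} (hf : HasDerivAt f f' x)
    (hg : HasDerivAt g g' x) :
    HasDerivAt (fun x => imI (f x) (g x)) (imI (f x) g' + imI f' (g x)) x :=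
  (hf.const_mul Complex.I).inner ℝ hg

theorem hasDerivAt_norm_rpow_comp {p : ℝ} (hp : 1 < p) {f : ℝ → ℂ} {f' : ℂ} {x : ℝ}
    (hf : HasDerivAt f f' x) :
    HasDerivAt (fun x => ‖f x‖ ^ (p + 1)) ((p + 1) * ‖f x‖ ^ (p - 1) * reI (f x) f') x := by
  have h := (hasFDerivAt_norm_rpow (f x) (by linarith : 1 < p + 1)).comp_hasDerivAt x hf
  refine h.congr_deriv ?_
  rw [show p + 1 - 2 = p - 1 by ring]
  rfl

theorem norm_rpow_add_one {p : ℝ} (hp : 1 < p) (z : ℂ) :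
    ‖z‖ ^ (p + 1) = ‖z‖ ^ (p - 1) * reI z z := by
  rw [reI, real_inner_self_eq_norm_sq, ← Real.rpow_two, ← Real.rpow_add_of_nonneg (norm_nonneg z)
    (by linarith) (by norm_num)]
  congr 1
  ring

theorem norm_rpow_add_three {p : ℝ} (hp : 1 < p) (z : ℂ) :
    ‖z‖ ^ (p + 3) = ‖z‖ ^ (p - 1) * reI z z * reI z z := by
  rw [← norm_rpow_add_one hp, reI, real_inner_self_eq_norm_sq, ← Real.rpow_two,
    ← Real.rpow_add_of_nonneg (norm_nonneg z) (by linarith) (by norm_num)]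
  congr 1
  ring

theorem morawetz_inequality_schwartz {p : ℝ} (hp : 1 < p) (a b : 𝓢(ℝ, ℂ)) (E : L2)
    (hE : E =ᵐ[volume] fun x => pw p (a x)
      - SchwartzMap.derivCLM ℂ ℂ (SchwartzMap.derivCLM ℂ ℂ a) x - Complex.I * b x) :
    (p - 1) / (p + 1) * ∫ x, ‖a x‖ ^ (p + 3)
      ≤ lam (b.toLp 2 volume) ((SchwartzMap.derivCLM ℂ ℂ a).toLp 2 volume)
            (a.toLp 2 volume) (a.toLp 2 volume)
          + lam (a.toLp 2 volume) ((SchwartzMap.derivCLM ℂ ℂ b).toLp 2 volume)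
            (a.toLp 2 volume) (a.toLp 2 volume)
          + (lam (a.toLp 2 volume) ((SchwartzMap.derivCLM ℂ ℂ a).toLp 2 volume)
            (b.toLp 2 volume) (a.toLp 2 volume)
          + lam (a.toLp 2 volume) ((SchwartzMap.derivCLM ℂ ℂ a).toLp 2 volume)
            (a.toLp 2 volume) (b.toLp 2 volume))
        + 6 * ‖a.toLp 2 (volume : Measure ℝ)‖ ^ 2 *
          ‖(SchwartzMap.derivCLM ℂ ℂ a).toLp 2 (volume : Measure ℝ)‖ * ‖E‖ := by
  set a' := SchwartzMap.derivCLM ℂ ℂ a with ha'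
  set a'' := SchwartzMap.derivCLM ℂ ℂ a' with ha''
  set b' := SchwartzMap.derivCLM ℂ ℂ b with hb'
  set A := ‖a.toLp 2 (volume : Measure ℝ)‖ with hA
  set A' := ‖a'.toLp 2 (volume : Measure ℝ)‖ with hA'
  set F : ℝ → ℂ := fun x => pw p (a x) - a'' x - Complex.I * b x with hF
  have hA0 : 0 ≤ A := norm_nonneg _
  have hA0' : 0 ≤ A' := norm_nonneg _
  have hda : ∀ x, HasDerivAt a (a' x) x := hasDerivAt_schwartz a
  have hda' : ∀ x, HasDerivAt a' (a'' x) x := hasDerivAt_schwartz a'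
  have hdb : ∀ x, HasDerivAt b (b' x) x := hasDerivAt_schwartz b
  have hFc : Continuous F :=
    (((continuous_pw hp).comp a.continuous).sub a''.continuous).sub
      (continuous_const.mul b.continuous)
  -- integrals against `F`
  have hFint : ∀ φ : 𝓢(ℝ, ℂ), Integrable (fun x => ‖φ x‖ * ‖F x‖) ∧
      ∫ x, ‖φ x‖ * ‖F x‖ ≤ ‖φ.toLp 2 (volume : Measure ℝ)‖ * ‖E‖ := by
    intro φ
    obtain ⟨h1, h2⟩ := L2_integral_norm_mul_norm_le (φ.toLp 2 volume) E
    have hae : (fun x => ‖φ.toLp 2 (volume : Measure ℝ) x‖ * ‖E x‖) =ᵐ[volume]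
        fun x => ‖φ x‖ * ‖F x‖ := by
      filter_upwards [φ.coeFn_toLp 2 volume, hE] with x hx hx'
      rw [hx, hx']
    rw [integral_congr_ae hae] at h2
    exact ⟨h1.congr hae, h2⟩
  -- mass to the left of `x`
  set R : ℝ → ℝ := fun x => ∫ y in Set.Iic x, reI (a y) (a y) with hR
  have hiaa := integrable_schwartz_reI a a
  have hdR : ∀ x, HasDerivAt R (reI (a x) (a x)) x :=
    hasDerivAt_integral_Iic hiaa (continuous_reI a.continuous a.continuous)
  have hreaa : ∀ x, reI (a x) (a x) = ‖a x‖ ^ 2 := fun x => real_inner_self_eq_norm_sq (a x)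
  have hRb : ∀ x, |R x| ≤ A ^ 2 := by
    intro x
    refine (abs_integral_Iic_le hiaa x).trans ?_
    rw [hA, norm_schwartz_toLp_sq]
    refine (integral_congr_ae (Eventually.of_forall fun y => ?_)).le
    rw [hreaa, abs_of_nonneg (by positivity)]
  set e : ℝ → ℝ := fun x => ∫ y in Set.Iic x, imI (a y) (F y) with he
  have hiaF : Integrable fun y => imI (a y) (F y) := integrable_imI a.continuous hFc (hFint a).1
  have heb : ∀ x, |e x| ≤ A * ‖E‖ := by
    intro x
    refine (abs_integral_Iic_le hiaF x).trans (le_trans ?_ (hFint a).2)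
    exact integral_mono hiaF.abs (hFint a).1 fun y => abs_imI_le _ _
  -- the time derivative of the mass to the left of `x`
  have hS : ∀ x, (∫ y in Set.Iic x, (reI (b y) (a y) + reI (a y) (b y))) =
      -2 * imI (a x) (a' x) - 2 * e x := by
    intro x
    have hP := integral_Iic_of_hasDerivAt_of_tendsto' (a := x) (f := fun y => imI (a y) (a' y))
      (f' := fun y => imI (a y) (a'' y) + imI (a' y) (a' y)) (m := 0)
      (fun y _ => hasDerivAt_imI (hda y) (hda' y))
      ((integrable_schwartz_imI a a'').add (integrable_schwartz_imI a' a')).integrableOn (by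
        have := (((schwartz_tendsto_atBot a).const_mul Complex.I).inner
          (schwartz_tendsto_atBot a') (𝕜 := ℝ))
        simpa using this)
    rw [sub_zero] at hP
    rw [he, ← hP]
    change _ = -2 * _ - 2 * ∫ y in Set.Iic x, imI (a y) (F y)
    have hi1 : Integrable fun y => -2 * (imI (a y) (a'' y) + imI (a' y) (a' y)) :=
      ((integrable_schwartz_imI a a'').add (integrable_schwartz_imI a' a')).const_mul _
    have hi2 : Integrable fun y => 2 * imI (a y) (F y) := hiaF.const_mul 2
    rw [← integral_const_mul, ← integral_const_mul, ← integral_sub hi1.integrableOn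
      hi2.integrableOn]
    congr 1 with y
    simp only [hF, pw, imI, reI, Complex.inner, Complex.mul_re, Complex.mul_im, Complex.conj_re,
      Complex.conj_im, Complex.I_re, Complex.I_im, Complex.sub_re, Complex.sub_im,
      Complex.ofReal_re, Complex.ofReal_im, map_mul, Complex.conj_I, Complex.neg_re,
      Complex.neg_im]
    ring
  -- the flux
  set Θ : ℝ → ℝ := fun x => imI (a x) (b x) * R x - reI (a' x) (a' x) * R x
    + 2 / (p + 1) * (‖a x‖ ^ (p + 1) * R x) - reI (a x) (a' x) * reI (a x) (a x) with hΘ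
  set flux : ℝ → ℝ := fun x =>
    (imI (a x) (b' x) + imI (a' x) (b x)) * R x + imI (a x) (b x) * reI (a x) (a x)
      - ((reI (a' x) (a'' x) + reI (a'' x) (a' x)) * R x + reI (a' x) (a' x) * reI (a x) (a x))
      + 2 / (p + 1) * ((p + 1) * ‖a x‖ ^ (p - 1) * reI (a x) (a' x) * R x
        + ‖a x‖ ^ (p - 1) * reI (a x) (a x) * reI (a x) (a x))
      - ((reI (a x) (a'' x) + reI (a' x) (a' x)) * reI (a x) (a x)
        + reI (a x) (a' x) * (reI (a x) (a' x) + reI (a' x) (a x))) with hflux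
  have hdΘ : ∀ x, HasDerivAt Θ (flux x) x := by
    intro x
    have h1 := (hasDerivAt_imI (hda x) (hdb x)).mul (hdR x)
    have h2 := (hasDerivAt_reI (hda' x) (hda' x)).mul (hdR x)
    have h3 := ((hasDerivAt_norm_rpow_comp hp (hda x)).mul (hdR x)).const_mul (2 / (p + 1))
    have h4 := (hasDerivAt_reI (hda x) (hda' x)).mul (hasDerivAt_reI (hda x) (hda x))
    refine (((h1.sub h2).add h3).sub h4).congr_deriv ?_
    simp only [hflux]
    rw [norm_rpow_add_one hp]
  -- `R` need not vanish at `+∞`, but it is bounded by the mass, and every term of `Θ` has another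
  -- factor that tends to zero.
  have hΘlim : ∀ l : Filter ℝ, Tendsto a l (𝓝 0) → Tendsto a' l (𝓝 0) → Tendsto b l (𝓝 0) →
      Tendsto Θ l (𝓝 0) := by
    intro l h1 h2 h3
    have hlim : Tendsto (fun x => ‖a x‖ * ‖b x‖ * A ^ 2 + ‖a' x‖ * ‖a' x‖ * A ^ 2
        + 2 / (p + 1) * (‖a x‖ ^ (p + 1) * A ^ 2) + ‖a x‖ * ‖a' x‖ * (‖a x‖ * ‖a x‖)) l (𝓝 0) := by
      have h4 := h1.norm.rpow_const (p := p + 1) (Or.inr (by linarith))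
      have := (((((h1.norm.mul h3.norm).mul_const (A ^ 2)).add
        ((h2.norm.mul h2.norm).mul_const (A ^ 2))).add
        ((h4.mul_const (A ^ 2)).const_mul (2 / (p + 1)))).add
        ((h1.norm.mul h2.norm).mul (h1.norm.mul h1.norm)))
      simpa [Real.zero_rpow (by linarith : p + 1 ≠ 0)] using this
    refine squeeze_zero_norm (fun x => ?_) hlim
    have hp1 : 0 < p + 1 := by linarith
    simp only [hΘ, Real.norm_eq_abs]
    refine (abs_sub _ _).trans (add_le_add ((abs_add_le _ _).trans (add_le_add
      ((abs_sub _ _).trans (add_le_add ?_ ?_)) ?_)) ?_)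
    · rw [abs_mul]
      exact mul_le_mul (abs_imI_le _ _) (hRb x) (abs_nonneg _) (by positivity)
    · rw [abs_mul]
      exact mul_le_mul (abs_reI_le _ _) (hRb x) (abs_nonneg _) (by positivity)
    · rw [abs_mul, abs_mul, abs_of_pos (by positivity : 0 < 2 / (p + 1)),
        abs_of_nonneg (by positivity : 0 ≤ ‖a x‖ ^ (p + 1))]
      gcongr
      exact hRb x
    · rw [abs_mul]
      exact mul_le_mul (abs_reI_le _ _) (abs_reI_le _ _) (abs_nonneg _) (by positivity)
  -- the integrand of the derivative of the Morawetz functional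
  set tot : ℝ → ℝ := fun x => (imI (b x) (a' x) + imI (a x) (b' x)) * R x
    + imI (a x) (a' x) * ∫ y in Set.Iic x, (reI (b y) (a y) + reI (a y) (b y)) with htot
  have hj1 : Integrable fun x => imI (b x) (a' x) * R x :=
    integrable_mul_integral_Iic (integrable_schwartz_imI b a') hiaa
  have hj2 : Integrable fun x => imI (a x) (b' x) * R x :=
    integrable_mul_integral_Iic (integrable_schwartz_imI a b') hiaa
  have hiba := integrable_schwartz_reI b a
  have hiab := integrable_schwartz_reI a b
  have hia' := integrable_schwartz_imI a a'
  have hj3 : Integrable fun x => imI (a x) (a' x) * ∫ y in Set.Iic x, reI (b y) (a y) :=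
    integrable_mul_integral_Iic hia' hiba
  have hj4 : Integrable fun x => imI (a x) (a' x) * ∫ y in Set.Iic x, reI (a y) (b y) :=
    integrable_mul_integral_Iic hia' hiab
  have htot' : tot = fun x => imI (b x) (a' x) * R x + imI (a x) (b' x) * R x
      + (imI (a x) (a' x) * (∫ y in Set.Iic x, reI (b y) (a y))
        + imI (a x) (a' x) * ∫ y in Set.Iic x, reI (a y) (b y)) := by
    ext x
    simp only [htot]
    rw [integral_add hiba.integrableOn hiab.integrableOn]
    ring
  have hitot : Integrable tot := by
    rw [htot']
    exact (hj1.add hj2).add (hj3.add hj4)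
  have hrhs : lam (b.toLp 2 volume) (a'.toLp 2 volume) (a.toLp 2 volume) (a.toLp 2 volume)
      + lam (a.toLp 2 volume) (b'.toLp 2 volume) (a.toLp 2 volume) (a.toLp 2 volume)
      + (lam (a.toLp 2 volume) (a'.toLp 2 volume) (b.toLp 2 volume) (a.toLp 2 volume)
      + lam (a.toLp 2 volume) (a'.toLp 2 volume) (a.toLp 2 volume) (b.toLp 2 volume))
      = ∫ x, tot x := by
    have hs1 := integral_add hj1 hj2
    have hs2 := integral_add hj3 hj4
    have hs3 := integral_add (hj1.add hj2) (hj3.add hj4)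
    simp only [lam_toLp]
    rw [htot']
    exact ((congrArg₂ (· + ·) hs1 hs2).symm.trans hs3.symm)
  set err : ℝ → ℝ := fun x => -2 * (reI (F x) (a' x) * R x) - reI (a x) (F x) * reI (a x) (a x)
    - 2 * (imI (a x) (a' x) * e x) with herr
  have hid : ∀ x, tot x = flux x + (4 * (reI (a x) (a' x) * reI (a x) (a' x))
      + (p - 1) / (p + 1) * ‖a x‖ ^ (p + 3) + err x) := by
    intro x
    simp only [htot]
    rw [hS, flux_identity (a x) (a' x) (a'' x) (b x) (b' x) (F x) (‖a x‖ ^ (p - 1)) (R x) (e x)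
      (by linarith : p + 1 ≠ 0) rfl, norm_rpow_add_three hp]
    simp only [hflux, herr]
    ring
  obtain ⟨Ca, hCa0, hCa⟩ := schwartz_bounded a
  obtain ⟨Cd, hCd0, hCd⟩ := schwartz_bounded a'
  have hk1 : Integrable fun x => reI (a x) (a' x) * reI (a x) (a' x) :=
    (integrable_schwartz_reI a a').mul_bdd (c := Ca * Cd)
      (continuous_reI a.continuous a'.continuous).aestronglyMeasurable
      (Eventually.of_forall fun x => (abs_reI_le _ _).trans
        (mul_le_mul (hCa x) (hCd x) (norm_nonneg _) hCa0))
  have hk2 : Integrable fun x => ‖a x‖ ^ (p + 3) := by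
    refine ((integrable_schwartz_mul_norm a a).const_mul (Ca ^ (p + 1))).mono'
      (a.continuous.norm.rpow_const fun _ => Or.inr (by linarith)).aestronglyMeasurable
      (Eventually.of_forall fun x => ?_)
    rw [Real.norm_of_nonneg (by positivity), show p + 3 = p + 1 + 2 by ring,
      Real.rpow_add_of_nonneg (norm_nonneg _) (by linarith) (by norm_num), Real.rpow_two, sq]
    gcongr
    · exact hCa x
  have hiFa : Integrable fun x => reI (F x) (a' x) := by
    refine integrable_reI hFc a'.continuous ?_
    simpa [mul_comm] using (hFint a').1
  have hk3 : Integrable fun x => reI (F x) (a' x) * R x := integrable_mul_integral_Iic hiFa hiaa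
  have hk4 : Integrable fun x => reI (a x) (F x) * reI (a x) (a x) :=
    (integrable_reI a.continuous hFc (hFint a).1).mul_bdd (c := Ca * Ca)
      (continuous_reI a.continuous a.continuous).aestronglyMeasurable
      (Eventually.of_forall fun x => (abs_reI_le _ _).trans
        (mul_le_mul (hCa x) (hCa x) (norm_nonneg _) hCa0))
  have hk5 : Integrable fun x => imI (a x) (a' x) * e x := integrable_mul_integral_Iic hia' hiaF
  have hierr : Integrable err := ((hk3.const_mul (-2)).sub hk4).sub (hk5.const_mul 2)
  have hiK : Integrable fun x => 4 * (reI (a x) (a' x) * reI (a x) (a' x))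
      + (p - 1) / (p + 1) * ‖a x‖ ^ (p + 3) + err x :=
    ((hk1.const_mul 4).add (hk2.const_mul _)).add hierr
  -- Every other term of the identity `hid` is known to be integrable, so its remaining term is as
  -- well.
  have hiflux : Integrable flux := by
    refine (hitot.sub hiK).congr (Eventually.of_forall fun x => ?_)
    simp only [Pi.sub_apply]
    rw [hid x]
    ring
  have hflux0 : ∫ x, flux x = 0 := by
    have := integral_of_hasDerivAt_of_tendsto hdΘ hiflux
      (hΘlim atBot (schwartz_tendsto_atBot a) (schwartz_tendsto_atBot a') (schwartz_tendsto_atBot b))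
      (hΘlim atTop (schwartz_tendsto_atTop a) (schwartz_tendsto_atTop a') (schwartz_tendsto_atTop b))
    simpa using this
  have htoteq : ∫ x, tot x = ∫ x, (4 * (reI (a x) (a' x) * reI (a x) (a' x))
      + (p - 1) / (p + 1) * ‖a x‖ ^ (p + 3) + err x) := by
    rw [integral_congr_ae (Eventually.of_forall hid), integral_add hiflux hiK, hflux0, zero_add]
  -- lower bound
  have hlow : ∀ x, (p - 1) / (p + 1) * ‖a x‖ ^ (p + 3)
      - (2 * A ^ 2 * (‖a' x‖ * ‖F x‖) + 2 * A * A' * (‖a x‖ * ‖F x‖)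
        + 2 * (A * ‖E‖) * (‖a x‖ * ‖a' x‖))
      ≤ 4 * (reI (a x) (a' x) * reI (a x) (a' x))
        + (p - 1) / (p + 1) * ‖a x‖ ^ (p + 3) + err x := by
    intro x
    have e1 : |reI (F x) (a' x) * R x| ≤ A ^ 2 * (‖a' x‖ * ‖F x‖) := by
      rw [abs_mul, mul_comm]
      refine mul_le_mul (hRb x) ?_ (abs_nonneg _) (by positivity)
      rw [mul_comm]
      exact abs_reI_le _ _
    have e2 : |reI (a x) (F x) * reI (a x) (a x)| ≤ 2 * A * A' * (‖a x‖ * ‖F x‖) := by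
      rw [abs_mul, mul_comm]
      refine mul_le_mul ?_ (abs_reI_le _ _) (abs_nonneg _) (by positivity)
      rw [hreaa, abs_of_nonneg (by positivity)]
      exact norm_sq_schwartz_le a x
    have e3 : |imI (a x) (a' x) * e x| ≤ A * ‖E‖ * (‖a x‖ * ‖a' x‖) := by
      rw [abs_mul, mul_comm]
      exact mul_le_mul (heb x) (abs_imI_le _ _) (abs_nonneg _) (by positivity)
    have e4 := mul_self_nonneg (reI (a x) (a' x))
    simp only [herr]
    linarith [le_abs_self (reI (F x) (a' x) * R x), le_abs_self (reI (a x) (F x) * reI (a x) (a x)),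
      le_abs_self (imI (a x) (a' x) * e x)]
  have hi1 : Integrable fun x => 2 * A ^ 2 * (‖a' x‖ * ‖F x‖) := (hFint a').1.const_mul _
  have hi2 : Integrable fun x => 2 * A * A' * (‖a x‖ * ‖F x‖) := (hFint a).1.const_mul _
  have hi3 : Integrable fun x => 2 * (A * ‖E‖) * (‖a x‖ * ‖a' x‖) :=
    (integrable_schwartz_mul_norm a a').const_mul _
  have hi4 : Integrable fun x => (p - 1) / (p + 1) * ‖a x‖ ^ (p + 3) := hk2.const_mul _
  have hmono := integral_mono (hi4.sub ((hi1.add hi2).add hi3)) hiK hlow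
  have hs1 := integral_sub hi4 ((hi1.add hi2).add hi3)
  have hs2 := integral_add (hi1.add hi2) hi3
  have hs3 := integral_add hi1 hi2
  simp only [Pi.add_apply, Pi.sub_apply] at hmono hs1 hs2 hs3
  rw [hs1, hs2, hs3, integral_const_mul, integral_const_mul, integral_const_mul,
    integral_const_mul] at hmono
  -- Each of the three error terms is at most `2 A² A' ‖E‖`, which gives the constant `6`.
  have b1 : 2 * A ^ 2 * ∫ x, ‖a' x‖ * ‖F x‖ ≤ 2 * A ^ 2 * (A' * ‖E‖) := by
    gcongr
    exact (hFint a').2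
  have b2 : 2 * A * A' * ∫ x, ‖a x‖ * ‖F x‖ ≤ 2 * A * A' * (A * ‖E‖) := by
    gcongr
    exact (hFint a).2
  have b3 : 2 * (A * ‖E‖) * ∫ x, ‖a x‖ * ‖a' x‖ ≤ 2 * (A * ‖E‖) * (A * A') := by
    gcongr
    exact integral_norm_mul_norm_le a a'
  rw [hrhs, htoteq]
  nlinarith

/-! ### The interaction Morawetz inequality at a fixed time -/

theorem JS_derivCLM (φ : 𝓢(ℝ, ℂ)) :
    JS (SchwartzMap.derivCLM ℂ ℂ φ) = SchwartzMap.derivCLM ℂ ℂ (JS φ) := by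
  rw [schwartz_derivCLM_eq, schwartz_derivCLM_eq, JS, JS,
    SchwartzMap.fourierMultiplierCLM_fourierMultiplierCLM_apply (besselSymbol_temperate _)
      derivSymbol_temperate,
    SchwartzMap.fourierMultiplierCLM_fourierMultiplierCLM_apply derivSymbol_temperate
      (besselSymbol_temperate _), mul_comm]

theorem J_injective : Function.Injective J := by
  intro f g h
  apply toTemperedDistribution_injective
  have h1 : TemperedDistribution.besselPotential ℝ ℂ (-1) (Lp.toTemperedDistribution f) =
      TemperedDistribution.besselPotential ℝ ℂ (-1) (Lp.toTemperedDistribution g) := by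
    rw [besselPotential_eq, ← toTemperedDistribution_J, ← toTemperedDistribution_J, h]
  have h2 := congrArg (TemperedDistribution.besselPotential ℝ ℂ 1) h1
  simpa using h2

/-- With `a = JJq` and `b = Jk` the error is determined by `(q, k)`, and both sides are continuous
on `L² × L²`; hence it is enough to check Schwartz `q` and `k`. -/
theorem morawetz_inequality_H2 {p : ℝ} (hp : 1 < p) (q k : L2) :
    (p - 1) / (p + 1) * PhiJ hp (J q) ≤ dmorawetz (J q) k
      + 6 * ‖J (J q)‖ ^ 2 * ‖D (J q)‖ * ‖NJ hp (J q) - D (D q) - Complex.I • J k‖ := by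
  have hJ := J.continuous
  have hD := D.continuous
  have hN := continuous_NJ hp
  have hP := continuous_PhiJ hp
  have hM : Continuous fun x : L2 × L2 => dmorawetz (J x.1) x.2 :=
    continuous_dmorawetz.comp (f := fun x : L2 × L2 => (J x.1, x.2)) (by fun_prop)
  have hclosed : IsClosed {x : L2 × L2 | (p - 1) / (p + 1) * PhiJ hp (J x.1) ≤
      dmorawetz (J x.1) x.2 + 6 * ‖J (J x.1)‖ ^ 2 * ‖D (J x.1)‖ *
        ‖NJ hp (J x.1) - D (D x.1) - Complex.I • J x.2‖} := by
    refine isClosed_le ?_ ?_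
    · exact continuous_const.mul (hP.comp (hJ.comp continuous_fst))
    · refine hM.add ?_
      have h1 : Continuous fun x : L2 × L2 => NJ hp (J x.1) := hN.comp (hJ.comp continuous_fst)
      fun_prop
  have hd : DenseRange (SchwartzMap.toLpCLM ℂ ℂ 2 (volume : Measure ℝ)) :=
    SchwartzMap.denseRange_toLpCLM ENNReal.ofNat_ne_top
  refine hd.induction_on₂ (p := fun q k => (q, k) ∈ {x : L2 × L2 | (p - 1) / (p + 1) *
    PhiJ hp (J x.1) ≤ dmorawetz (J x.1) x.2 + 6 * ‖J (J x.1)‖ ^ 2 * ‖D (J x.1)‖ *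
        ‖NJ hp (J x.1) - D (D x.1) - Complex.I • J x.2‖}) hclosed (fun φ ψ => ?_) q k
  change (p - 1) / (p + 1) * PhiJ hp (J (φ.toLp 2 volume)) ≤
    dmorawetz (J (φ.toLp 2 volume)) (ψ.toLp 2 volume) + 6 * ‖J (J (φ.toLp 2 volume))‖ ^ 2 *
      ‖D (J (φ.toLp 2 volume))‖ * ‖NJ hp (J (φ.toLp 2 volume)) - D (D (φ.toLp 2 volume))
        - Complex.I • J (ψ.toLp 2 volume)‖
  set E := NJ hp (J (φ.toLp 2 volume)) - D (D (φ.toLp 2 volume))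
        - Complex.I • J (ψ.toLp 2 volume) with hEdef
  have hJJ : J (J (φ.toLp 2 volume)) = (JS (JS φ)).toLp 2 volume := by rw [J_toLp, J_toLp]
  have hDJ : D (J (φ.toLp 2 volume)) = (SchwartzMap.derivCLM ℂ ℂ (JS (JS φ))).toLp 2 volume := by
    rw [J_toLp, D_toLp]
  have hDD : D (D (φ.toLp 2 volume)) = (SchwartzMap.derivCLM ℂ ℂ
      (SchwartzMap.derivCLM ℂ ℂ (JS (JS φ)))).toLp 2 volume := by
    rw [D_toLp, D_toLp, JS_derivCLM]
  have hE : E =ᵐ[volume] fun x => pw p (JS (JS φ) x) - SchwartzMap.derivCLM ℂ ℂ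
      (SchwartzMap.derivCLM ℂ ℂ (JS (JS φ))) x - Complex.I * JS ψ x := by
    rw [hEdef, hDD, J_toLp ψ]
    set a'' := SchwartzMap.derivCLM ℂ ℂ (SchwartzMap.derivCLM ℂ ℂ (JS (JS φ)))
    filter_upwards [Lp.coeFn_sub (NJ hp (J (φ.toLp 2 volume)) - a''.toLp 2 volume)
      (Complex.I • (JS ψ).toLp 2 volume),
      Lp.coeFn_sub (NJ hp (J (φ.toLp 2 volume))) (a''.toLp 2 volume),
      Lp.coeFn_smul Complex.I ((JS ψ).toLp 2 volume), NJ_ae hp (J (φ.toLp 2 volume)),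
      a''.coeFn_toLp 2 volume, (JS ψ).coeFn_toLp 2 volume, (JS (JS φ)).coeFn_toLp 2 volume]
      with x h1 h2 h3 h4 h5 h6 h7
    rw [h1, Pi.sub_apply, h2, Pi.sub_apply, h3, Pi.smul_apply, h4, h5, h6, hJJ, h7, smul_eq_mul]
  have hPhi : PhiJ hp (J (φ.toLp 2 volume)) = ∫ x, ‖JS (JS φ) x‖ ^ (p + 3) := by
    rw [(PhiJ_eq hp _).2, hJJ]
    refine integral_congr_ae ?_
    filter_upwards [(JS (JS φ)).coeFn_toLp 2 volume] with x hx
    rw [hx]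
  rw [hPhi, dmorawetz, hJJ, hDJ, J_toLp ψ, D_toLp ψ]
  exact morawetz_inequality_schwartz hp (JS (JS φ)) (JS ψ) E hE

/-- The interaction Morawetz inequality at a fixed time: here `a = Jg` is the solution, `b = Jk` its
time derivative and `i b + a'' = |a|^{p-1} a - E`. -/
theorem morawetz_inequality {p : ℝ} (hp : 1 < p) (g k E : L2)
    (h : TemperedDistribution.derivCLM ℂ
        (TemperedDistribution.derivCLM ℂ (Lp.toTemperedDistribution (J g))) =
      Lp.toTemperedDistribution (NJ hp g - E - Complex.I • J k)) :
    (p - 1) / (p + 1) * PhiJ hp g ≤ dmorawetz g k + 6 * ‖J g‖ ^ 2 * ‖D g‖ * ‖E‖ := by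
  -- All other terms of the equation are in `L²`, so the equation itself upgrades `Jg` from `H¹` to
  -- `H²`.
  obtain ⟨q, hq, hq2⟩ := exists_eq_J_J h.symm
  obtain rfl := J_injective hq
  have hE : NJ hp (J q) - D (D q) - Complex.I • J k = E := by
    rw [← hq2]
    abel
  have := morawetz_inequality_H2 hp q k
  rwa [hE] at this

noncomputable section

/-! ### Mollification -/

/-- The convolution `f * κ` on the line. -/
def mollify (κ f : ℝ → ℂ) (x : ℝ) : ℂ :=
  ∫ y, f y * κ (x - y)

theorem mollify_congr_ae {κ f g : ℝ → ℂ} (h : f =ᵐ[volume] g) (x : ℝ) :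
    mollify κ f x = mollify κ g x :=
  integral_congr_ae (by filter_upwards [h] with y hy; rw [hy])

/-- This is Jensen's inequality for the finite measure `|κ(x - y)| dy`. -/
theorem enorm_mollify_rpow_le {q : ℝ} (hq : 1 ≤ q) {κ f : ℝ → ℂ} (hκ : Continuous κ)
    (hf : AEStronglyMeasurable f volume) (x : ℝ) :
    ‖mollify κ f x‖ₑ ^ q ≤
      (∫⁻ y, ‖κ (x - y)‖ₑ * ‖f y‖ₑ ^ q) * (∫⁻ y, ‖κ y‖ₑ) ^ (q - 1) := by
  have hq0 : 0 < q := by linarith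
  have hm : Measurable fun y => ‖κ (x - y)‖ₑ :=
    (hκ.comp (continuous_const.sub continuous_id)).enorm.measurable
  set ν : Measure ℝ := volume.withDensity fun y => ‖κ (x - y)‖ₑ with hν
  have hac : ν ≪ volume := withDensity_absolutelyContinuous _ _
  have hfin : ∀ᵐ y ∂(volume : Measure ℝ), ‖κ (x - y)‖ₑ < ⊤ := by simp
  have huniv : ν Set.univ = ∫⁻ y, ‖κ y‖ₑ := by
    rw [hν, withDensity_apply _ MeasurableSet.univ, Measure.restrict_univ,
      lintegral_sub_left_eq_self (fun y => ‖κ y‖ₑ) x]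
  have h1 : ‖mollify κ f x‖ₑ ≤ eLpNorm' f 1 ν := by
    refine (enorm_integral_le_lintegral_enorm _).trans (le_of_eq ?_)
    rw [eLpNorm', hν, lintegral_withDensity_eq_lintegral_mul_non_measurable _ hm hfin]
    simp [mul_comm]
  have h2 := eLpNorm'_le_eLpNorm'_mul_rpow_measure_univ one_pos hq (hf.mono_ac hac)
  calc ‖mollify κ f x‖ₑ ^ q
      ≤ (eLpNorm' f q ν * ν Set.univ ^ (1 / 1 - 1 / q)) ^ q :=
        ENNReal.rpow_le_rpow (h1.trans h2) hq0.le
    _ = _ := by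
        rw [ENNReal.mul_rpow_of_nonneg _ _ hq0.le, eLpNorm', ← ENNReal.rpow_mul,
          ← ENNReal.rpow_mul, one_div_mul_cancel hq0.ne', ENNReal.rpow_one, huniv, hν,
          lintegral_withDensity_eq_lintegral_mul_non_measurable _ hm hfin]
        congr 2
        field_simp

/-- Young's inequality for convolution with an integrable kernel. -/
theorem lintegral_enorm_mollify_rpow_le {q : ℝ} (hq : 1 ≤ q) {κ f : ℝ → ℂ} (hκ : Continuous κ)
    (hf : AEStronglyMeasurable f volume) :
    ∫⁻ x, ‖mollify κ f x‖ₑ ^ q ≤ (∫⁻ y, ‖κ y‖ₑ) ^ q * ∫⁻ y, ‖f y‖ₑ ^ q := by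
  have hm : AEMeasurable (Function.uncurry fun x y : ℝ => ‖κ (x - y)‖ₑ * ‖f y‖ₑ ^ q)
      (volume.prod volume) := by
    refine AEMeasurable.mul ?_ ?_
    · exact (hκ.comp (continuous_fst.sub continuous_snd)).enorm.measurable.aemeasurable
    · exact (hf.comp_snd.enorm).pow_const q
  calc ∫⁻ x, ‖mollify κ f x‖ₑ ^ q
      ≤ ∫⁻ x, (∫⁻ y, ‖κ (x - y)‖ₑ * ‖f y‖ₑ ^ q) * (∫⁻ y, ‖κ y‖ₑ) ^ (q - 1) :=
        lintegral_mono fun x => enorm_mollify_rpow_le hq hκ hf x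
    _ = (∫⁻ x, ∫⁻ y, ‖κ (x - y)‖ₑ * ‖f y‖ₑ ^ q) * (∫⁻ y, ‖κ y‖ₑ) ^ (q - 1) := by
        exact lintegral_mul_const'' _ hm.lintegral_prod_right'
    _ = (∫⁻ y, (∫⁻ x, ‖κ (x - y)‖ₑ) * ‖f y‖ₑ ^ q) * (∫⁻ y, ‖κ y‖ₑ) ^ (q - 1) := by
        rw [lintegral_lintegral_swap hm]
        congr 2
        funext y
        exact lintegral_mul_const _
          (hκ.comp (continuous_id.sub continuous_const)).enorm.measurable
    _ = ((∫⁻ y, ‖κ y‖ₑ) * ∫⁻ y, ‖f y‖ₑ ^ q) * (∫⁻ y, ‖κ y‖ₑ) ^ (q - 1) := by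
        congr 1
        rw [← lintegral_const_mul'' _ (hf.enorm.pow_const q)]
        congr 1
        funext y
        rw [lintegral_sub_right_eq_self (fun x => ‖κ x‖ₑ) y]
    _ = _ := by
        rw [mul_right_comm]
        congr 1
        have := ENNReal.rpow_add_of_nonneg (x := ∫⁻ y, ‖κ y‖ₑ) 1 (q - 1) zero_le_one (by linarith)
        rw [ENNReal.rpow_one, add_sub_cancel] at this
        exact this.symm

theorem stronglyMeasurable_mollify {κ : ℝ → ℂ} {F : ℝ × ℝ → ℂ} (hκ : Continuous κ)
    (hF : StronglyMeasurable F) :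
    StronglyMeasurable fun z : ℝ × ℝ => mollify κ (fun y => F (z.1, y)) z.2 := by
  refine StronglyMeasurable.integral_prod_right
    (f := fun (z : ℝ × ℝ) (y : ℝ) => F (z.1, y) * κ (z.2 - y)) ?_
  refine StronglyMeasurable.mul ?_ ?_
  · exact hF.comp_measurable ((measurable_fst.comp measurable_fst).prodMk measurable_snd)
  · exact (hκ.comp ((continuous_snd.comp continuous_fst).sub continuous_snd)).stronglyMeasurable

theorem hasDerivAt_mollify {κ f : ℝ → ℂ} (hκ : HasCompactSupport κ) (hκ' : ContDiff ℝ 1 κ)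
    (hf : LocallyIntegrable f volume) (x : ℝ) :
    HasDerivAt (mollify κ f) (mollify (deriv κ) f x) x :=
  hκ.hasDerivAt_convolution_right (ContinuousLinearMap.mul ℝ ℂ) hf hκ' x

theorem memLp_mollify {q : ℝ} (hq : 1 ≤ q) {κ f : ℝ → ℂ} (hκ : Continuous κ)
    (hκ1 : Integrable κ volume) (hf : MemLp f (ENNReal.ofReal q) volume) :
    MemLp (mollify κ f) (ENNReal.ofReal q) volume := by
  have hq0 : 0 < q := by linarith
  have h0 : ENNReal.ofReal q ≠ 0 := by simpa using hq0
  have hmeas : AEStronglyMeasurable (mollify κ f) volume := by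
    have := (stronglyMeasurable_mollify (F := fun z => hf.1.mk f z.2) hκ
      (hf.1.stronglyMeasurable_mk.comp_measurable measurable_snd)).comp_measurable
      (measurable_const.prodMk measurable_id : Measurable fun x : ℝ => ((0 : ℝ), x))
    refine this.aestronglyMeasurable.congr (Eventually.of_forall fun x => ?_)
    exact (mollify_congr_ae hf.1.ae_eq_mk x).symm
  refine ⟨hmeas, ?_⟩
  have h2 := lintegral_rpow_enorm_lt_top_of_eLpNorm_lt_top h0 ENNReal.ofReal_ne_top hf.2
  rw [ENNReal.toReal_ofReal hq0.le] at h2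
  rw [eLpNorm_lt_top_iff_lintegral_rpow_enorm_lt_top h0 ENNReal.ofReal_ne_top,
    ENNReal.toReal_ofReal hq0.le]
  refine (lintegral_enorm_mollify_rpow_le hq hκ hf.1).trans_lt (ENNReal.mul_lt_top ?_ h2)
  exact ENNReal.rpow_lt_top_of_nonneg hq0.le hκ1.2.ne

/-- The Laplacian is symmetric: `∫ Im (conj v v'') = 0` for a mollification `v`. -/
theorem integral_im_conj_mollify {κ f : ℝ → ℂ} (hκ : HasCompactSupport κ) (hκ' : ContDiff ℝ 2 κ)
    (hf : MemLp f 2 volume) :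
    ∫ x, ((starRingEnd ℂ) (mollify κ f x) * mollify (deriv (deriv κ)) f x).im = 0 := by
  have hfl : LocallyIntegrable f volume := hf.locallyIntegrable (by norm_num)
  have hd1 : ContDiff ℝ 1 (deriv κ) := ContDiff.deriv' (n := 1) (by norm_num; exact hκ')
  have hf' : MemLp f (ENNReal.ofReal 2) volume := by simpa using hf
  have hv {κ : ℝ → ℂ} (hc : Continuous κ) (hs : HasCompactSupport κ) :
      MemLp (mollify κ f) 2 volume := by
    simpa using memLp_mollify one_le_two hc (hc.integrable_of_hasCompactSupport hs) hf'
  have h0 := hv hκ'.continuous hκ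
  have h1 := hv hd1.continuous hκ.deriv
  have h2 := hv (hd1.continuous_deriv le_rfl) hκ.deriv.deriv
  have hc {a : ℝ → ℂ} (ha : MemLp a 2 volume) :
      MemLp (fun x => (starRingEnd ℂ) (a x)) 2 volume := ha.star
  have hibp := integral_mul_deriv_eq_deriv_mul_of_integrable
    (u := fun x => (starRingEnd ℂ) (mollify κ f x)) (v := mollify (deriv κ) f)
    (u' := fun x => (starRingEnd ℂ) (mollify (deriv κ) f x)) (v' := mollify (deriv (deriv κ)) f)
    (fun x _ => (hasDerivAt_mollify hκ (hκ'.of_le (by norm_num)) hfl x).star)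
    (fun x _ => hasDerivAt_mollify hκ.deriv hd1 hfl x)
    ((hc h0).integrable_mul h2) ((hc h1).integrable_mul h1) ((hc h0).integrable_mul h1)
  have him := integral_im ((hc h0).integrable_mul h2)
  have him' := integral_im ((hc h1).integrable_mul h1)
  simp only [Pi.mul_apply, RCLike.im_to_complex] at him him'
  rw [him, hibp, Complex.neg_im, ← him']
  simp [mul_comm (Complex.re _)]

theorem lintegral_enorm_mollify_prod_le {μ : Measure ℝ} [SFinite μ] {q : ℝ} (hq : 1 ≤ q)
    {κ : ℝ → ℂ} (hκ : Continuous κ) {H : ℝ × ℝ → ℂ} (hH : StronglyMeasurable H) :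
    ∫⁻ z, ‖mollify κ (fun y => H (z.1, y)) z.2‖ₑ ^ q ∂(μ.prod volume) ≤
      (∫⁻ y, ‖κ y‖ₑ) ^ q * ∫⁻ z, ‖H z‖ₑ ^ q ∂(μ.prod volume) := by
  have hm := ((stronglyMeasurable_mollify hκ hH).enorm.pow_const q).aemeasurable
    (μ := μ.prod volume)
  have hm' : Measurable fun z => ‖H z‖ₑ ^ q := hH.enorm.pow_const q
  rw [lintegral_prod _ hm, lintegral_prod _ hm'.aemeasurable,
    ← lintegral_const_mul _ hm'.lintegral_prod_right']
  refine lintegral_mono fun τ => ?_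
  exact lintegral_enorm_mollify_rpow_le hq hκ
    (hH.comp_measurable measurable_prodMk_left).aestronglyMeasurable

theorem memLp_ofReal_iff {α : Type*} [MeasurableSpace α] {μ : Measure α} {q : ℝ} (hq : 0 < q)
    {f : α → ℂ} :
    MemLp f (ENNReal.ofReal q) μ ↔ AEStronglyMeasurable f μ ∧ ∫⁻ a, ‖f a‖ₑ ^ q ∂μ < ⊤ := by
  have h0 : ENNReal.ofReal q ≠ 0 := by simpa using hq
  rw [MemLp, eLpNorm_lt_top_iff_lintegral_rpow_enorm_lt_top h0 ENNReal.ofReal_ne_top,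
    ENNReal.toReal_ofReal hq.le]

theorem memLp_mollify_prod {μ : Measure ℝ} [SFinite μ] {q : ℝ} (hq : 1 ≤ q)
    {κ : ℝ → ℂ} (hκ : Continuous κ) (hκ1 : Integrable κ volume) {H : ℝ × ℝ → ℂ}
    (hH : StronglyMeasurable H) (h : MemLp H (ENNReal.ofReal q) (μ.prod volume)) :
    MemLp (fun z : ℝ × ℝ => mollify κ (fun y => H (z.1, y)) z.2) (ENNReal.ofReal q)
      (μ.prod volume) := by
  have hq0 : 0 < q := by linarith
  rw [memLp_ofReal_iff hq0] at h ⊢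
  refine ⟨(stronglyMeasurable_mollify hκ hH).aestronglyMeasurable,
    (lintegral_enorm_mollify_prod_le hq hκ hH).trans_lt (ENNReal.mul_lt_top ?_ h.2)⟩
  exact ENNReal.rpow_lt_top_of_nonneg hq0.le hκ1.2.ne

/-- Integrability in time is needed at every `x`, since the mollified equation is an integral
equation at each point. The kernel is bounded, which gives `L^q` in time, and the time measure is
finite. -/
theorem integrable_mollify_section {μ : Measure ℝ} [IsFiniteMeasure μ] {q : ℝ} (hq : 1 ≤ q)
    {κ : ℝ → ℂ} (hκ : Continuous κ) (hκs : HasCompactSupport κ) {H : ℝ × ℝ → ℂ}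
    (hH : StronglyMeasurable H) (h : MemLp H (ENNReal.ofReal q) (μ.prod volume)) (x : ℝ) :
    Integrable (fun τ => mollify κ (fun y => H (τ, y)) x) μ := by
  have hq0 : 0 < q := by linarith
  obtain ⟨B, hB⟩ := hκs.exists_bound_of_continuous hκ
  have hB' : ∀ y, ‖κ y‖ₑ ≤ ENNReal.ofReal B := fun y => by
    rw [← ofReal_norm]; exact ENNReal.ofReal_le_ofReal (hB y)
  rw [memLp_ofReal_iff hq0] at h
  have hm' : Measurable fun z => ‖H z‖ₑ ^ q := hH.enorm.pow_const q
  have hmem : MemLp (fun τ => mollify κ (fun y => H (τ, y)) x) (ENNReal.ofReal q) μ := by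
    rw [memLp_ofReal_iff hq0]
    refine ⟨((stronglyMeasurable_mollify hκ hH).comp_measurable
      (measurable_prodMk_right (y := x))).aestronglyMeasurable, ?_⟩
    calc ∫⁻ τ, ‖mollify κ (fun y => H (τ, y)) x‖ₑ ^ q ∂μ
        ≤ ∫⁻ τ, (ENNReal.ofReal B * (∫⁻ y, ‖κ y‖ₑ) ^ (q - 1)) * (∫⁻ y, ‖H (τ, y)‖ₑ ^ q) ∂μ := by
          refine lintegral_mono fun τ => (enorm_mollify_rpow_le hq hκ
            (hH.comp_measurable measurable_prodMk_left).aestronglyMeasurable x).trans ?_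
          rw [mul_right_comm]
          gcongr
          refine le_trans (lintegral_mono fun y => mul_le_mul_left (hB' _) _) (le_of_eq ?_)
          exact lintegral_const_mul _ (hm'.comp measurable_prodMk_left)
      _ = (ENNReal.ofReal B * (∫⁻ y, ‖κ y‖ₑ) ^ (q - 1)) * ∫⁻ z, ‖H z‖ₑ ^ q ∂(μ.prod volume) := by
          rw [lintegral_prod _ hm'.aemeasurable, lintegral_const_mul _ hm'.lintegral_prod_right']
      _ < ⊤ := by
          refine ENNReal.mul_lt_top (ENNReal.mul_lt_top ENNReal.ofReal_lt_top ?_) h.2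
          exact ENNReal.rpow_lt_top_of_nonneg (by linarith)
            (hκ.integrable_of_hasCompactSupport hκs).2.ne
  exact hmem.integrable (by simpa using hq)

/-- The fundamental theorem of calculus for `|v|²`, where `v` is absolutely continuous. -/
theorem sq_norm_sub_sq_norm_eq {v k : ℝ → ℂ} {t : ℝ} (ht : 0 ≤ t)
    (hk : IntervalIntegrable k volume 0 t)
    (hv : ∀ τ ∈ Set.Icc 0 t, v τ = v 0 + ∫ r in (0 : ℝ)..τ, k r) :
    ‖v t‖ ^ 2 - ‖v 0‖ ^ 2 = ∫ τ in (0 : ℝ)..t, 2 * ((starRingEnd ℂ) (v τ) * k τ).re := by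
  -- The real case is the product rule for an absolutely continuous function with itself. It is
  -- applied to the real and imaginary parts separately.
  have key (c : ℝ) (r : ℝ → ℝ) (hr : IntervalIntegrable r volume 0 t) :
      (c + ∫ s in (0 : ℝ)..t, r s) ^ 2 - c ^ 2 =
        ∫ τ in (0 : ℝ)..t, 2 * ((c + ∫ s in (0 : ℝ)..τ, r s) * r τ) := by
    have hac : AbsolutelyContinuousOnInterval (fun τ => c + ∫ s in (0 : ℝ)..τ, r s) 0 t :=
      ((LipschitzWith.const c).lipschitzOnWith.absolutelyContinuousOnInterval).fun_add
        (hr.absolutelyContinuousOnInterval_intervalIntegral Set.left_mem_uIcc)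
    have h := hac.integral_deriv_mul_eq_sub hac
    simp only [intervalIntegral.integral_same, add_zero] at h
    rw [sq, sq, ← h]
    refine intervalIntegral.integral_congr_ae ?_
    filter_upwards [hr.ae_hasDerivAt_integral] with τ hτ hmem
    rw [((hτ (Set.uIoc_subset_uIcc hmem) 0 Set.left_mem_uIcc).const_add c).deriv]
    ring
  have hre : IntervalIntegrable (fun τ => (k τ).re) volume 0 t := ⟨hk.1.re, hk.2.re⟩
  have him : IntervalIntegrable (fun τ => (k τ).im) volume 0 t := ⟨hk.1.im, hk.2.im⟩
  have hint (τ : ℝ) (hτ : τ ∈ Set.Icc 0 t) : IntervalIntegrable k volume 0 τ :=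
    hk.mono_set (by rw [Set.uIcc_of_le ht, Set.uIcc_of_le hτ.1]; exact Set.Icc_subset_Icc_right hτ.2)
  have hvre (τ : ℝ) (hτ : τ ∈ Set.Icc 0 t) :
      (v τ).re = (v 0).re + ∫ s in (0 : ℝ)..τ, (k s).re := by
    rw [hv τ hτ, Complex.add_re]
    congr 1
    exact (Complex.reCLM.intervalIntegral_comp_comm (hint τ hτ)).symm
  have hvim (τ : ℝ) (hτ : τ ∈ Set.Icc 0 t) :
      (v τ).im = (v 0).im + ∫ s in (0 : ℝ)..τ, (k s).im := by
    rw [hv τ hτ, Complex.add_im]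
    congr 1
    exact (Complex.imCLM.intervalIntegral_comp_comm (hint τ hτ)).symm
  have hcre := intervalIntegral.continuousOn_primitive_interval' hre Set.left_mem_uIcc
  have hcim := intervalIntegral.continuousOn_primitive_interval' him Set.left_mem_uIcc
  have hmem : t ∈ Set.Icc 0 t := ⟨ht, le_rfl⟩
  have h1 := key (v 0).re _ hre
  have h2 := key (v 0).im _ him
  rw [← hvre t hmem] at h1
  rw [← hvim t hmem] at h2
  rw [← Complex.normSq_eq_norm_sq, ← Complex.normSq_eq_norm_sq, Complex.normSq_apply,
    Complex.normSq_apply]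
  calc _ = ((v t).re ^ 2 - (v 0).re ^ 2) + ((v t).im ^ 2 - (v 0).im ^ 2) := by ring
    _ = _ := by
      rw [h1, h2, ← intervalIntegral.integral_add]
      · refine intervalIntegral.integral_congr fun τ hτ => ?_
        rw [Set.uIcc_of_le ht] at hτ
        simp only [← hvre τ hτ, ← hvim τ hτ, Complex.mul_re, Complex.conj_re, Complex.conj_im]
        ring
      · exact (hre.continuousOn_mul (continuousOn_const.add hcre)).const_mul 2
      · exact (him.continuousOn_mul (continuousOn_const.add hcim)).const_mul 2

/-- A dominated convergence theorem in which the dominating functions converge. -/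
theorem tendsto_lintegral_zero_of_le {α : Type*} [MeasurableSpace α] {μ : Measure α}
    {H I : ℕ → α → ℝ≥0∞} {h : α → ℝ≥0∞} (hI : ∀ n, AEMeasurable (I n) μ)
    (hH : ∀ n, AEMeasurable (H n) μ) (hle : ∀ n a, I n a ≤ H n a)
    (hHh : ∀ n, ∫⁻ a, H n a ∂μ ≤ ∫⁻ a, h a ∂μ) (hfin : ∫⁻ a, h a ∂μ ≠ ⊤)
    (hlimH : ∀ᵐ a ∂μ, Tendsto (fun n => H n a) atTop (𝓝 (h a)))
    (hlimI : ∀ᵐ a ∂μ, Tendsto (fun n => I n a) atTop (𝓝 0)) :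
    Tendsto (fun n => ∫⁻ a, I n a ∂μ) atTop (𝓝 0) := by
  have hadd (n : ℕ) : ∫⁻ a, (H n a - I n a) ∂μ + ∫⁻ a, I n a ∂μ ≤ ∫⁻ a, h a ∂μ := by
    rw [← lintegral_add_right' _ (hI n)]
    refine le_trans (lintegral_mono fun a => ?_) (hHh n)
    exact (tsub_add_cancel_of_le (hle n a)).le
  -- Fatou's lemma is applied to `H n - I n`, which is nonnegative and tends to `h`. The integrals
  -- of `H n` do not exceed that of `h`, so nothing is left for `I n`.
  have hfatou : ∫⁻ a, h a ∂μ ≤ liminf (fun n => ∫⁻ a, (H n a - I n a) ∂μ) atTop := by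
    refine le_trans (le_of_eq (lintegral_congr_ae ?_))
      (lintegral_liminf_le' fun n => (hH n).sub (hI n))
    filter_upwards [hlimH, hlimI] with a h1 h2
    have := ENNReal.Tendsto.sub h1 h2 (Or.inr ENNReal.zero_ne_top)
    rw [tsub_zero] at this
    exact this.liminf_eq.symm
  rw [ENNReal.tendsto_nhds_zero]
  intro ε hε
  rcases eq_or_ne (∫⁻ a, h a ∂μ) 0 with h0 | h0
  · refine Eventually.of_forall fun n => ?_
    have := (le_add_self.trans (hadd n)).trans h0.le
    exact this.trans zero_le
  · have hlt := (ENNReal.sub_lt_self hfin h0 hε.ne').trans_le hfatou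
    filter_upwards [eventually_lt_of_lt_liminf hlt] with n hn
    have h1 : (∫⁻ a, h a ∂μ - ε) + ∫⁻ a, I n a ∂μ ≤ (∫⁻ a, h a ∂μ - ε) + ε := by
      calc _ ≤ ∫⁻ a, (H n a - I n a) ∂μ + ∫⁻ a, I n a ∂μ := by gcongr
        _ ≤ ∫⁻ a, h a ∂μ := hadd n
        _ ≤ _ := le_tsub_add
    exact (ENNReal.add_le_add_iff_left (ne_top_of_le_ne_top hfin tsub_le_self)).1 h1

/-- Smooth compactly supported functions are Schwartz, as are their reflected translates. -/
theorem exists_schwartz_translate {ρ : ℝ → ℂ} (hρs : HasCompactSupport ρ) (hρ : ContDiff ℝ ∞ ρ)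
    (x : ℝ) : ∃ φ : 𝓢(ℝ, ℂ), (∀ y, φ y = ρ (x - y)) ∧
      ∀ y, iteratedDeriv 2 φ y = deriv (deriv ρ) (x - y) := by
  have hs : HasCompactSupport fun y => ρ (x - y) :=
    hρs.comp_homeomorph (Homeomorph.subLeft x)
  refine ⟨hs.toSchwartzMap (hρ.comp (contDiff_const.sub contDiff_id)), fun y => rfl, fun y => ?_⟩
  have h1 (f : ℝ → ℂ) : deriv (fun y => f (x - y)) = fun y => -deriv f (x - y) := by
    funext y
    exact deriv_comp_const_sub f x y
  change iteratedDeriv 2 (fun y => ρ (x - y)) y = _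
  rw [iteratedDeriv_succ, iteratedDeriv_one, h1]
  simp [h1 (deriv ρ)]

theorem holderConjugate_add_one {p : ℝ} (hp : 1 < p) : (p + 1).HolderConjugate ((p + 1) / p) := by
  rw [Real.holderConjugate_iff]
  refine ⟨by linarith, ?_⟩
  field_simp
  ring

theorem enorm_pw_rpow {p : ℝ} (hp : 1 < p) (z : ℂ) :
    ‖pw p z‖ₑ ^ ((p + 1) / p) = ‖z‖ₑ ^ (p + 1) := by
  have h : ‖pw p z‖ₑ = ‖z‖ₑ ^ p := by
    rw [← ofReal_norm, norm_pw hp, ← ENNReal.ofReal_rpow_of_nonneg (norm_nonneg _) (by linarith),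
      ofReal_norm]
  rw [h, ← ENNReal.rpow_mul]
  congr 1
  field_simp

theorem memLp_pw {α : Type*} [MeasurableSpace α] {μ : Measure α} {p : ℝ} (hp : 1 < p) {F : α → ℂ}
    (hF : MemLp F (ENNReal.ofReal (p + 1)) μ) :
    MemLp (fun a => pw p (F a)) (ENNReal.ofReal ((p + 1) / p)) μ := by
  rw [memLp_ofReal_iff (by positivity)] at hF ⊢
  simp_rw [enorm_pw_rpow hp]
  exact ⟨(continuous_pw hp).comp_aestronglyMeasurable hF.1, hF.2⟩

/-! ### Mass bound for rough solutions -/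

section

variable {p t : ℝ} {u : ℝ → ℝ → ℂ} {F : ℝ × ℝ → ℂ} {ρ : ℝ → ℂ}

/-- The mass of a mollified solution grows at most by the flux through the nonlinearity. -/
theorem lintegral_mollify_sq_le (hp : 1 < p) (ht : 0 ≤ t) (hF : StronglyMeasurable F)
    (hae : ∀ᵐ τ ∂(volume.restrict (Set.Ioc 0 t)), u τ =ᵐ[volume] fun y => F (τ, y))
    (hF2 : MemLp F (ENNReal.ofReal 2) ((volume.restrict (Set.Ioc 0 t)).prod volume))
    (hFp : MemLp F (ENNReal.ofReal (p + 1)) ((volume.restrict (Set.Ioc 0 t)).prod volume))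
    (hu0 : MemLp (u 0) 2 volume) (hut : MemLp (u t) 2 volume)
    (hρs : HasCompactSupport ρ) (hρ : ContDiff ℝ ∞ ρ)
    (heq : ∀ φ : 𝓢(ℝ, ℂ), ∀ τ ∈ Set.Icc 0 t,
      Complex.I * (∫ x, u τ x * φ x) - Complex.I * (∫ x, u 0 x * φ x)
        + ∫ r in (0 : ℝ)..τ, ∫ x, u r x * iteratedDeriv 2 φ x
        = ∫ r in (0 : ℝ)..τ, ∫ x, nonlin p (u r) x * φ x) :
    ∫⁻ x, ‖mollify ρ (u t) x‖ₑ ^ (2 : ℝ) ≤ (∫⁻ x, ‖mollify ρ (u 0) x‖ₑ ^ (2 : ℝ)) +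
      2 * ∫⁻ z, ‖((starRingEnd ℂ) (mollify ρ (fun y => F (z.1, y)) z.2) *
        mollify ρ (fun y => pw p (F (z.1, y))) z.2).im‖ₑ
          ∂((volume.restrict (Set.Ioc 0 t)).prod volume) := by
  set μ : Measure ℝ := volume.restrict (Set.Ioc 0 t) with hμ
  set V : ℝ × ℝ → ℂ := fun z => mollify ρ (fun y => F (z.1, y)) z.2 with hV
  set W : ℝ × ℝ → ℂ := fun z => mollify (deriv (deriv ρ)) (fun y => F (z.1, y)) z.2 with hW
  set G : ℝ × ℝ → ℂ := fun z => mollify ρ (fun y => pw p (F (z.1, y))) z.2 with hG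
  have hρd : ContDiff ℝ ∞ (deriv ρ) := ContDiff.iterate_deriv 1 hρ
  have hρdd : ContDiff ℝ ∞ (deriv (deriv ρ)) := ContDiff.iterate_deriv 2 hρ
  have hρi := hρ.continuous.integrable_of_hasCompactSupport hρs (μ := volume)
  have hρddi := hρdd.continuous.integrable_of_hasCompactSupport hρs.deriv.deriv (μ := volume)
  have hN : StronglyMeasurable fun z => pw p (F z) := (continuous_pw hp).comp_stronglyMeasurable hF
  have hq : 1 ≤ (p + 1) / p := by rw [le_div_iff₀ (by linarith)]; linarith
  have hNq := memLp_pw hp hFp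
  have hV2 : MemLp V (ENNReal.ofReal 2) (μ.prod volume) :=
    memLp_mollify_prod one_le_two hρ.continuous hρi hF hF2
  have hVp : MemLp V (ENNReal.ofReal (p + 1)) (μ.prod volume) :=
    memLp_mollify_prod (by linarith) hρ.continuous hρi hF hFp
  have hW2 : MemLp W (ENNReal.ofReal 2) (μ.prod volume) :=
    memLp_mollify_prod one_le_two hρdd.continuous hρddi hF hF2
  have hGq : MemLp G (ENNReal.ofReal ((p + 1) / p)) (μ.prod volume) :=
    memLp_mollify_prod hq hρ.continuous hρi hN hNq
  have hVW : Integrable (fun z => (starRingEnd ℂ) (V z) * W z) (μ.prod volume) := by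
    rw [ENNReal.ofReal_ofNat] at hV2 hW2
    exact hV2.star.integrable_mul hW2
  have hVG : Integrable (fun z => (starRingEnd ℂ) (V z) * G z) (μ.prod volume) := by
    have := (holderConjugate_add_one hp).ennrealOfReal
    exact hVp.star.integrable_mul hGq
  have hWx (x : ℝ) : Integrable (fun τ => W (τ, x)) μ :=
    integrable_mollify_section one_le_two hρdd.continuous hρs.deriv.deriv hF hF2 x
  have hGx (x : ℝ) : Integrable (fun τ => G (τ, x)) μ :=
    integrable_mollify_section hq hρ.continuous hρs hN hNq x
  have hk (x : ℝ) : IntervalIntegrable (fun τ => Complex.I * (W (τ, x) - G (τ, x))) volume 0 t := by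
    rw [intervalIntegrable_iff_integrableOn_Ioc_of_le ht]
    exact ((hWx x).sub (hGx x)).const_mul _
  have hint {a : ℝ → ℂ} (ha : Integrable a μ) {τ : ℝ} (hτ : τ ∈ Set.Icc 0 t) :
      IntervalIntegrable a volume 0 τ := by
    rw [intervalIntegrable_iff_integrableOn_Ioc_of_le hτ.1]
    exact IntegrableOn.mono_set ha (Set.Ioc_subset_Ioc_right hτ.2)
  -- Testing the equation against `y ↦ ρ(x - y)` gives the equation for the mollification at the
  -- point `x`. The two derivatives fall on the kernel.
  have hv (x : ℝ) : ∀ τ ∈ Set.Icc 0 t, mollify ρ (u τ) x =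
      mollify ρ (u 0) x + ∫ r in (0 : ℝ)..τ, Complex.I * (W (r, x) - G (r, x)) := by
    intro τ hτ
    obtain ⟨φ, hφ, hφ2⟩ := exists_schwartz_translate hρs hρ x
    have h := heq φ τ hτ
    simp_rw [hφ, hφ2] at h
    have hsub : ∀ᵐ r ∂(volume : Measure ℝ), r ∈ Set.uIoc 0 τ → u r =ᵐ[volume] fun y => F (r, y) := by
      filter_upwards [(ae_restrict_iff' measurableSet_Ioc).1 hae] with r hr hmem
      rw [Set.uIoc_of_le hτ.1] at hmem
      exact hr ⟨hmem.1, hmem.2.trans hτ.2⟩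
    have e1 : ∫ r in (0 : ℝ)..τ, ∫ y, u r y * deriv (deriv ρ) (x - y) =
        ∫ r in (0 : ℝ)..τ, W (r, x) := by
      refine intervalIntegral.integral_congr_ae ?_
      filter_upwards [hsub] with r hr hmem
      exact mollify_congr_ae (hr hmem) x
    have e2 : ∫ r in (0 : ℝ)..τ, ∫ y, nonlin p (u r) y * ρ (x - y) =
        ∫ r in (0 : ℝ)..τ, G (r, x) := by
      refine intervalIntegral.integral_congr_ae ?_
      filter_upwards [hsub] with r hr hmem
      refine mollify_congr_ae ?_ x
      filter_upwards [hr hmem] with y hy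
      rw [nonlin_apply, hy]
    rw [e1, e2] at h
    rw [intervalIntegral.integral_const_mul,
      intervalIntegral.integral_sub (hint (hWx x) hτ) (hint (hGx x) hτ), ← h]
    change mollify ρ (u τ) x = mollify ρ (u 0) x + Complex.I * (_ -
      (Complex.I * mollify ρ (u τ) x - Complex.I * mollify ρ (u 0) x + _))
    linear_combination (mollify ρ (u τ) x - mollify ρ (u 0) x) * Complex.I_sq
  set K : ℝ × ℝ → ℝ := fun z => 2 * ((starRingEnd ℂ) (V z) * (Complex.I * (W z - G z))).re with hK
  have hKe : K = fun z => 2 * ((starRingEnd ℂ) (V z) * G z).im -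
      2 * ((starRingEnd ℂ) (V z) * W z).im := by
    funext z
    have : (starRingEnd ℂ) (V z) * (Complex.I * (W z - G z)) =
      Complex.I * ((starRingEnd ℂ) (V z) * W z - (starRingEnd ℂ) (V z) * G z) := by ring
    rw [hK]
    simp only [this, Complex.I_mul_re, Complex.sub_im]
    ring
  have hKi : Integrable K (μ.prod volume) := by
    rw [hKe]
    exact (hVG.im.const_mul 2).sub (hVW.im.const_mul 2)
  have hsq (x : ℝ) : ‖mollify ρ (u t) x‖ ^ 2 - ‖mollify ρ (u 0) x‖ ^ 2 = ∫ τ, K (τ, x) ∂μ := by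
    rw [sq_norm_sub_sq_norm_eq (v := fun τ => mollify ρ (u τ) x) ht (hk x) (hv x),
      intervalIntegral.integral_of_le ht]
    refine integral_congr_ae ?_
    filter_upwards [hae] with τ hτ
    rw [hK, mollify_congr_ae hτ x]
  have hL2 {f : ℝ → ℂ} (hf : MemLp f 2 volume) : MemLp (mollify ρ f) 2 volume := by
    have := memLp_mollify one_le_two hρ.continuous hρi (f := f) (by simpa using hf)
    simpa using this
  have hsqi {f : ℝ → ℂ} (hf : MemLp f 2 volume) : Integrable fun x => ‖mollify ρ f x‖ ^ 2 :=
    (hL2 hf).norm.integrable_sq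
  have hconv {f : ℝ → ℂ} (hf : MemLp f 2 volume) :
      ∫⁻ x, ‖mollify ρ f x‖ₑ ^ (2 : ℝ) = ENNReal.ofReal (∫ x, ‖mollify ρ f x‖ ^ 2) := by
    rw [ofReal_integral_eq_lintegral_ofReal (hsqi hf) (Eventually.of_forall fun x => by positivity)]
    refine lintegral_congr fun x => ?_
    rw [ENNReal.ofReal_pow (norm_nonneg _), ofReal_norm]
    norm_cast
  -- For almost every time `F(τ, ·)` is in `L²`, so the dispersive part of the mass change
  -- integrates to zero in `x`.
  have hzero : ∀ᵐ τ ∂μ, ∫ x, K (τ, x) = ∫ x, 2 * ((starRingEnd ℂ) (V (τ, x)) * G (τ, x)).im := by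
    have hF2' : ∀ᵐ τ ∂μ, MemLp (fun y => F (τ, y)) 2 volume := by
      have h2 := hF2
      rw [memLp_ofReal_iff two_pos] at h2
      have hm : Measurable fun z => ‖F z‖ₑ ^ (2 : ℝ) := hF.enorm.pow_const _
      rw [lintegral_prod _ hm.aemeasurable] at h2
      filter_upwards [ae_lt_top hm.lintegral_prod_right' h2.2.ne] with τ hτ
      have : MemLp (fun y => F (τ, y)) (ENNReal.ofReal 2) volume :=
        (memLp_ofReal_iff two_pos).2
          ⟨(hF.comp_measurable measurable_prodMk_left).aestronglyMeasurable, hτ⟩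
      simpa using this
    filter_upwards [hF2', hVW.prod_right_ae, hVG.prod_right_ae] with τ h1 h2 h3
    rw [hKe]
    have := integral_im_conj_mollify hρs (hρ.of_le (WithTop.coe_le_coe.2 le_top)) h1
    refine (integral_sub (h3.im.const_mul 2) (h2.im.const_mul 2)).trans ?_
    rw [integral_const_mul (2 : ℝ) fun x => RCLike.im ((starRingEnd ℂ) (V (τ, x)) * W (τ, x))]
    simp only [hV, hW, RCLike.im_to_complex, this, mul_zero, sub_zero]
  have hmain : ∫ x, ‖mollify ρ (u t) x‖ ^ 2 = (∫ x, ‖mollify ρ (u 0) x‖ ^ 2) +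
      ∫ z, 2 * ((starRingEnd ℂ) (V z) * G z).im ∂(μ.prod volume) := by
    rw [← sub_eq_iff_eq_add', ← integral_sub (hsqi hut) (hsqi hu0),
      integral_prod (fun z => 2 * ((starRingEnd ℂ) (V z) * G z).im) (hVG.im.const_mul 2)]
    simp_rw [hsq]
    rw [integral_integral_swap (f := fun x τ => K (τ, x)) hKi.swap]
    exact integral_congr_ae hzero
  rw [hconv hut, hconv hu0, hmain]
  refine ENNReal.ofReal_add_le.trans ?_
  gcongr
  rw [integral_const_mul, ENNReal.ofReal_mul zero_le_two, ENNReal.ofReal_ofNat]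
  gcongr
  refine (Real.ofReal_le_enorm _).trans (enorm_integral_le_lintegral_enorm _)

end

/-- There is an approximate identity of smooth compactly supported functions, for which the
mollifications of a locally integrable function converge almost everywhere. -/
theorem exists_mollifier : ∃ ρ : ℕ → ℝ → ℂ, (∀ n, HasCompactSupport (ρ n)) ∧
    (∀ n, ContDiff ℝ ∞ (ρ n)) ∧ (∀ n, ∫⁻ y, ‖ρ n y‖ₑ = 1) ∧
    ∀ f : ℝ → ℂ, LocallyIntegrable f volume →
      ∀ᵐ x, Tendsto (fun n => mollify (ρ n) f x) atTop (𝓝 (f x)) := by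
  let φ (n : ℕ) : ContDiffBump (0 : ℝ) :=
    ⟨1 / (n + 1), 2 * (1 / (n + 1)), by positivity,
      lt_mul_of_one_lt_left (by positivity) one_lt_two⟩
  have hlim : Tendsto (fun n => (φ n).rOut) atTop (𝓝 0) := by
    have := (tendsto_one_div_add_atTop_nhds_zero_nat (𝕜 := ℝ)).const_mul 2
    rwa [mul_zero] at this
  refine ⟨fun n x => ((φ n).normed volume x : ℂ), fun n => ?_, fun n => ?_, fun n => ?_,
    fun f hf => ?_⟩
  · exact (φ n).hasCompactSupport_normed.comp_left (g := fun r : ℝ => (r : ℂ)) Complex.ofReal_zero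
  · exact Complex.ofRealCLM.contDiff.comp (φ n).contDiff_normed
  · rw [← ENNReal.ofReal_one, ← (φ n).integral_normed (μ := volume),
      ofReal_integral_eq_lintegral_ofReal (φ n).integrable_normed
        (Eventually.of_forall (φ n).nonneg_normed)]
    refine lintegral_congr fun y => ?_
    rw [← ofReal_norm, Complex.norm_real, Real.norm_of_nonneg ((φ n).nonneg_normed y)]
  · filter_upwards [ContDiffBump.ae_convolution_tendsto_right_of_locallyIntegrable (K := 2) hlim
      (Eventually.of_forall fun n => le_rfl) hf] with x hx
    refine hx.congr fun n => ?_
    rw [MeasureTheory.convolution_eq_swap]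
    refine integral_congr_ae (Eventually.of_forall fun y => ?_)
    simp [mul_comm]

theorem im_conj_mul_pw (p : ℝ) (z : ℂ) : ((starRingEnd ℂ) z * pw p z).im = 0 := by
  rw [pw, mul_left_comm, ← Complex.normSq_eq_conj_mul_self, ← Complex.ofReal_mul,
    Complex.ofReal_im]

/-- The mass of a solution does not exceed its initial mass. -/
theorem eLpNorm_two_le_of_equation {p t : ℝ} (hp : 1 < p) (ht : 0 ≤ t) {u : ℝ → ℝ → ℂ}
    (hsp : MemLp (Function.uncurry u) (ENNReal.ofReal (p + 1))
      ((volume.restrict (Set.Icc 0 t)).prod volume))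
    (hu : ∀ τ ∈ Set.Icc 0 t, MemLp (u τ) 2 volume) {R : ℝ≥0∞} (hR : R ≠ ⊤)
    (huR : ∀ τ ∈ Set.Icc 0 t, eLpNorm (u τ) 2 volume ≤ R)
    (heq : ∀ φ : 𝓢(ℝ, ℂ), ∀ τ ∈ Set.Icc 0 t,
      Complex.I * (∫ x, u τ x * φ x) - Complex.I * (∫ x, u 0 x * φ x)
        + ∫ r in (0 : ℝ)..τ, ∫ x, u r x * iteratedDeriv 2 φ x
        = ∫ r in (0 : ℝ)..τ, ∫ x, nonlin p (u r) x * φ x) :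
    eLpNorm (u t) 2 volume ≤ eLpNorm (u 0) 2 volume := by
  set μ : Measure ℝ := volume.restrict (Set.Ioc 0 t) with hμ
  have hsp' : MemLp (Function.uncurry u) (ENNReal.ofReal (p + 1)) (μ.prod volume) :=
    hsp.mono_measure (Measure.prod_mono (Measure.restrict_mono Set.Ioc_subset_Icc_self le_rfl)
      le_rfl)
  -- A jointly measurable representative is needed for Fubini; it agrees with `u τ` only for almost
  -- every `τ`, so the endpoint values are kept as `u 0` and `u t`.
  obtain ⟨F, hF, hFu⟩ := hsp'.1
  have hae : ∀ᵐ τ ∂μ, u τ =ᵐ[volume] fun y => F (τ, y) := Measure.ae_ae_of_ae_prod hFu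
  have hFp : MemLp F (ENNReal.ofReal (p + 1)) (μ.prod volume) := hsp'.ae_eq hFu
  have hp1 : 0 < p + 1 := by linarith
  have hq : 1 ≤ (p + 1) / p := by rw [le_div_iff₀ (by linarith)]; linarith
  have hsq (f : ℝ → ℂ) : eLpNorm f 2 volume ^ (2 : ℝ) = ∫⁻ x, ‖f x‖ₑ ^ (2 : ℝ) := by
    rw [eLpNorm_eq_lintegral_rpow_enorm_toReal two_ne_zero ENNReal.ofNat_ne_top,
      ← ENNReal.rpow_mul]
    norm_num
  have hmem : ∀ τ ∈ Set.Ioc 0 t, τ ∈ Set.Icc 0 t := fun τ h => Set.Ioc_subset_Icc_self h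
  -- The a priori bound `R` does not enter the conclusion; it only makes the dispersive term
  -- integrable in space-time.
  have hF2 : MemLp F (ENNReal.ofReal 2) (μ.prod volume) := by
    rw [memLp_ofReal_iff two_pos]
    have hm : Measurable fun z => ‖F z‖ₑ ^ (2 : ℝ) := hF.enorm.pow_const _
    refine ⟨hF.aestronglyMeasurable, ?_⟩
    rw [lintegral_prod _ hm.aemeasurable]
    calc ∫⁻ τ, (∫⁻ y, ‖F (τ, y)‖ₑ ^ (2 : ℝ)) ∂μ ≤ ∫⁻ _, R ^ (2 : ℝ) ∂μ := by
          refine lintegral_mono_ae ?_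
          filter_upwards [hae, ae_restrict_mem measurableSet_Ioc] with τ h1 h2
          rw [← hsq fun y => F (τ, y), ← eLpNorm_congr_ae h1]
          gcongr
          exact huR τ (hmem τ h2)
      _ < ⊤ := by
          rw [lintegral_const]
          exact ENNReal.mul_lt_top (ENNReal.rpow_lt_top_of_nonneg zero_le_two hR)
            (measure_lt_top μ _)
  have hN : StronglyMeasurable fun z => pw p (F z) := (continuous_pw hp).comp_stronglyMeasurable hF
  have hNq := memLp_pw hp hFp
  obtain ⟨ρ, hρs, hρ, hρ1, hρlim⟩ := exists_mollifier
  set V : ℕ → ℝ × ℝ → ℂ := fun n z => mollify (ρ n) (fun y => F (z.1, y)) z.2 with hV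
  set G : ℕ → ℝ × ℝ → ℂ := fun n z => mollify (ρ n) (fun y => pw p (F (z.1, y))) z.2 with hG
  have hVm (n : ℕ) : StronglyMeasurable (V n) := stronglyMeasurable_mollify (hρ n).continuous hF
  have hGm (n : ℕ) : StronglyMeasurable (G n) := stronglyMeasurable_mollify (hρ n).continuous hN
  have hloc {q : ℝ} (hq : 1 ≤ q) {H : ℝ × ℝ → ℂ} (hH : StronglyMeasurable H)
      (hHq : MemLp H (ENNReal.ofReal q) (μ.prod volume)) :
      ∀ᵐ z ∂(μ.prod volume),
        Tendsto (fun n => mollify (ρ n) (fun y => H (z.1, y)) z.2) atTop (𝓝 (H z)) := by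
    have hq0 : 0 < q := by linarith
    rw [Measure.ae_prod_iff_ae_ae (measurableSet_tendsto_fun (fun n =>
      (stronglyMeasurable_mollify (hρ n).continuous hH).measurable) hH.measurable)]
    rw [memLp_ofReal_iff hq0] at hHq
    have hm : Measurable fun z => ‖H z‖ₑ ^ q := hH.enorm.pow_const _
    rw [lintegral_prod _ hm.aemeasurable] at hHq
    filter_upwards [ae_lt_top hm.lintegral_prod_right' hHq.2.ne] with τ hτ
    refine hρlim (fun y => H (τ, y)) (MemLp.locallyIntegrable (p := ENNReal.ofReal q) ?_ ?_)
    · exact (memLp_ofReal_iff hq0).2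
        ⟨(hH.comp_measurable measurable_prodMk_left).aestronglyMeasurable, hτ⟩
    · simpa using hq
  have hVlim := hloc (by linarith) hF hFp
  have hGlim := hloc hq hN hNq
  have hfin := ((memLp_ofReal_iff hp1).1 hFp).2
  -- Young's inequality dominates the integrand by `|V|^{p+1} + |G|^{(p+1)/p}`. Since the kernels
  -- have mass one, the integral of this bound does not exceed that of its limit. The integrand
  -- tends almost everywhere to `Im(F̄ |F|^{p-1}F) = 0`.
  have hI : Tendsto (fun n => ∫⁻ z, ‖((starRingEnd ℂ) (V n z) * G n z).im‖ₑ ∂(μ.prod volume))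
      atTop (𝓝 0) := by
    refine tendsto_lintegral_zero_of_le
      (H := fun n z => ‖V n z‖ₑ ^ (p + 1) + ‖G n z‖ₑ ^ ((p + 1) / p))
      (h := fun z => ‖F z‖ₑ ^ (p + 1) + ‖pw p (F z)‖ₑ ^ ((p + 1) / p)) (fun n => ?_) (fun n => ?_)
      (fun n z => ?_) (fun n => ?_) ?_ ?_ ?_
    · exact (Complex.continuous_im.comp_stronglyMeasurable
        ((Complex.continuous_conj.comp_stronglyMeasurable (hVm n)).mul
          (hGm n))).enorm.aemeasurable
    · exact (((hVm n).enorm.pow_const _).add ((hGm n).enorm.pow_const _)).aemeasurable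
    · have h1 : ‖((starRingEnd ℂ) (V n z) * G n z).im‖ₑ ≤ ‖V n z‖ₑ * ‖G n z‖ₑ := by
        rw [← ofReal_norm, ← ofReal_norm, ← ofReal_norm, ← ENNReal.ofReal_mul (norm_nonneg _)]
        refine ENNReal.ofReal_le_ofReal ((Complex.abs_im_le_norm _).trans (le_of_eq ?_))
        rw [norm_mul, RCLike.norm_conj]
      refine h1.trans ((ENNReal.young_inequality _ _ (holderConjugate_add_one hp)).trans ?_)
      gcongr
      · exact ENNReal.div_le_of_le_mul (le_mul_of_one_le_right zero_le
          (by simpa using (by linarith : (0 : ℝ) ≤ p)))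
      · exact ENNReal.div_le_of_le_mul (le_mul_of_one_le_right zero_le (by simpa using hq))
    · rw [lintegral_add_left ((hVm n).enorm.pow_const _),
        lintegral_add_left (hF.enorm.pow_const _)]
      have h1 := lintegral_enorm_mollify_prod_le (μ := μ) (by linarith : 1 ≤ p + 1)
        (hρ n).continuous hF
      have h2 := lintegral_enorm_mollify_prod_le (μ := μ) hq (hρ n).continuous hN
      rw [hρ1 n, ENNReal.one_rpow, one_mul] at h1 h2
      exact add_le_add h1 h2
    · rw [lintegral_add_left (hF.enorm.pow_const _)]
      simp_rw [enorm_pw_rpow hp]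
      exact (ENNReal.add_lt_top.2 ⟨hfin, hfin⟩).ne
    · filter_upwards [hVlim, hGlim] with z h1 h2
      exact ((ENNReal.continuous_rpow_const.tendsto _).comp h1.enorm).add
        ((ENNReal.continuous_rpow_const.tendsto _).comp h2.enorm)
    · filter_upwards [hVlim, hGlim] with z h1 h2
      have h3 := (((Complex.continuous_im.tendsto _).comp
        (((Complex.continuous_conj.tendsto _).comp h1).mul h2))).enorm
      rw [im_conj_mul_pw, enorm_zero] at h3
      exact h3
  have h0 : (0 : ℝ) ∈ Set.Icc 0 t := ⟨le_rfl, ht⟩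
  have htt : t ∈ Set.Icc 0 t := ⟨ht, le_rfl⟩
  have hbound (n : ℕ) : ∫⁻ x, ‖mollify (ρ n) (u t) x‖ₑ ^ (2 : ℝ) ≤
      eLpNorm (u 0) 2 volume ^ (2 : ℝ) +
        2 * ∫⁻ z, ‖((starRingEnd ℂ) (V n z) * G n z).im‖ₑ ∂(μ.prod volume) := by
    refine (lintegral_mollify_sq_le hp ht hF hae hF2 hFp (hu 0 h0) (hu t htt) (hρs n) (hρ n)
      heq).trans ?_
    gcongr
    rw [hsq]
    have := lintegral_enorm_mollify_rpow_le one_le_two (hρ n).continuous (hu 0 h0).1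
    rwa [hρ1 n, ENNReal.one_rpow, one_mul] at this
  -- Only an upper bound for the mass is needed, so Fatou's lemma suffices at time `t`.
  have hfatou : ∫⁻ x, ‖u t x‖ₑ ^ (2 : ℝ) ≤
      liminf (fun n => ∫⁻ x, ‖mollify (ρ n) (u t) x‖ₑ ^ (2 : ℝ)) atTop := by
    refine le_trans (le_of_eq (lintegral_congr_ae ?_)) (lintegral_liminf_le' fun n => ?_)
    · filter_upwards [hρlim (u t) ((hu t htt).locallyIntegrable (by norm_num))] with x hx
      exact ((ENNReal.continuous_rpow_const.tendsto _).comp hx.enorm).liminf_eq.symm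
    · have := memLp_mollify one_le_two (hρ n).continuous
        ((hρ n).continuous.integrable_of_hasCompactSupport (hρs n)) (f := u t)
        (by simpa using hu t htt)
      exact this.1.enorm.pow_const _
  have hlim : Tendsto (fun n => eLpNorm (u 0) 2 volume ^ (2 : ℝ) +
      2 * ∫⁻ z, ‖((starRingEnd ℂ) (V n z) * G n z).im‖ₑ ∂(μ.prod volume)) atTop
      (𝓝 (eLpNorm (u 0) 2 volume ^ (2 : ℝ))) := by
    have := (ENNReal.Tendsto.const_mul hI (Or.inr ENNReal.ofNat_ne_top) (a := 2)).const_add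
      (eLpNorm (u 0) 2 volume ^ (2 : ℝ))
    simpa using this
  have hfinal := hfatou.trans ((liminf_le_liminf (Eventually.of_forall hbound)).trans
    hlim.liminf_eq.le)
  rw [← hsq] at hfinal
  exact (ENNReal.rpow_le_rpow_iff two_pos).1 hfinal

/-! ### Averages in time of a continuous curve in `L²` -/

/-- The pairing of square-integrable functions with a Schwartz function. -/
def pairing (φ : 𝓢(ℝ, ℂ)) : L2 →L[ℂ] ℂ :=
  LinearMap.mkContinuous
    { toFun := fun f => Lp.toTemperedDistribution f φ
      map_add' := fun f g =>
        congrArg (fun S : 𝓢'(ℝ, ℂ) => S φ) (map_add (Lp.toTemperedDistributionCLM ℂ volume 2) f g)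
      map_smul' := fun c f =>
        congrArg (fun S : 𝓢'(ℝ, ℂ) => S φ) (map_smul (Lp.toTemperedDistributionCLM ℂ volume 2) c f) }
    ‖φ.toLp 2 (volume : Measure ℝ)‖ fun f => by
      have h := enorm_apply_le_normL (Lp.toTemperedDistribution f) φ
      rw [normL_two_toTemperedDistribution, ← ofReal_norm, ← ofReal_norm, ← ofReal_norm,
        ← ENNReal.ofReal_mul (norm_nonneg _), ENNReal.ofReal_le_ofReal_iff (by positivity),
        mul_comm] at h
      exact h

theorem pairing_apply (φ : 𝓢(ℝ, ℂ)) (f : L2) : pairing φ f = Lp.toTemperedDistribution f φ := rfl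

theorem norm_pairing_le (φ : 𝓢(ℝ, ℂ)) (f : L2) :
    ‖pairing φ f‖ ≤ ‖f‖ * ‖φ.toLp 2 (volume : Measure ℝ)‖ := by
  rw [mul_comm]
  exact (pairing φ).le_of_opNorm_le (LinearMap.mkContinuous_norm_le _ (norm_nonneg _) _) f

/-- The second derivative of a Schwartz function. -/
def secondDeriv (φ : 𝓢(ℝ, ℂ)) : 𝓢(ℝ, ℂ) :=
  SchwartzMap.derivCLM ℂ ℂ (SchwartzMap.derivCLM ℂ ℂ φ)

theorem derivCLM_derivCLM_apply (S : 𝓢'(ℝ, ℂ)) (φ : 𝓢(ℝ, ℂ)) :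
    TemperedDistribution.derivCLM ℂ (TemperedDistribution.derivCLM ℂ S) φ = S (secondDeriv φ) := by
  simp [secondDeriv, TemperedDistribution.derivCLM_apply_apply]

/-- The average of `g` over the interval between `t` and `t + h`. -/
def average {E : Type*} [NormedAddCommGroup E] [NormedSpace ℝ E] (g : ℝ → E) (h t : ℝ) : E :=
  ∫ r in (0 : ℝ)..1, g (t + h * r)

section

variable {E : Type*} [NormedAddCommGroup E] [NormedSpace ℝ E] {g : ℝ → E}

theorem average_eq (g : ℝ → E) {h : ℝ} (hh : h ≠ 0) (t : ℝ) :
    average g h t = h⁻¹ • ∫ τ in t..(t + h), g τ := by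
  rw [average, intervalIntegral.integral_comp_add_mul _ hh]
  simp

/-- Rescaling the average to `[0,1]` makes it continuous up to and including `h = 0`, where it
equals `g`; the limit `h → 0` later is an evaluation at zero. -/
theorem continuous_average (hg : Continuous g) : Continuous fun x : ℝ × ℝ => average g x.1 x.2 := by
  refine intervalIntegral.continuous_parametric_intervalIntegral_of_continuous'
    (f := fun (x : ℝ × ℝ) (r : ℝ) => g (x.2 + x.1 * r)) ?_ 0 1
  exact hg.comp (by fun_prop : Continuous fun x : (ℝ × ℝ) × ℝ => x.1.2 + x.1.1 * x.2)

theorem continuous_average_right (hg : Continuous g) (h : ℝ) : Continuous (average g h) :=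
  (continuous_average hg).comp (by fun_prop : Continuous fun t : ℝ => (h, t))

theorem average_zero [CompleteSpace E] (g : ℝ → E) (t : ℝ) : average g 0 t = g t := by
  simp [average]

theorem hasDerivAt_average [CompleteSpace E] (hg : Continuous g) {h : ℝ} (hh : h ≠ 0) (t : ℝ) :
    HasDerivAt (average g h) (h⁻¹ • (g (t + h) - g t)) t := by
  have h1 : average g h = fun t => h⁻¹ • ((∫ τ in (0 : ℝ)..(t + h), g τ) - ∫ τ in (0 : ℝ)..t, g τ) := by
    funext t
    rw [average_eq g hh, intervalIntegral.integral_interval_sub_left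
      (hg.intervalIntegrable _ _) (hg.intervalIntegrable _ _)]
  rw [h1]
  have hd (t : ℝ) : HasDerivAt (fun t => ∫ τ in (0 : ℝ)..t, g τ) (g t) t :=
    intervalIntegral.integral_hasDerivAt_right (hg.intervalIntegrable _ _)
      (hg.stronglyMeasurableAtFilter _ _) hg.continuousAt
  exact (((hd (t + h)).comp_add_const t h).sub (hd t)).const_smul h⁻¹

theorem norm_average_le {C h t : ℝ} (hC : ∀ r ∈ Set.Icc (0 : ℝ) 1, ‖g (t + h * r)‖ ≤ C) :
    ‖average g h t‖ ≤ C := by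
  have := intervalIntegral.norm_integral_le_of_norm_le_const (f := fun r => g (t + h * r))
    (a := 0) (b := 1) (C := C) fun r hr => hC r ?_
  · simpa [average] using this
  · rw [Set.uIoc_of_le zero_le_one] at hr
    exact Set.Ioc_subset_Icc_self hr

end

theorem map_average (L : L2 →L[ℂ] L2) {g : ℝ → L2} (hg : Continuous g) (h t : ℝ) :
    L (average g h t) = average (fun τ => L (g τ)) h t :=
  (L.intervalIntegral_comp_comm (Continuous.intervalIntegrable (by fun_prop) _ _)).symm

theorem pairing_average (φ : 𝓢(ℝ, ℂ)) {g : ℝ → L2} (hg : Continuous g) (h t : ℝ) :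
    pairing φ (average g h t) = average (fun τ => pairing φ (g τ)) h t :=
  ((pairing φ).intervalIntegral_comp_comm (Continuous.intervalIntegrable (by fun_prop) _ _)).symm

/-- The averages in time of a nonnegative function, integrated over an interval. -/
theorem integral_average_le {f : ℝ → ℝ} (hf : Integrable f) (hf0 : 0 ≤ f) {h T : ℝ} (hh : 0 < h) :
    ∫ t in (0 : ℝ)..T, average f h t ≤ ∫ τ, f τ := by
  -- The average is the difference quotient of the primitive `Φ`. Its integral over `[0,T]`
  -- telescopes to two end pieces of length `h`, where `0 ≤ Φ ≤ ∫ f`.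
  set Φ : ℝ → ℝ := fun t => ∫ τ in Set.Iic t, f τ with hΦ
  have hΦle (t : ℝ) : Φ t ≤ ∫ τ, f τ := setIntegral_le_integral hf (Eventually.of_forall hf0)
  have hΦ0 (t : ℝ) : 0 ≤ Φ t := setIntegral_nonneg measurableSet_Iic fun τ _ => hf0 τ
  have hav (t : ℝ) : average f h t = h⁻¹ * (Φ (t + h) - Φ t) := by
    rw [average_eq f hh.ne', smul_eq_mul, hΦ]
    simp only [intervalIntegral.integral_Iic_sub_Iic hf.integrableOn hf.integrableOn]
  have hc : Continuous Φ := by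
    have h1 : Φ = fun t => Φ 0 + ∫ τ in (0 : ℝ)..t, f τ := by
      funext t
      rw [← intervalIntegral.integral_Iic_sub_Iic hf.integrableOn hf.integrableOn]
      simp [hΦ]
    rw [h1]
    exact continuous_const.add (intervalIntegral.continuous_primitive
      (fun a b => hf.intervalIntegrable) 0)
  have hi (a b : ℝ) : IntervalIntegrable Φ volume a b := hc.intervalIntegrable a b
  have hbound : ∫ t in T..(T + h), Φ t ≤ h * ∫ τ, f τ := by
    have := intervalIntegral.integral_mono_on (by linarith : T ≤ T + h) (hi _ _)
      intervalIntegrable_const (g := fun _ => ∫ τ, f τ) fun t _ => hΦle t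
    simpa using this
  have hpos : 0 ≤ ∫ t in (0 : ℝ)..(0 + h), Φ t :=
    intervalIntegral.integral_nonneg (by linarith) fun t _ => hΦ0 t
  calc ∫ t in (0 : ℝ)..T, average f h t
      = h⁻¹ * ((∫ t in (0 : ℝ)..T, Φ (t + h)) - ∫ t in (0 : ℝ)..T, Φ t) := by
        simp_rw [hav]
        rw [intervalIntegral.integral_const_mul, intervalIntegral.integral_sub
          (Continuous.intervalIntegrable (by fun_prop) _ _) (hi _ _)]
    _ = h⁻¹ * ((∫ t in T..(T + h), Φ t) - ∫ t in (0 : ℝ)..(0 + h), Φ t) := by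
        rw [intervalIntegral.integral_comp_add_right]
        congr 1
        have e1 := intervalIntegral.integral_add_adjacent_intervals (hi 0 (0 + h)) (hi (0 + h) (T + h))
        have e2 := intervalIntegral.integral_add_adjacent_intervals (hi 0 T) (hi T (T + h))
        linarith
    _ ≤ h⁻¹ * (h * ∫ τ, f τ) := by gcongr; linarith
    _ = ∫ τ, f τ := by field_simp

/-! ### The interaction Morawetz inequality in time -/

theorem abs_morawetz_le {g : L2} {M K : ℝ} (hM : ‖J g‖ ≤ M) (hK : ‖D g‖ ≤ K) :
    |morawetz g| ≤ M ^ 3 * K := by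
  have hM0 : 0 ≤ M := (norm_nonneg _).trans hM
  have hK0 : 0 ≤ K := (norm_nonneg _).trans hK
  calc |morawetz g| ≤ ‖J g‖ * ‖D g‖ * (‖J g‖ * ‖J g‖) := abs_lam_le _ _ _ _
    _ ≤ M * K * (M * M) := by gcongr
    _ = _ := by ring

theorem integral_le_of_forall_le {P d η a : ℝ → ℝ} (hP : Continuous P) (hd : Continuous d)
    (hη : Continuous η) (ha : Continuous a) {c B S : ℝ} (hS : 0 ≤ S)
    (h : ∀ t ∈ Set.Icc 0 S, c * P t ≤ d t + B * (η t + a t)) :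
    c * ∫ t in (0 : ℝ)..S, P t ≤ (∫ t in (0 : ℝ)..S, d t) +
      B * ((∫ t in (0 : ℝ)..S, η t) + ∫ t in (0 : ℝ)..S, a t) := by
  have hi {b : ℝ → ℝ} (hb : Continuous b) : IntervalIntegrable b volume 0 S :=
    hb.intervalIntegrable 0 S
  rw [← intervalIntegral.integral_add (hi hη) (hi ha), ← intervalIntegral.integral_const_mul,
    ← intervalIntegral.integral_const_mul,
    ← intervalIntegral.integral_add (hi hd) (hi (by fun_prop))]
  exact intervalIntegral.integral_mono_on hS (hi (by fun_prop)) (hi (by fun_prop)) h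

section

variable {p T M K : ℝ} {g : ℝ → L2} {f : ℝ → ℝ}

/-- The weak form of `i ∂ₜ(Jg) + ∂ₓ²(Jg) = |Jg|^{p-1} Jg + O(f)` on `[0,T]`, where `O(f(t))` is
bounded by `f(t)` in `L²`. -/
def AlmostSolves (hp : 1 < p) (T : ℝ) (g : ℝ → L2) (f : ℝ → ℝ) : Prop :=
  ∀ (φ : 𝓢(ℝ, ℂ)) (a b : ℝ), 0 ≤ a → a ≤ b → b ≤ T →
    ‖Complex.I * (pairing φ (J (g b)) - pairing φ (J (g a)))
      + (∫ τ in a..b, pairing (secondDeriv φ) (J (g τ)))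
      - ∫ τ in a..b, pairing φ (NJ hp (g τ))‖ ≤ (∫ τ in a..b, f τ) * ‖φ.toLp 2 (volume : Measure ℝ)‖

/-- The interaction Morawetz inequality for the averages in time of an almost solution. -/
theorem AlmostSolves.morawetz_average (hp : 1 < p) (hg : Continuous g) (hf0 : 0 ≤ f)
    (H : AlmostSolves hp T g f) {h t : ℝ} (hh : 0 < h) (ht : 0 ≤ t) (htT : t + h ≤ T) :
    (p - 1) / (p + 1) * PhiJ hp (average g h t) ≤
      dmorawetz (average g h t) (h⁻¹ • (g (t + h) - g t)) +
        6 * ‖J (average g h t)‖ ^ 2 * ‖D (average g h t)‖ *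
          (‖NJ hp (average g h t) - average (fun τ => NJ hp (g τ)) h t‖ + average f h t) := by
  set k : L2 := h⁻¹ • (g (t + h) - g t) with hk
  have hN : Continuous fun τ => NJ hp (g τ) := (continuous_NJ hp).comp hg
  have hJg : Continuous fun τ => J (g τ) := J.continuous.comp hg
  have hav0 : 0 ≤ average f h t :=
    intervalIntegral.integral_nonneg zero_le_one fun r _ => hf0 _
  -- `l` is the defect in the equation for the averaged curve, so far only a distribution. Its bound
  -- on test functions in `L²` shows that it is an `L²` function `E`.
  let l : 𝓢(ℝ, ℂ) →ₗ[ℂ] ℂ :=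
    ((Lp.toTemperedDistribution (NJ hp (average g h t)) -
      Complex.I • Lp.toTemperedDistribution (J k) -
      TemperedDistribution.derivCLM ℂ (TemperedDistribution.derivCLM ℂ
        (Lp.toTemperedDistribution (J (average g h t)))) : 𝓢'(ℝ, ℂ)) : 𝓢(ℝ, ℂ) →ₗ[ℂ] ℂ)
  have hl (φ : 𝓢(ℝ, ℂ)) : l φ = pairing φ (NJ hp (average g h t)) - Complex.I * pairing φ (J k) -
      pairing (secondDeriv φ) (J (average g h t)) := by
    simp only [pairing_apply, ← derivCLM_derivCLM_apply]
    rfl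
  have hbound (φ : 𝓢(ℝ, ℂ)) : ‖l φ‖ ≤
      (‖NJ hp (average g h t) - average (fun τ => NJ hp (g τ)) h t‖ + average f h t) *
        ‖φ.toLp 2 (volume : Measure ℝ)‖ := by
    have e1 : pairing φ (J k) =
        (h⁻¹ : ℂ) * (pairing φ (J (g (t + h))) - pairing φ (J (g t))) := by
      rw [hk, J.map_smul_of_tower, (pairing φ).map_smul_of_tower, map_sub, map_sub, Complex.real_smul]
      push_cast
      rfl
    have e2 : pairing (secondDeriv φ) (J (average g h t)) =
        (h⁻¹ : ℂ) * ∫ τ in t..(t + h), pairing (secondDeriv φ) (J (g τ)) := by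
      rw [map_average J hg, pairing_average _ hJg, average_eq _ hh.ne', Complex.real_smul]
      push_cast
      rfl
    have e3 : pairing φ (average (fun τ => NJ hp (g τ)) h t) =
        (h⁻¹ : ℂ) * ∫ τ in t..(t + h), pairing φ (NJ hp (g τ)) := by
      rw [pairing_average _ hN, average_eq _ hh.ne', Complex.real_smul]
      push_cast
      rfl
    -- The defect has two parts: the commutator of the nonlinearity with averaging, and the defect
    -- of the original equation over `[t, t+h]`, divided by `h`.
    have e4 : l φ = pairing φ (NJ hp (average g h t) - average (fun τ => NJ hp (g τ)) h t) -
        (h⁻¹ : ℂ) * (Complex.I * (pairing φ (J (g (t + h))) - pairing φ (J (g t)))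
          + (∫ τ in t..(t + h), pairing (secondDeriv φ) (J (g τ)))
          - ∫ τ in t..(t + h), pairing φ (NJ hp (g τ))) := by
      rw [hl, e1, e2, map_sub, e3]
      ring
    rw [e4, add_mul]
    refine (norm_sub_le _ _).trans (add_le_add (norm_pairing_le _ _) ?_)
    rw [norm_mul, norm_inv, Complex.norm_real, Real.norm_of_nonneg hh.le, average_eq _ hh.ne',
      smul_eq_mul, mul_assoc]
    exact mul_le_mul_of_nonneg_left (H φ t (t + h) ht (by linarith) htT) (by positivity)
  obtain ⟨E, hE, hEl⟩ := exists_L2_of_bound l (by positivity) hbound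
  have heq : TemperedDistribution.derivCLM ℂ (TemperedDistribution.derivCLM ℂ
      (Lp.toTemperedDistribution (J (average g h t)))) =
      Lp.toTemperedDistribution (NJ hp (average g h t) - E - Complex.I • J k) := by
    ext φ
    have h1 := hl φ
    rw [hEl φ] at h1
    rw [derivCLM_derivCLM_apply, ← pairing_apply, ← pairing_apply, map_sub, map_sub, map_smul,
      smul_eq_mul, pairing_apply φ E, h1]
    ring
  refine (morawetz_inequality hp _ _ E heq).trans ?_
  gcongr

/-- The interaction Morawetz inequality for almost solutions, up to a time before the end. -/
theorem AlmostSolves.integral_average_le (hp : 1 < p) (hg : Continuous g) (hf : Integrable f)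
    (hf0 : 0 ≤ f) (H : AlmostSolves hp T g f) (hM : ∀ t ∈ Set.Icc 0 T, ‖J (g t)‖ ≤ M)
    (hK : ∀ t ∈ Set.Icc 0 T, ‖D (g t)‖ ≤ K) {h S : ℝ} (hh : 0 < h) (hS : 0 ≤ S) (hST : S + h ≤ T) :
    (p - 1) / (p + 1) * ∫ t in (0 : ℝ)..S, PhiJ hp (average g h t) ≤
      2 * M ^ 3 * K + 6 * M ^ 2 * K *
        ((∫ t in (0 : ℝ)..S, ‖NJ hp (average g h t) - average (fun τ => NJ hp (g τ)) h t‖) +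
          ∫ t, f t) := by
  have hT0 : (0 : ℝ) ∈ Set.Icc 0 T := ⟨le_rfl, by linarith⟩
  have hM0 : 0 ≤ M := (norm_nonneg _).trans (hM 0 hT0)
  have hK0 : 0 ≤ K := (norm_nonneg _).trans (hK 0 hT0)
  have hN : Continuous fun τ => NJ hp (g τ) := (continuous_NJ hp).comp hg
  have hgav := continuous_average_right hg h
  have hNav := continuous_average_right hN h
  have hmem {t r : ℝ} (ht : t ∈ Set.Icc 0 S) (hr : r ∈ Set.Icc (0 : ℝ) 1) :
      t + h * r ∈ Set.Icc 0 T := by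
    have h1 : 0 ≤ h * r := mul_nonneg hh.le hr.1
    have h2 : h * r ≤ h := mul_le_of_le_one_right hh.le hr.2
    exact ⟨by linarith [ht.1], by linarith [ht.2]⟩
  have hJav {t : ℝ} (ht : t ∈ Set.Icc 0 S) : ‖J (average g h t)‖ ≤ M := by
    rw [map_average J hg]
    exact norm_average_le fun r hr => hM _ (hmem ht hr)
  have hDav {t : ℝ} (ht : t ∈ Set.Icc 0 S) : ‖D (average g h t)‖ ≤ K := by
    rw [map_average D hg]
    exact norm_average_le fun r hr => hK _ (hmem ht hr)
  have hcP : Continuous fun t => PhiJ hp (average g h t) := (continuous_PhiJ hp).comp hgav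
  have hcη : Continuous fun t => ‖NJ hp (average g h t) - average (fun τ => NJ hp (g τ)) h t‖ :=
    (((continuous_NJ hp).comp hgav).sub hNav).norm
  have hcd : Continuous fun t => dmorawetz (average g h t) (h⁻¹ • (g (t + h) - g t)) :=
    continuous_dmorawetz.comp (f := fun t => (average g h t, h⁻¹ • (g (t + h) - g t)))
      (hgav.prodMk (by fun_prop))
  have hcf : Continuous fun t => average f h t := by
    have h1 : (fun t => average f h t) =
        fun t => h⁻¹ * ((∫ τ in (0 : ℝ)..(t + h), f τ) - ∫ τ in (0 : ℝ)..t, f τ) := by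
      funext t
      rw [average_eq f hh.ne', smul_eq_mul, intervalIntegral.integral_interval_sub_left
        hf.intervalIntegrable hf.intervalIntegrable]
    rw [h1]
    have hc : Continuous fun t => ∫ τ in (0 : ℝ)..t, f τ :=
      intervalIntegral.continuous_primitive (fun a b => hf.intervalIntegrable) 0
    exact continuous_const.mul ((hc.comp (continuous_add_const h)).sub hc)
  have hpoint : ∀ t ∈ Set.Icc 0 S, (p - 1) / (p + 1) * PhiJ hp (average g h t) ≤
      dmorawetz (average g h t) (h⁻¹ • (g (t + h) - g t)) + 6 * M ^ 2 * K *
        (‖NJ hp (average g h t) - average (fun τ => NJ hp (g τ)) h t‖ + average f h t) := by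
    intro t ht
    refine (H.morawetz_average hp hg hf0 hh ht.1 (by linarith [ht.2])).trans ?_
    have hav0 : 0 ≤ average f h t :=
      intervalIntegral.integral_nonneg zero_le_one fun r _ => hf0 _
    gcongr
    · exact hJav ht
    · exact hDav ht
  have hint := integral_le_of_forall_le hcP hcd hcη hcf hS hpoint
  -- The functional is differentiable along the averaged curve, so the derivative integrates to two
  -- boundary values, each at most `M³K`.
  rw [intervalIntegral.integral_eq_sub_of_hasDerivAt
      (fun t _ => hasDerivAt_morawetz (hasDerivAt_average hg hh.ne' t))
      (hcd.intervalIntegrable _ _)] at hint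
  refine hint.trans ?_
  have h1 := abs_le.1 (abs_morawetz_le (hJav ⟨hS, le_rfl⟩) (hDav ⟨hS, le_rfl⟩))
  have h2 := abs_le.1 (abs_morawetz_le (hJav ⟨le_rfl, hS⟩) (hDav ⟨le_rfl, hS⟩))
  have h3 := AlmostMorawetz.integral_average_le hf hf0 (T := S) hh
  gcongr
  linarith [h1.2, h2.1]

/-- The interaction Morawetz inequality for almost solutions. -/
theorem AlmostSolves.integral_le (hp : 1 < p) (hg : Continuous g) (hf : Integrable f)
    (hf0 : 0 ≤ f) (H : AlmostSolves hp T g f) (hM : ∀ t ∈ Set.Icc 0 T, ‖J (g t)‖ ≤ M)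
    (hK : ∀ t ∈ Set.Icc 0 T, ‖D (g t)‖ ≤ K) (hT : 0 < T) :
    (p - 1) / (p + 1) * ∫ t in (0 : ℝ)..T, PhiJ hp (g t) ≤
      2 * M ^ 3 * K + 6 * M ^ 2 * K * ∫ t, f t := by
  have hN : Continuous fun τ => NJ hp (g τ) := (continuous_NJ hp).comp hg
  have hgav := continuous_average hg
  have hNav := continuous_average hN
  have hPg : Continuous fun t => PhiJ hp (g t) := (continuous_PhiJ hp).comp hg
  -- The averages look ahead by `h`, so stopping at `S < T` leaves room for small `h`. The limit `h
  -- → 0` is taken first, then `S → T`.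
  have key : ∀ S ∈ Set.Ico 0 T, (p - 1) / (p + 1) * ∫ t in (0 : ℝ)..S, PhiJ hp (g t) ≤
      2 * M ^ 3 * K + 6 * M ^ 2 * K * ∫ t, f t := by
    intro S hS
    have hc1 : Continuous fun h : ℝ => ∫ t in (0 : ℝ)..S, PhiJ hp (average g h t) :=
      intervalIntegral.continuous_parametric_intervalIntegral_of_continuous'
        (f := fun h t => PhiJ hp (average g h t)) ((continuous_PhiJ hp).comp hgav) 0 S
    have hc2 : Continuous fun h : ℝ => ∫ t in (0 : ℝ)..S,
        ‖NJ hp (average g h t) - average (fun τ => NJ hp (g τ)) h t‖ :=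
      intervalIntegral.continuous_parametric_intervalIntegral_of_continuous'
        (f := fun h t => ‖NJ hp (average g h t) - average (fun τ => NJ hp (g τ)) h t‖)
        (((continuous_NJ hp).comp hgav).sub hNav).norm 0 S
    have hl1 := (hc1.const_mul ((p - 1) / (p + 1))).tendsto 0
    have hl2 := (continuous_const.add ((hc2.add continuous_const).const_mul
      (6 * M ^ 2 * K))).tendsto (0 : ℝ) (f := fun h : ℝ => 2 * M ^ 3 * K + 6 * M ^ 2 * K *
        ((∫ t in (0 : ℝ)..S, ‖NJ hp (average g h t) - average (fun τ => NJ hp (g τ)) h t‖) +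
          ∫ t, f t))
    simp only [average_zero, sub_self, norm_zero, intervalIntegral.integral_zero, zero_add]
      at hl1 hl2
    refine le_of_tendsto_of_tendsto (hl1.mono_left (nhdsWithin_le_nhds (s := Set.Ioi 0)))
      (hl2.mono_left nhdsWithin_le_nhds) ?_
    filter_upwards [Ioc_mem_nhdsGT (sub_pos.2 hS.2)] with h hh
    exact H.integral_average_le hp hg hf hf0 hM hK hh.1 hS.1 (by linarith [hh.2])
  have hc : Continuous fun S => (p - 1) / (p + 1) * ∫ t in (0 : ℝ)..S, PhiJ hp (g t) :=
    (intervalIntegral.continuous_primitive (fun a b => hPg.intervalIntegrable a b) 0).const_mul _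
  refine le_of_tendsto ((hc.tendsto T).mono_left (nhdsWithin_le_nhds (s := Set.Iio T))) ?_
  filter_upwards [Ico_mem_nhdsLT hT] with S hS
  exact key S hS

end

/-! ### Solutions as continuous curves -/

section

variable {p s T N : ℝ} {u₀ : ℝ → ℂ} {u : ℝ → ℝ → ℂ} {m : ℝ → ℝ}

theorem besselSymbol_zero : besselSymbol 0 = 1 := by
  ext ξ
  simp [besselSymbol]

/-- A solution in `H^s` as a continuous curve in `L²`, the Bessel potential of order `s` of `u`. -/
theorem IsSolution.exists_curve (h : IsSolution p s T u₀ u) (hT : 0 ≤ T) :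
    ∃ G : ℝ → L2, Continuous G ∧ ∀ t ∈ Set.Icc 0 T, Lp.toTemperedDistribution (G t) =
      TemperedDistribution.besselPotential ℝ ℂ s (ofFun (u t)) := by
  choose G hG using fun t : Set.Icc 0 T => h.memSobolev t t.2
  have hcont : Continuous G := by
    rw [continuous_iff_continuousAt]
    intro t₀
    have h1 := (tendsto_nhdsWithin_iff_subtype t₀.2 _ _).1 (h.continuous t₀ t₀.2)
    rw [ContinuousAt, tendsto_iff_edist_tendsto_0]
    refine h1.congr fun t => ?_
    have h2 : TemperedDistribution.besselPotential ℝ ℂ s (ofFun (u t) - ofFun (u t₀)) =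
        Lp.toTemperedDistribution (G t - G t₀) := by
      rw [map_sub, hG, hG]
      exact (map_sub (Lp.toTemperedDistributionCLM ℂ volume 2) (G t) (G t₀)).symm
    rw [Set.domRestrict_apply, normH, h2, normL_two_toTemperedDistribution, edist_eq_enorm_sub]
  -- The curve is extended by its endpoint values, so that it is continuous on the whole line and
  -- can be averaged freely.
  refine ⟨fun t => G (Set.projIcc 0 T hT t), hcont.comp continuous_projIcc, fun t ht => ?_⟩
  simp only [Set.projIcc_of_mem hT ht, ← hG]

theorem IsSolution.ofFun_eq (h : IsSolution p s T u₀ u) {t : ℝ} (ht : t ∈ Set.Icc 0 T) :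
    ofFun (u t) = Lp.toTemperedDistribution ((h.memLp t ht).toLp (u t)) :=
  ofFun_toLp _

theorem IsSolution.equation_initial (h : IsSolution p s T u₀ u) (φ : 𝓢(ℝ, ℂ)) {t : ℝ}
    (ht : t ∈ Set.Icc 0 T) :
    Complex.I * (∫ x, u t x * φ x) - Complex.I * (∫ x, u 0 x * φ x)
      + ∫ τ in (0 : ℝ)..t, ∫ x, u τ x * iteratedDeriv 2 φ x
      = ∫ τ in (0 : ℝ)..t, ∫ x, nonlin p (u τ) x * φ x := by
  have h1 : ∫ x, u 0 x * φ x = ∫ x, u₀ x * φ x :=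
    integral_congr_ae (by filter_upwards [h.initial] with x hx; rw [hx])
  rw [h1]
  exact h.equation φ t ht

/-- The mass of a solution is at most its initial mass. -/
theorem IsSolution.eLpNorm_le (hp : 1 < p) (hs : 0 ≤ s) (h : IsSolution p s T u₀ u) {t : ℝ}
    (ht : t ∈ Set.Icc 0 T) : eLpNorm (u t) 2 volume ≤ eLpNorm u₀ 2 volume := by
  obtain ⟨G, hG, hGu⟩ := h.exists_curve (ht.1.trans ht.2)
  obtain ⟨R, hR⟩ := (isCompact_Icc (a := 0) (b := T)).exists_bound_of_continuousOn hG.continuousOn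
  have hb := isBddSymbol_besselSymbol (neg_nonpos.2 hs)
  -- Compactness of `[0,T]` bounds the `H^s` norm, and `s ≥ 0` lets it control the `L²` norm.
  have huR : ∀ τ ∈ Set.Icc 0 T, eLpNorm (u τ) 2 volume ≤ ENNReal.ofReal R := by
    intro τ hτ
    have h1 : mult (besselSymbol (-s)) (G τ) = (h.memLp τ hτ).toLp (u τ) := by
      apply toTemperedDistribution_injective
      change Lp.toTemperedDistribution _ = Lp.toTemperedDistribution _
      rw [hb.toTemperedDistribution_mult, hGu τ hτ, ← h.ofFun_eq hτ, ← besselPotential_eq]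
      simp
    rw [← Lp.enorm_toLp (h.memLp τ hτ), ← h1, ← ofReal_norm]
    refine ENNReal.ofReal_le_ofReal ((hb.norm_mult_le _).trans ?_)
    rw [one_mul]
    exact hR τ hτ
  have hsub : Set.Icc 0 t ⊆ Set.Icc 0 T := Set.Icc_subset_Icc_right ht.2
  rw [← eLpNorm_congr_ae h.initial]
  exact eLpNorm_two_le_of_equation hp ht.1
    (h.memLp_spacetime.mono_measure (Measure.prod_mono (Measure.restrict_mono hsub le_rfl) le_rfl))
    (fun τ hτ => h.memLp τ (hsub hτ)) ENNReal.ofReal_ne_top (fun τ hτ => huR τ (hsub hτ))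
    fun φ τ hτ => h.equation_initial φ (hsub hτ)

/-- The function `Iu` as a continuous curve in `H¹`. -/
theorem IsSolution.exists_curve_opI (h : IsSolution p s T u₀ u) (hT : 0 ≤ T) (hs : s ≤ 1)
    (hN : 0 < N) (hm : IsIMultiplier s N m) :
    ∃ g : ℝ → L2, Continuous g ∧
      ∀ t ∈ Set.Icc 0 T, Lp.toTemperedDistribution (J (g t)) = opI m (ofFun (u t)) := by
  obtain ⟨G, hG, hGu⟩ := h.exists_curve hT
  obtain ⟨C, hC⟩ := hm.isBddSymbol_mul_bessel hN hs
  refine ⟨fun t => mult (iSymbol m * besselSymbol (1 - s)) (G t),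
    (mult _).continuous.comp hG, fun t ht => ?_⟩
  rw [toTemperedDistribution_J, hC.toTemperedDistribution_mult, hGu t ht, besselPotential_eq,
    TemperedDistribution.fourierMultiplierCLM_fourierMultiplierCLM_apply (besselSymbol_temperate _)
      hC.temperate,
    TemperedDistribution.fourierMultiplierCLM_fourierMultiplierCLM_apply
      ((besselSymbol_temperate _).mul hC.temperate) (besselSymbol_temperate _), opI_eq]
  congr 2
  -- The curve factors `Iu` as `⟨∇⟩⁻¹ · (I⟨∇⟩^{1-s}) · ⟨∇⟩^s u`, and the Bessel orders sum to zero.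
  have h1 : besselSymbol s * besselSymbol (1 - s) * besselSymbol (-1) = 1 := by
    rw [besselSymbol_mul, besselSymbol_mul, ← besselSymbol_zero]
    congr 1
    ring
  calc _ = iSymbol m * (besselSymbol s * besselSymbol (1 - s) * besselSymbol (-1)) := by ring
    _ = _ := by rw [h1, mul_one]

theorem IsSolution.enorm_J_le (hp : 1 < p) (hs0 : 0 ≤ s) (hs : s ≤ 1) (hN : 0 < N)
    (hm : IsIMultiplier s N m) (h : IsSolution p s T u₀ u) {t : ℝ} (ht : t ∈ Set.Icc 0 T) {a : L2}
    (ha : Lp.toTemperedDistribution a = opI m (ofFun (u t))) :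
    ‖a‖ₑ ≤ eLpNorm u₀ 2 volume := by
  have hI := hm.isBddSymbol hN hs
  have h1 : mult (iSymbol m) ((h.memLp t ht).toLp (u t)) = a := by
    apply toTemperedDistribution_injective
    change Lp.toTemperedDistribution _ = Lp.toTemperedDistribution _
    rw [hI.toTemperedDistribution_mult, ha, h.ofFun_eq ht, opI_eq]
  refine le_trans ?_ (h.eLpNorm_le hp hs0 ht)
  rw [← Lp.enorm_toLp (h.memLp t ht), ← h1, ← ofReal_norm, ← ofReal_norm]
  exact ENNReal.ofReal_le_ofReal ((hI.norm_mult_le _).trans_eq (one_mul _))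

end

/-- `ψ` is the transpose of `I` applied to `φ`; testing the equation for `u` against `ψ` yields the
equation for `Iu` tested against `φ`. -/
theorem exists_opI_apply (m : ℝ → ℝ) (φ : 𝓢(ℝ, ℂ)) :
    ∃ ψ : 𝓢(ℝ, ℂ), ∀ S : 𝓢'(ℝ, ℂ), opI m S φ = S ψ :=
  ⟨FourierTransform.fourier (SchwartzMap.smulLeftCLM ℂ (iSymbol m)
    (FourierTransformInv.fourierInv φ)), fun _ => rfl⟩

theorem secondDeriv_apply (φ : 𝓢(ℝ, ℂ)) (x : ℝ) : secondDeriv φ x = iteratedDeriv 2 φ x := by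
  rw [iteratedDeriv_succ, iteratedDeriv_one]
  rfl

/-! ### The equation for `Iu` and its error -/

section

variable {p s T N : ℝ} {u₀ : ℝ → ℂ} {u : ℝ → ℝ → ℂ} {m : ℝ → ℝ}

theorem derivCLM_derivCLM_opI (hs : s ≤ 1) (hN : 0 < N) (hm : IsIMultiplier s N m)
    (S : 𝓢'(ℝ, ℂ)) :
    opI m (TemperedDistribution.derivCLM ℂ (TemperedDistribution.derivCLM ℂ S)) =
      TemperedDistribution.derivCLM ℂ (TemperedDistribution.derivCLM ℂ (opI m S)) := by
  have hi := hm.iSymbol_temperate hN hs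
  have key (S : 𝓢'(ℝ, ℂ)) : opI m (TemperedDistribution.derivCLM ℂ S) =
      TemperedDistribution.derivCLM ℂ (opI m S) := by
    rw [distribution_derivCLM_eq, distribution_derivCLM_eq, opI_eq, opI_eq,
      TemperedDistribution.fourierMultiplierCLM_fourierMultiplierCLM_apply derivSymbol_temperate hi,
      TemperedDistribution.fourierMultiplierCLM_fourierMultiplierCLM_apply hi derivSymbol_temperate,
      mul_comm]
  rw [key, key]

theorem IsSolution.ae_memLp_nonlin (hp : 1 < p) (h : IsSolution p s T u₀ u) :
    ∀ᵐ τ ∂(volume.restrict (Set.Icc 0 T)),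
      MemLp (nonlin p (u τ)) (ENNReal.ofReal ((p + 1) / p)) volume := by
  have hp1 : 0 < p + 1 := by linarith
  obtain ⟨h1, h2⟩ := (memLp_ofReal_iff hp1).1 h.memLp_spacetime
  have hm := h1.enorm.pow_const (p + 1)
  rw [lintegral_prod _ hm] at h2
  filter_upwards [ae_lt_top' hm.lintegral_prod_right' h2.ne, ae_restrict_mem measurableSet_Icc]
    with τ h3 h4
  exact memLp_pw hp ((memLp_ofReal_iff hp1).2 ⟨(h.memLp τ h4).1, h3⟩)

theorem IsSolution.integrable_nonlin_mul (hp : 1 < p) (h : IsSolution p s T u₀ u)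
    (ψ : 𝓢(ℝ, ℂ)) :
    IntegrableOn (fun τ => ∫ x, nonlin p (u τ) x * ψ x) (Set.Icc 0 T) volume := by
  have h1 := memLp_pw hp h.memLp_spacetime
  have h2 : MemLp (fun z : ℝ × ℝ => ψ z.2) (ENNReal.ofReal (p + 1))
      ((volume.restrict (Set.Icc 0 T)).prod volume) :=
    (ψ.memLp _ volume).comp_snd _
  have := (holderConjugate_add_one hp).symm.ennrealOfReal
  exact (h1.integrable_mul h2).integral_prod_left

/-- The error is the difference of the two nonlinear terms. -/
theorem errorF_apply (hp : 1 < p) {f : ℝ → ℂ}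
    (hf : MemLp (nonlin p f) (ENNReal.ofReal ((p + 1) / p)) volume) {g : L2}
    (hg : Lp.toTemperedDistribution (J g) = opI m (ofFun f)) {φ ψ : 𝓢(ℝ, ℂ)}
    (hψ : ∀ S : 𝓢'(ℝ, ℂ), opI m S φ = S ψ) :
    errorF p m f φ = pairing φ (NJ hp g) - ∫ x, nonlin p f x * ψ x := by
  have hq : Fact (1 ≤ ENNReal.ofReal ((p + 1) / p)) := ⟨by
    rw [ENNReal.one_le_ofReal, le_div_iff₀ (by linarith)]
    linarith⟩
  have h1 : ofFun (nonlin p (toFun (opI m (ofFun f)))) = Lp.toTemperedDistribution (NJ hp g) := by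
    refine ((represents_Lp _).congr_ae ?_).ofFun_eq
    rw [← hg]
    filter_upwards [NJ_ae hp g, (represents_Lp (J g)).toFun_ae_eq] with x h2 h3
    rw [h2, nonlin_apply, h3]
  have h2 : ofFun (nonlin p f) ψ = ∫ x, nonlin p f x * ψ x := by
    rw [ofFun_toLp hf, ((represents_toLp hf) ψ).2]
    simp_rw [mul_comm]
  rw [← h2, ← hψ, pairing_apply, ← h1]
  rfl

/-- The equation for `Iu`: if `f` dominates the error, `Iu` is an almost solution. -/
theorem IsSolution.almostSolves (hp : 1 < p) (hs : s ≤ 1) (hN : 0 < N) (hm : IsIMultiplier s N m)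
    (h : IsSolution p s T u₀ u) {g : ℝ → L2} (hg : Continuous g)
    (hgu : ∀ t ∈ Set.Icc 0 T, Lp.toTemperedDistribution (J (g t)) = opI m (ofFun (u t)))
    {f : ℝ → ℝ} (hf0 : 0 ≤ f)
    (hf : ∀ a b, 0 ≤ a → a ≤ b → b ≤ T → ∫⁻ τ in Set.Ioc a b, normL 2 (errorF p m (u τ)) ≤
      ENNReal.ofReal (∫ τ in a..b, f τ)) :
    AlmostSolves hp T g f := by
  intro φ a b ha hab hb
  obtain ⟨ψ, hψ⟩ := exists_opI_apply m φ
  set A : ℝ → ℂ := fun τ => ∫ x, nonlin p (u τ) x * ψ x with hA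
  have hAi := h.integrable_nonlin_mul hp ψ
  have hAint {c d : ℝ} (hc : 0 ≤ c) (hcd : c ≤ d) (hd : d ≤ T) :
      IntervalIntegrable A volume c d := by
    rw [intervalIntegrable_iff_integrableOn_Icc_of_le hcd]
    exact hAi.mono_set (Set.Icc_subset_Icc hc hd)
  have hJg : Continuous fun τ => J (g τ) := J.continuous.comp hg
  have hQ : Continuous fun τ => pairing (secondDeriv φ) (J (g τ)) :=
    (pairing (secondDeriv φ)).continuous.comp hJg
  have hB : Continuous fun τ => pairing φ (NJ hp (g τ)) :=
    (pairing φ).continuous.comp ((continuous_NJ hp).comp hg)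
  have hu {t : ℝ} (ht : t ∈ Set.Icc 0 T) (χ : 𝓢(ℝ, ℂ)) : ∫ x, u t x * χ x = ofFun (u t) χ := by
    rw [h.ofFun_eq ht, ((represents_toLp (h.memLp t ht)) χ).2]
    simp_rw [mul_comm]
  have hP {t : ℝ} (ht : t ∈ Set.Icc 0 T) : ∫ x, u t x * ψ x = pairing φ (J (g t)) := by
    rw [hu ht, ← hψ, pairing_apply, hgu t ht]
  have hP2 {t : ℝ} (ht : t ∈ Set.Icc 0 T) :
      ∫ x, u t x * iteratedDeriv 2 ψ x = pairing (secondDeriv φ) (J (g t)) := by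
    simp_rw [← secondDeriv_apply]
    rw [hu ht, pairing_apply, hgu t ht, ← derivCLM_derivCLM_apply, ← derivCLM_derivCLM_apply,
      ← derivCLM_derivCLM_opI hs hN hm, hψ]
  have heq {t : ℝ} (ht : t ∈ Set.Icc 0 T) :
      Complex.I * pairing φ (J (g t)) - Complex.I * pairing φ (J (g 0)) +
        (∫ τ in (0 : ℝ)..t, pairing (secondDeriv φ) (J (g τ))) = ∫ τ in (0 : ℝ)..t, A τ := by
    have h1 := h.equation_initial ψ ht
    rw [hP ht, hP ⟨le_rfl, ht.1.trans ht.2⟩] at h1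
    rw [← h1]
    congr 1
    refine intervalIntegral.integral_congr fun τ hτ => ?_
    rw [Set.uIcc_of_le ht.1] at hτ
    exact (hP2 ⟨hτ.1, hτ.2.trans ht.2⟩).symm
  have h0b : 0 ≤ b := ha.trans hab
  have e1 := intervalIntegral.integral_interval_sub_left (hAint le_rfl h0b hb)
    (hAint le_rfl ha (hab.trans hb))
  have e2 := intervalIntegral.integral_interval_sub_left (hQ.intervalIntegrable (μ := volume) 0 b)
    (hQ.intervalIntegrable 0 a)
  have e3 : Complex.I * (pairing φ (J (g b)) - pairing φ (J (g a)))
      + (∫ τ in a..b, pairing (secondDeriv φ) (J (g τ)))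
      - ∫ τ in a..b, pairing φ (NJ hp (g τ)) =
      ∫ τ in Set.Ioc a b, (A τ - pairing φ (NJ hp (g τ))) := by
    rw [← intervalIntegral.integral_of_le hab, intervalIntegral.integral_sub (hAint ha hab hb)
      (hB.intervalIntegrable _ _), ← e1, ← e2, ← heq ⟨h0b, hb⟩, ← heq ⟨ha, hab.trans hb⟩]
    ring
  -- For almost every time the nonlinearity lies in `L^{(p+1)/p}`, so the difference of the
  -- nonlinear terms is the pairing with `errorF`.
  have herr : ∀ᵐ τ ∂(volume.restrict (Set.Ioc a b)), ‖A τ - pairing φ (NJ hp (g τ))‖ₑ ≤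
      normL 2 (errorF p m (u τ)) * ‖φ.toLp 2 (volume : Measure ℝ)‖ₑ := by
    have hsub : Set.Ioc a b ⊆ Set.Icc 0 T := fun τ hτ => ⟨ha.trans hτ.1.le, hτ.2.trans hb⟩
    filter_upwards [ae_restrict_of_ae_restrict_of_subset hsub (h.ae_memLp_nonlin hp),
      ae_restrict_mem measurableSet_Ioc] with τ h1 h2
    refine le_trans (le_of_eq ?_) (enorm_apply_le_normL _ _)
    rw [errorF_apply hp h1 (hgu τ (hsub h2)) hψ, ← enorm_neg, neg_sub]
  rw [e3]
  have h4 : ‖∫ τ in Set.Ioc a b, (A τ - pairing φ (NJ hp (g τ)))‖ₑ ≤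
      ENNReal.ofReal (∫ τ in a..b, f τ) * ‖φ.toLp 2 (volume : Measure ℝ)‖ₑ := by
    refine (enorm_integral_le_lintegral_enorm _).trans ((lintegral_mono_ae herr).trans ?_)
    rw [lintegral_mul_const' _ _ enorm_ne_top]
    gcongr
    exact hf a b ha hab hb
  have hf1 : 0 ≤ ∫ τ in a..b, f τ := intervalIntegral.integral_nonneg hab fun τ _ => hf0 τ
  rw [← ofReal_norm, ← ofReal_norm, ← ENNReal.ofReal_mul hf1,
    ENNReal.ofReal_le_ofReal_iff (by positivity)] at h4
  exact h4

end

/-! ### Degenerate cases, energy and majorants -/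

theorem PhiJ_nonneg {p : ℝ} (hp : 1 < p) (g : L2) : 0 ≤ PhiJ hp g := by
  rw [(PhiJ_eq hp g).2]
  exact integral_nonneg fun x => by positivity

theorem PhiJ_eq_zero {p : ℝ} (hp : 1 < p) {g : L2} (h : ‖J g‖ * ‖D g‖ = 0) : PhiJ hp g = 0 := by
  rw [(PhiJ_eq hp g).2]
  refine integral_eq_zero_of_ae ?_
  filter_upwards [ae_norm_sq_J_le g] with x hx
  have h1 : ‖J g x‖ = 0 := by
    rw [mul_assoc, h, mul_zero] at hx
    exact pow_eq_zero_iff two_ne_zero |>.1 (le_antisymm hx (sq_nonneg _))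
  rw [h1, Real.zero_rpow (by linarith), Pi.zero_apply]

/-- The energy gives the constant `√2`; it is rounded up to `2`. -/
theorem enorm_D_le_energy {p : ℝ} {S : 𝓢'(ℝ, ℂ)} {g : L2}
    (h : Lp.toTemperedDistribution (J g) = S) : ‖D g‖ₑ ≤ 2 * energy p S ^ (1 / 2 : ℝ) := by
  have h1 : normL 2 (TemperedDistribution.derivCLM ℂ S) = ‖D g‖ₑ := by
    rw [← h, ← toTemperedDistribution_D, normL_two_toTemperedDistribution]
  have h2 : ‖D g‖ₑ ^ (2 : ℝ) ≤ 2 ^ (2 : ℝ) * energy p S := by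
    rw [energy, h1, ENNReal.rpow_two, ENNReal.rpow_two, mul_add]
    refine le_add_right ?_
    rw [← mul_assoc, pow_two (2 : ℝ≥0∞), mul_assoc (2 : ℝ≥0∞),
      ENNReal.mul_inv_cancel two_ne_zero ENNReal.ofNat_ne_top, mul_one]
    exact le_mul_of_one_le_left zero_le one_le_two
  have h3 := ENNReal.rpow_le_rpow h2 (by norm_num : (0 : ℝ) ≤ 1 / 2)
  rw [ENNReal.mul_rpow_of_nonneg _ _ (by norm_num), ← ENNReal.rpow_mul, ← ENNReal.rpow_mul] at h3
  norm_num at h3 ⊢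
  exact h3

/-- A function of finite integral on `[0,T]` is dominated, after integration over subintervals, by
an integrable function with the same integral. -/
theorem exists_integrable_majorant {T : ℝ} {e : ℝ → ℝ≥0∞}
    (he : ∫⁻ t in Set.Icc 0 T, e t ≠ ⊤) :
    ∃ f : ℝ → ℝ, Integrable f ∧ 0 ≤ f ∧ ∫ t, f t = (∫⁻ t in Set.Icc 0 T, e t).toReal ∧
      ∀ a b, 0 ≤ a → a ≤ b → b ≤ T →
        ∫⁻ t in Set.Ioc a b, e t ≤ ENNReal.ofReal (∫ t in a..b, f t) := by
  rw [← lintegral_indicator measurableSet_Icc] at he ⊢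
  -- Measurability in time of the error norm is not assumed. The lower integral `∫⁻` is attained by
  -- a measurable function below `e` with the same integral over every measurable set.
  obtain ⟨k, hk, -, hke⟩ := exists_measurable_le_setLIntegral_eq_of_integrable he
  have hk1 : ∫⁻ t, k t = ∫⁻ t, (Set.Icc 0 T).indicator e t := by
    simpa using (hke Set.univ MeasurableSet.univ).symm
  have hk2 : ∫⁻ t, k t ≠ ⊤ := by rwa [hk1]
  have hfin : ∀ᵐ t ∂(volume : Measure ℝ), k t < ⊤ := ae_lt_top hk hk2
  refine ⟨fun t => (k t).toReal, integrable_toReal_of_lintegral_ne_top hk.aemeasurable hk2,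
    fun t => ENNReal.toReal_nonneg, ?_, fun a b ha hab hb => ?_⟩
  · rw [integral_toReal hk.aemeasurable hfin, hk1]
  · have hne : ∫⁻ t in Set.Ioc a b, k t ≠ ⊤ :=
      ne_top_of_le_ne_top hk2 (setLIntegral_le_lintegral _ _)
    rw [intervalIntegral.integral_of_le hab,
      integral_toReal hk.aemeasurable (ae_restrict_of_ae hfin), ENNReal.ofReal_toReal hne,
      ← hke _ measurableSet_Ioc]
    refine (setLIntegral_congr_fun measurableSet_Ioc fun t ht => ?_).le
    have hmem : t ∈ Set.Icc 0 T := ⟨ha.trans ht.1.le, ht.2.trans hb⟩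
    rw [Set.indicator_of_mem hmem]

end

end AlmostMorawetz

open AlmostMorawetz in
theorem lemma7p1 (p : ℝ) (hp : 1 < p) :
    ∃ C : ℝ≥0, ∀ (s : ℝ), 0 ≤ s → s ≤ 1 → ∀ (N : ℝ), 0 < N →
      ∀ (m : ℝ → ℝ), IsIMultiplier s N m →
      ∀ (T : ℝ), 0 < T → ∀ (u₀ : ℝ → ℂ) (u : ℝ → ℝ → ℂ), IsSolution p s T u₀ u →
        normMixed (p + 3) (p + 3) T (fun t => opI m (ofFun (u t))) ^ (p + 3) ≤
          C * (eLpNorm u₀ 2 volume ^ 3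
                * ⨆ t ∈ Set.Icc 0 T, energy p (opI m (ofFun (u t))) ^ (1 / 2 : ℝ))
          + C * (eLpNorm u₀ 2 volume ^ 2
                * (⨆ t ∈ Set.Icc 0 T, energy p (opI m (ofFun (u t))) ^ (1 / 2 : ℝ))
                * normMixed 1 2 T (fun t => errorF p m (u t))) := by
  have hc : 0 < (p - 1) / (p + 1) := div_pos (by linarith) (by linarith)
  have hC : 0 < 12 / ((p - 1) / (p + 1)) := by positivity
  -- The bound `2M³K + 6M²K ∫ f` with `K = 2E` has coefficients `4` and `12`; both are replaced by
  -- `12` and divided by `(p-1)/(p+1)`.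
  refine ⟨(12 / ((p - 1) / (p + 1))).toNNReal, fun s hs0 hs N hN m hm T hT u₀ u h => ?_⟩
  obtain ⟨g, hg, hgu⟩ := h.exists_curve_opI hT.le hs hN hm
  have hPc : Continuous fun t => PhiJ hp (g t) := (continuous_PhiJ hp).comp hg
  have hlhs : normMixed (p + 3) (p + 3) T (fun t => opI m (ofFun (u t))) ^ (p + 3) =
      ENNReal.ofReal (∫ t in (0 : ℝ)..T, PhiJ hp (g t)) := by
    rw [normMixed, ← ENNReal.rpow_mul, one_div_mul_cancel (by linarith), ENNReal.rpow_one,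
      intervalIntegral.integral_of_le hT.le, ← integral_Icc_eq_integral_Ioc,
      ofReal_integral_eq_lintegral_ofReal hPc.integrableOn_Icc
        (Eventually.of_forall fun t => PhiJ_nonneg hp _)]
    refine setLIntegral_congr_fun measurableSet_Icc fun t ht => ?_
    rw [← hgu t ht, (represents_Lp _).normL_eq, eLpNorm_J_rpow hp]
  have herr : normMixed 1 2 T (fun t => errorF p m (u t)) =
      ∫⁻ t in Set.Icc 0 T, normL 2 (errorF p m (u t)) := by
    simp [normMixed]
  rw [hlhs, herr]
  set A := eLpNorm u₀ 2 volume with hA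
  set E := ⨆ t ∈ Set.Icc 0 T, energy p (opI m (ofFun (u t))) ^ (1 / 2 : ℝ) with hE
  set F := ∫⁻ t in Set.Icc 0 T, normL 2 (errorF p m (u t)) with hF
  have hJ (t : ℝ) (ht : t ∈ Set.Icc 0 T) : ‖J (g t)‖ₑ ≤ A :=
    h.enorm_J_le hp hs0 hs hN hm ht (hgu t ht)
  have hD (t : ℝ) (ht : t ∈ Set.Icc 0 T) : ‖D (g t)‖ₑ ≤ 2 * E :=
    (enorm_D_le_energy (hgu t ht)).trans (mul_le_mul_right
      (le_iSup₂ (f := fun t _ => energy p (opI m (ofFun (u t))) ^ (1 / 2 : ℝ)) t ht) 2)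
  have hAtop : A ≠ ⊤ := by
    rw [hA, ← eLpNorm_congr_ae h.initial]
    exact (h.memLp 0 ⟨le_rfl, hT.le⟩).2.ne
  have hC0 : ((12 / ((p - 1) / (p + 1))).toNNReal : ℝ≥0∞) ≠ 0 := by simpa using hC
  -- Since `0 * ⊤ = 0`, the right side can be zero even when another factor is infinite. In this
  -- case `Iu` vanishes at every time, and so does the left side.
  by_cases hAE : A = 0 ∨ E = 0
  · have hzero : ∫ t in (0 : ℝ)..T, PhiJ hp (g t) = 0 := by
      refine (intervalIntegral.integral_congr (g := fun _ => 0) fun t ht => ?_).trans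
        intervalIntegral.integral_zero
      rw [Set.uIcc_of_le hT.le] at ht
      refine PhiJ_eq_zero hp (mul_eq_zero.2 ?_)
      rcases hAE with h0 | h0
      · have := hJ t ht
        rw [h0, nonpos_iff_eq_zero, enorm_eq_zero] at this
        exact Or.inl (norm_eq_zero.2 this)
      · have := hD t ht
        rw [h0, mul_zero, nonpos_iff_eq_zero, enorm_eq_zero] at this
        exact Or.inr (norm_eq_zero.2 this)
    rw [hzero, ENNReal.ofReal_zero]
    exact zero_le
  push Not at hAE
  obtain ⟨hA0, hE0⟩ := hAE
  by_cases hEtop : E = ⊤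
  · rw [hEtop, ENNReal.mul_top (pow_ne_zero 3 hA0), ENNReal.mul_top hC0, top_add]
    exact le_top
  by_cases hFtop : F = ⊤
  · rw [hFtop, ENNReal.mul_top (mul_ne_zero (pow_ne_zero 2 hA0) hE0), ENNReal.mul_top hC0, add_top]
    exact le_top
  obtain ⟨f, hfi, hf0, hfF, hf⟩ := exists_integrable_majorant hFtop
  have hsol := h.almostSolves hp hs hN hm hg hgu hf0 hf
  have hM (t : ℝ) (ht : t ∈ Set.Icc 0 T) : ‖J (g t)‖ ≤ A.toReal := by
    simpa using ENNReal.toReal_mono hAtop (hJ t ht)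
  have hK (t : ℝ) (ht : t ∈ Set.Icc 0 T) : ‖D (g t)‖ ≤ 2 * E.toReal := by
    simpa using ENNReal.toReal_mono (ENNReal.mul_ne_top ENNReal.ofNat_ne_top hEtop) (hD t ht)
  have hmain := hsol.integral_le hp hg hfi hf0 hM hK hT
  rw [hfF, mul_comm, ← le_div_iff₀ hc] at hmain
  have h1 : A ^ 3 * E ≠ ⊤ := ENNReal.mul_ne_top (ENNReal.pow_ne_top hAtop) hEtop
  have h2 : A ^ 2 * E * F ≠ ⊤ :=
    ENNReal.mul_ne_top (ENNReal.mul_ne_top (ENNReal.pow_ne_top hAtop) hEtop) hFtop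
  refine ENNReal.ofReal_le_of_le_toReal (hmain.trans ?_)
  rw [ENNReal.toReal_add (ENNReal.mul_ne_top ENNReal.coe_ne_top h1)
    (ENNReal.mul_ne_top ENNReal.coe_ne_top h2)]
  simp only [ENNReal.toReal_mul, ENNReal.toReal_pow, ENNReal.coe_toReal, Real.coe_toNNReal _ hC.le]
  have h3 : 0 ≤ A.toReal ^ 3 * E.toReal := by positivity
  calc _ = (4 * (A.toReal ^ 3 * E.toReal) + 12 * (A.toReal ^ 2 * E.toReal * F.toReal)) /
        ((p - 1) / (p + 1)) := by ring
    _ ≤ (12 * (A.toReal ^ 3 * E.toReal) + 12 * (A.toReal ^ 2 * E.toReal * F.toReal)) /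
        ((p - 1) / (p + 1)) := by gcongr; norm_num
    _ = _ := by ring
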